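/- Let $\mathbb{F}_q$ be a finite field with $q$ elements. For $r \le 8$, say that distinct rational points $P_1,\dots,P_r \in \mathbb{P}^2(\mathbb{F}_q)$ lie in general position if no three of them are collinear, no six of them lie on a conic, and no eight of them lie on a cubic curve that is singular at one of these eight points. (Here a conic, respectively a cubic, is the zero locus of a nonzero ternary form over $\mathbb{F}_q$ of degree $2$, respectively $3$, possibly reducible or non-reduced; it is singular at a rational point if the form and its three partial derivatives all vanish there.) Then: 1. $\mathbb{P}^2(\mathbb{F}_q)$ contains $7$ rational points in general position if and only if $q \ge 9$. 2. $\mathbb{P}^2(\mathbb{F}_q)$ contains $8$ rational points in general position if and only if $q = 16$ or $q \ge 19$. -/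

import Mathlib

open scoped LinearAlgebra.Projectivization

/-- The set of `K`-rational points of the projective plane over `K`, with homogeneous
coordinates indexed by `Fin 3`. -/
abbrev ProjPlane (K : Type*) [Field K] : Type _ := ℙ K (Fin 3 → K)

/-- The polynomial `F` vanishes at the point `p` of the projective plane: it vanishes at every
vector of homogeneous coordinates of `p`. -/
def VanishesAt {K : Type*} [Field K] (F : MvPolynomial (Fin 3) K) (p : ProjPlane K) : Prop :=
  ∀ (v : Fin 3 → K) (hv : v ≠ 0), Projectivization.mk K v hv = p → MvPolynomial.eval v F = 0

/-- For a form `F`, the plane curve `F = 0` passes through `p` and is singular there: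
`F` and its three partial derivatives vanish at `p`. -/
def SingularAt {K : Type*} [Field K] (F : MvPolynomial (Fin 3) K) (p : ProjPlane K) : Prop :=
  VanishesAt F p ∧ ∀ j : Fin 3, VanishesAt (MvPolynomial.pderiv j F) p

/-- `F` is the equation of a plane curve of degree `d` (possibly reducible or non-reduced):
a nonzero form of degree `d` in three variables. -/
def IsPlaneCurveEquation {K : Type*} [Field K] (d : ℕ) (F : MvPolynomial (Fin 3) K) : Prop :=
  F ≠ 0 ∧ F.IsHomogeneous d

/-- The points `P i`, `i : Fin r` (where `r ≤ 8`), are distinct and in general position. -/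
structure InGeneralPosition {K : Type*} [Field K] {r : ℕ} (P : Fin r → ProjPlane K) : Prop where
  /-- The points are distinct. -/
  distinct : Function.Injective P
  /-- No three of the points are collinear. -/
  no_three_collinear : ∀ T : Finset (Fin r), T.card = 3 →
    ¬ Projectivization.IsCollinear (P '' (T : Set (Fin r)))
  /-- No six of the points lie on a conic. -/
  no_six_on_conic : ∀ T : Finset (Fin r), T.card = 6 →
    ¬ ∃ F : MvPolynomial (Fin 3) K, IsPlaneCurveEquation 2 F ∧ ∀ i ∈ T, VanishesAt F (P i)
  /-- No eight of the points lie on a cubic that is singular at one of these points. -/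
  no_eight_on_singular_cubic : ∀ T : Finset (Fin r), T.card = 8 →
    ¬ ∃ F : MvPolynomial (Fin 3) K, IsPlaneCurveEquation 3 F ∧ (∀ i ∈ T, VanishesAt F (P i)) ∧
      ∃ i ∈ T, SingularAt F (P i)

/-! Existence over large fields comes from a cuspidal cubic. Its smooth points (1 : t : t³) are
parametrised by the additive group of K. If three of them are collinear, or six lie on a conic, then
the parameters sum to zero. If a cubic through eight of them is singular at the i-th, then tᵢ + ∑ tⱼ
= 0. The values to be kept nonzero, namely tᵢ − tⱼ, the sums of three, the sums of six, and tᵢ + ∑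
tⱼ, are up to sign those of an additive map from the E₈ root lattice to K at the 120 positive roots
(`vecGP_cuspidal`). Such maps exist once K has dimension 4 over its prime field for p = 2, dimension
3 for p = 3, dimension 2 for p ≥ 5, and for every prime p > 30 (`exists_vecGP_of_card_eq_pow`). For
the prime fields with 19, 23, 29 elements, and for seven points when q = 9, 11, 13, 17, explicit
points are certified by Gaussian elimination over coded fields (`vecGP_of_checkGP`).

Seven points need five different slopes through one of them, so q ≥ 5. For q = 5, 7, 8 four points
are moved to the standard frame and the rest is a finite search (`not_vecGP_of_noSeven`).

For eight points with q = 9, 11, 13, 17, the cubics through them form a pencil. General position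
makes all its members smooth at the eight points and gives a ninth base point different from them
(`AdaptedPts.exists_ninth`). Counting incidences between the q² + q + 1 points and the q + 1 members
gives at least q² + 10q + 1, so some member has at least 18, 20, 22, 26 points respectively
(`AdaptedPts.exists_member`). A member contains no rational line, and a smooth rational point on it
brings it to a Weierstrass form or to a double cover given by a quartic
(`Carries.exists_normalForm`). Tabulating all such equations shows that for q = 9, 11, 13 no member
has so many points (`not_vecGP_of_countCheck`).

For q = 17 one curve survives up to projective equivalence: z² = x³ + 3x, with 26 points and cyclic
group. On it three labels in ℤ/26 with sum zero give collinear points and six give points on a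
conic. A search over sets of eight labels finds in each remaining case a cubic through the eight
points that is singular at one of them (`not_vecGP_curve`). -/

namespace PlanePoints

/-! ### Ternary forms as coefficient vectors, linear substitution, and general position of
coordinate vectors. -/

section Forms

open MvPolynomial

variable {K : Type*} [Field K]

/-- The form with monomials `e i` and coefficients `c i`. -/
noncomputable def formOf {n : ℕ} (e : Fin n → Fin 3 → ℕ) (c : Fin n → K) : MvPolynomial (Fin 3) K :=
  ∑ i, monomial (Finsupp.equivFunOnFinite.symm (e i)) (c i)

theorem eval_formOf {n : ℕ} (e : Fin n → Fin 3 → ℕ) (c : Fin n → K) (v : Fin 3 → K) :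
    eval v (formOf e c) = ∑ i, c i * ∏ j, v j ^ e i j := by
  simp only [formOf, map_sum, eval_monomial]
  refine Finset.sum_congr rfl fun i _ => ?_
  rw [Finsupp.prod_fintype _ _ (by simp)]
  simp

theorem eval_pderiv_formOf {n : ℕ} (e : Fin n → Fin 3 → ℕ) (c : Fin n → K) (v : Fin 3 → K)
    (k : Fin 3) :
    eval v (pderiv k (formOf e c)) =
      ∑ i, c i * (e i k : K) * ∏ j, v j ^ (e i j - if j = k then 1 else 0) := by
  simp only [formOf, map_sum, pderiv_monomial, eval_monomial]
  refine Finset.sum_congr rfl fun i _ => ?_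
  rw [Finsupp.prod_fintype _ _ (by simp)]
  simp [Finsupp.single_apply, eq_comm]

theorem formOf_isHomogeneous {n d : ℕ} (e : Fin n → Fin 3 → ℕ) (he : ∀ i, ∑ j, e i j = d)
    (c : Fin n → K) : (formOf e c).IsHomogeneous d := by
  refine IsHomogeneous.sum _ _ _ fun i _ => isHomogeneous_monomial _ ?_
  rw [Finsupp.degree_eq_sum]
  simpa using he i

theorem coeff_formOf {n : ℕ} (e : Fin n → Fin 3 → ℕ) (he : Function.Injective e)
    (c : Fin n → K) (i : Fin n) :
    coeff (Finsupp.equivFunOnFinite.symm (e i)) (formOf e c) = c i := by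
  simp only [formOf, coeff_sum, coeff_monomial, EmbeddingLike.apply_eq_iff_eq]
  rw [Finset.sum_eq_single i]
  · simp
  · intro j _ hj
    rw [if_neg fun h => hj (he h)]
  · simp

theorem formOf_ne_zero {n : ℕ} (e : Fin n → Fin 3 → ℕ) (he : Function.Injective e)
    {c : Fin n → K} (hc : c ≠ 0) : formOf e c ≠ 0 := by
  intro h
  apply hc
  funext i
  rw [← coeff_formOf e he c i, h]
  simp

theorem weight_one_fin3 (m : Fin 3 →₀ ℕ) : Finsupp.weight (1 : Fin 3 → ℕ) m = ∑ j, m j := by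
  rw [Finsupp.weight_apply, Finsupp.sum_fintype _ _ (by simp)]
  simp

theorem exists_eq_formOf {n d : ℕ} (e : Fin n → Fin 3 → ℕ) (he : Function.Injective e)
    (hs : ∀ m : Fin 3 → ℕ, ∑ j, m j = d → ∃ i, e i = m) {F : MvPolynomial (Fin 3) K}
    (hF : F.IsHomogeneous d) : ∃ c : Fin n → K, F = formOf e c := by
  refine ⟨fun i => coeff (Finsupp.equivFunOnFinite.symm (e i)) F, ?_⟩
  ext m
  by_cases hm : coeff m F = 0
  · rw [hm]
    by_cases h : ∃ i, Finsupp.equivFunOnFinite.symm (e i) = m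
    · obtain ⟨i, rfl⟩ := h
      rw [coeff_formOf e he, hm]
    · push Not at h
      simp only [formOf, coeff_sum, coeff_monomial]
      rw [Finset.sum_eq_zero]
      intro i _
      rw [if_neg (h i)]
  · obtain ⟨i, hi⟩ := hs m (by
      have := hF hm
      rwa [weight_one_fin3] at this)
    have : m = Finsupp.equivFunOnFinite.symm (e i) := by
      rw [hi]; ext; simp
    rw [this, coeff_formOf e he]

/-- The exponents of the monomials of degree two. -/
def expTwo : Fin 6 → Fin 3 → ℕ :=
  ![![2, 0, 0], ![1, 1, 0], ![1, 0, 1], ![0, 2, 0], ![0, 1, 1], ![0, 0, 2]]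

/-- The exponents of the monomials of degree three. -/
def expThree : Fin 10 → Fin 3 → ℕ :=
  ![![3, 0, 0], ![2, 1, 0], ![2, 0, 1], ![1, 2, 0], ![1, 1, 1], ![1, 0, 2], ![0, 3, 0],
    ![0, 2, 1], ![0, 1, 2], ![0, 0, 3]]

theorem expTwo_injective : Function.Injective expTwo := by decide

theorem expThree_injective : Function.Injective expThree := by decide

theorem expTwo_sum (i : Fin 6) : ∑ j, expTwo i j = 2 := by
  revert i; decide

theorem expThree_sum (i : Fin 10) : ∑ j, expThree i j = 3 := by
  revert i; decide

theorem expTwo_surj (m : Fin 3 → ℕ) (hm : ∑ j, m j = 2) : ∃ i, expTwo i = m := by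
  have key : ∀ a < 3, ∀ b < 3, ∀ c < 3, a + b + c = 2 → ∃ i, expTwo i = ![a, b, c] := by decide
  rw [Fin.sum_univ_three] at hm
  obtain ⟨i, hi⟩ := key (m 0) (by omega) (m 1) (by omega) (m 2) (by omega) hm
  exact ⟨i, hi.trans (List.ofFn_inj.mp rfl)⟩

theorem expThree_surj (m : Fin 3 → ℕ) (hm : ∑ j, m j = 3) : ∃ i, expThree i = m := by
  have key : ∀ a < 4, ∀ b < 4, ∀ c < 4, a + b + c = 3 → ∃ i, expThree i = ![a, b, c] := by decide
  rw [Fin.sum_univ_three] at hm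
  obtain ⟨i, hi⟩ := key (m 0) (by omega) (m 1) (by omega) (m 2) (by omega) hm
  exact ⟨i, hi.trans (List.ofFn_inj.mp rfl)⟩

/-- The linear form with coefficients `a`. -/
def linForm (a v : Fin 3 → K) : K := a 0 * v 0 + a 1 * v 1 + a 2 * v 2

/-- The quadratic form with coefficients `c`. -/
def quadForm (c : Fin 6 → K) (v : Fin 3 → K) : K :=
  c 0 * v 0 ^ 2 + c 1 * (v 0 * v 1) + c 2 * (v 0 * v 2) + c 3 * v 1 ^ 2 + c 4 * (v 1 * v 2) +
    c 5 * v 2 ^ 2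

/-- The cubic form with coefficients `c`. -/
def cubForm (c : Fin 10 → K) (v : Fin 3 → K) : K :=
  c 0 * v 0 ^ 3 + c 1 * (v 0 ^ 2 * v 1) + c 2 * (v 0 ^ 2 * v 2) + c 3 * (v 0 * v 1 ^ 2) +
    c 4 * (v 0 * v 1 * v 2) + c 5 * (v 0 * v 2 ^ 2) + c 6 * v 1 ^ 3 + c 7 * (v 1 ^ 2 * v 2) +
    c 8 * (v 1 * v 2 ^ 2) + c 9 * v 2 ^ 3

/-- The gradient of a cubic form. -/
def cubGrad (c : Fin 10 → K) (v : Fin 3 → K) : Fin 3 → K :=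
  ![3 * c 0 * v 0 ^ 2 + 2 * c 1 * (v 0 * v 1) + 2 * c 2 * (v 0 * v 2) + c 3 * v 1 ^ 2 +
      c 4 * (v 1 * v 2) + c 5 * v 2 ^ 2,
    c 1 * v 0 ^ 2 + 2 * c 3 * (v 0 * v 1) + c 4 * (v 0 * v 2) + 3 * c 6 * v 1 ^ 2 +
      2 * c 7 * (v 1 * v 2) + c 8 * v 2 ^ 2,
    c 2 * v 0 ^ 2 + c 4 * (v 0 * v 1) + 2 * c 5 * (v 0 * v 2) + c 7 * v 1 ^ 2 +
      2 * c 8 * (v 1 * v 2) + 3 * c 9 * v 2 ^ 2]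

theorem eval_formOf_expTwo (c : Fin 6 → K) (v : Fin 3 → K) :
    eval v (formOf expTwo c) = quadForm c v := by
  rw [eval_formOf]
  simp [Fin.sum_univ_succ, Fin.prod_univ_succ, expTwo, quadForm]
  ring!

theorem eval_formOf_expThree (c : Fin 10 → K) (v : Fin 3 → K) :
    eval v (formOf expThree c) = cubForm c v := by
  rw [eval_formOf]
  simp [Fin.sum_univ_succ, Fin.prod_univ_succ, expThree, cubForm]
  ring!

theorem eval_pderiv_formOf_expThree (c : Fin 10 → K) (v : Fin 3 → K) (k : Fin 3) :
    eval v (pderiv k (formOf expThree c)) = cubGrad c v k := by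
  rw [eval_pderiv_formOf]
  fin_cases k <;>
  · simp [Fin.sum_univ_succ, Fin.prod_univ_succ, expThree, cubGrad]
    ring!

/-- Linear substitution in a polynomial. -/
noncomputable def linSubst (M : Matrix (Fin 3) (Fin 3) K) (F : MvPolynomial (Fin 3) K) :
    MvPolynomial (Fin 3) K :=
  aeval (fun i => ∑ j, C (M i j) * X j) F

theorem eval_linSubst (M : Matrix (Fin 3) (Fin 3) K) (F : MvPolynomial (Fin 3) K)
    (v : Fin 3 → K) : eval v (linSubst M F) = eval (M.mulVec v) F := by
  induction F using MvPolynomial.induction_on with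
  | C a => simp [linSubst]
  | add p q hp hq => simp only [linSubst, map_add] at hp hq ⊢; rw [hp, hq]
  | mul_X p i hp =>
    simp only [linSubst, map_mul, aeval_X, eval_X] at hp ⊢
    rw [hp]
    simp [Matrix.mulVec, dotProduct]

/-- The chain rule. It carries the singularity condition through a change of coordinates. -/
theorem eval_pderiv_linSubst (M : Matrix (Fin 3) (Fin 3) K) (F : MvPolynomial (Fin 3) K)
    (v : Fin 3 → K) (k : Fin 3) :
    eval v (pderiv k (linSubst M F)) = ∑ i, M i k * eval (M.mulVec v) (pderiv i F) := by
  induction F using MvPolynomial.induction_on with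
  | C a => simp [linSubst]
  | add p q hp hq =>
    simp only [linSubst, map_add] at hp hq ⊢
    rw [hp, hq, ← Finset.sum_add_distrib]
    exact Finset.sum_congr rfl fun i _ => by ring
  | mul_X p i hp =>
    have h1 : linSubst M (p * X i) = linSubst M p * ∑ j, C (M i j) * X j := by
      simp [linSubst]
    have h2 : eval v (pderiv k (∑ j, C (M i j) * X j)) = M i k := by
      simp [pderiv_X, Pi.single_apply]
    have h3 : eval v (∑ j, C (M i j) * X j) = M.mulVec v i := by
      simp [Matrix.mulVec, dotProduct]
    rw [h1, Derivation.leibniz, map_add, smul_eq_mul, smul_eq_mul, map_mul, map_mul, h2, h3, hp,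
      eval_linSubst]
    simp only [Derivation.leibniz, smul_eq_mul, map_add, map_mul, eval_X, pderiv_X, mul_add,
      Finset.sum_add_distrib]
    congr 1
    · rw [Finset.sum_eq_single i]
      · simp [mul_comm]
      · intro j _ hj
        rw [Pi.single_eq_of_ne hj.symm]
        simp
      · simp
    · rw [Finset.mul_sum]
      exact Finset.sum_congr rfl fun j _ => by ring

theorem linSubst_linSubst (M N : Matrix (Fin 3) (Fin 3) K) (F : MvPolynomial (Fin 3) K) :
    linSubst M (linSubst N F) = linSubst (N * M) F := by
  induction F using MvPolynomial.induction_on with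
  | C a => simp [linSubst]
  | add p q hp hq => simp only [linSubst, map_add] at hp hq ⊢; rw [hp, hq]
  | mul_X p i hp =>
    have h : ∀ (L : Matrix (Fin 3) (Fin 3) K) (p q : MvPolynomial (Fin 3) K),
      linSubst L (p * q) = linSubst L p * linSubst L q := fun L p q => by simp [linSubst]
    have hX : ∀ (L : Matrix (Fin 3) (Fin 3) K), linSubst L (X i) = ∑ j, C (L i j) * X j :=
      fun L => by simp [linSubst]
    have hs : linSubst M (∑ j, C (N i j) * X j) = ∑ j, C (N i j) * ∑ k, C (M j k) * X k := by
      simp [linSubst]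
    rw [h, h, h, hp, hX, hX, hs]
    congr 1
    simp only [Matrix.mul_apply, Fin.sum_univ_three, map_add, map_mul]
    ring

theorem linSubst_one (F : MvPolynomial (Fin 3) K) : linSubst 1 F = F := by
  have : (fun i => ∑ j, C ((1 : Matrix (Fin 3) (Fin 3) K) i j) * X j) =
      (X : Fin 3 → MvPolynomial (Fin 3) K) := by
    funext i
    simp [Matrix.one_apply, apply_ite C]
  rw [linSubst, this, aeval_X_left_apply]

theorem linSubst_isHomogeneous (M : Matrix (Fin 3) (Fin 3) K) {F : MvPolynomial (Fin 3) K} {d : ℕ}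
    (hF : F.IsHomogeneous d) : (linSubst M F).IsHomogeneous d := by
  have := hF.aeval (n := 1) (fun i => ∑ j, C (M i j) * X j : Fin 3 → MvPolynomial (Fin 3) K)
    (fun i => IsHomogeneous.sum _ _ _ fun j _ => (isHomogeneous_X _ _).C_mul _)
  rwa [one_mul] at this

theorem linSubst_ne_zero {M N : Matrix (Fin 3) (Fin 3) K} (hMN : M * N = 1)
    {F : MvPolynomial (Fin 3) K} (hF : F ≠ 0) : linSubst M F ≠ 0 := by
  intro h
  apply hF
  rw [← linSubst_one F, ← hMN, ← linSubst_linSubst, h]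
  simp [linSubst]

/-- General position for points of the plane given by vectors of homogeneous coordinates. -/
structure VecGP {r : ℕ} (v : Fin r → Fin 3 → K) : Prop where
  ne_zero : ∀ i, v i ≠ 0
  line : ∀ i j k, i ≠ j → i ≠ k → j ≠ k → ∀ a : Fin 3 → K, a ≠ 0 → linForm a (v i) = 0 →
    linForm a (v j) = 0 → linForm a (v k) ≠ 0
  conic : ∀ T : Finset (Fin r), T.card = 6 → ∀ c : Fin 6 → K, c ≠ 0 →
    ∃ i ∈ T, quadForm c (v i) ≠ 0
  cubic : ∀ T : Finset (Fin r), T.card = 8 → ∀ c : Fin 10 → K, c ≠ 0 →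
    (∀ i ∈ T, cubForm c (v i) = 0) → ∀ i ∈ T, cubGrad c (v i) ≠ 0

theorem eval_eq_zero_of_mk_eq {F : MvPolynomial (Fin 3) K} {d : ℕ} (hF : F.IsHomogeneous d)
    {v w : Fin 3 → K} (hv : v ≠ 0) (hw : w ≠ 0)
    (h : Projectivization.mk K v hv = Projectivization.mk K w hw) (h0 : eval w F = 0) :
    eval v F = 0 := by
  obtain ⟨a, rfl⟩ := (Projectivization.mk_eq_mk_iff' K v w hv hw).1 h
  obtain ⟨s, hs⟩ : ∃ s : K, eval (a • w) F = s * eval w F := by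
    refine ⟨a ^ d, ?_⟩
    rw [eval_eq', eval_eq', Finset.mul_sum]
    refine Finset.sum_congr rfl fun m hm => ?_
    have h1 := hF (mem_support_iff.1 hm)
    rw [weight_one_fin3] at h1
    have h1' : a ^ d = ∏ i, a ^ m i := by rw [Finset.prod_pow_eq_pow_sum, h1]
    simp only [Pi.smul_apply, smul_eq_mul, mul_pow, Finset.prod_mul_distrib, h1']
    ring
  rw [hs, h0, mul_zero]

theorem vanishesAt_mk_iff {F : MvPolynomial (Fin 3) K} {d : ℕ} (hF : F.IsHomogeneous d)
    {v : Fin 3 → K} (hv : v ≠ 0) : VanishesAt F (Projectivization.mk K v hv) ↔ eval v F = 0 :=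
  ⟨fun h => h v hv rfl, fun h _ hw e => eval_eq_zero_of_mk_eq hF hw hv e h⟩

theorem singularAt_mk_iff {F : MvPolynomial (Fin 3) K} {d : ℕ} (hF : F.IsHomogeneous d)
    {v : Fin 3 → K} (hv : v ≠ 0) : SingularAt F (Projectivization.mk K v hv) ↔
      eval v F = 0 ∧ ∀ j, eval v (pderiv j F) = 0 := by
  unfold SingularAt
  rw [vanishesAt_mk_iff hF hv]
  exact and_congr_right fun _ => forall_congr' fun j => vanishesAt_mk_iff hF.pderiv hv

/-- A linear form as a linear map. -/
def linFormMap (a : Fin 3 → K) : (Fin 3 → K) →ₗ[K] K where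
  toFun := linForm a
  map_add' x y := by simp [linForm]; ring
  map_smul' c x := by simp [linForm]; ring

theorem isCollinear_of_linForm {S : Set (ProjPlane K)} {a : Fin 3 → K} (ha : a ≠ 0)
    (h : ∀ p ∈ S, linForm a p.rep = 0) : Projectivization.IsCollinear S := by
  refine ⟨(LinearMap.ker (linFormMap a)).projectivization, inferInstance, ?_, ?_⟩
  · rw [Projectivization.Subspace.submodule.apply_symm_apply]
    have hne : linFormMap a ≠ 0 := by
      intro h0
      apply ha
      funext i
      have := LinearMap.congr_fun h0 (Pi.single i 1)
      fin_cases i <;> simpa [linFormMap, linForm] using this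
    have h1 := Module.Dual.finrank_ker_add_one_of_ne_zero (f := linFormMap a) hne
    simp at h1
    omega
  · intro p hp
    have := h p hp
    rw [← p.mk_rep]
    exact this

theorem exists_linForm_of_isCollinear {S : Set (ProjPlane K)}
    (h : Projectivization.IsCollinear S) : ∃ a : Fin 3 → K, a ≠ 0 ∧
      ∀ (v : Fin 3 → K) (hv : v ≠ 0), Projectivization.mk K v hv ∈ S → linForm a v = 0 := by
  obtain ⟨M, -, h2, h3⟩ := h
  have hlt : Projectivization.Subspace.submodule M < ⊤ := by
    rw [lt_top_iff_ne_top]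
    intro h
    rw [h] at h2
    simp at h2
  obtain ⟨f, hf, hM⟩ := Submodule.exists_le_ker_of_lt_top _ hlt
  have key : ∀ v, f v = linForm (fun i => f (Pi.single i 1)) v := by
    intro v
    conv_lhs => rw [← Finset.univ_sum_single v]
    have h1 : ∀ i, f (Pi.single i (v i)) = f (Pi.single i 1) * v i := by
      intro i
      have : (Pi.single i (v i) : Fin 3 → K) = v i • Pi.single i 1 := by
        rw [← Pi.single_smul]; simp
      rw [this, map_smul, smul_eq_mul, mul_comm]
    simp [h1, Fin.sum_univ_three, linForm]
  refine ⟨fun i => f (Pi.single i 1), ?_, ?_⟩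
  · intro h0
    apply hf
    ext v
    simpa using congrFun h0 v
  · intro v hv hvS
    rw [← key]
    exact hM ((Projectivization.Subspace.mem_submodule_iff M hv).2 (h3 hvS))

theorem VecGP.inGeneralPosition {r : ℕ} (hr : 3 ≤ r) {v : Fin r → Fin 3 → K} (h : VecGP v) :
    InGeneralPosition fun i => Projectivization.mk K (v i) (h.ne_zero i) where
  distinct := by
    intro i j hij
    by_contra hne
    -- Two equal points would be collinear with any third one, so distinctness follows from the line
    -- condition as soon as a third index exists.
    obtain ⟨k, hk⟩ : ∃ k : Fin r, k ∉ ({i, j} : Finset (Fin r)) := by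
      by_contra hc
      push Not at hc
      have : (Finset.univ : Finset (Fin r)) ⊆ {i, j} := fun x _ => hc x
      have := (Finset.card_le_card this).trans Finset.card_le_two
      simp at this
      omega
    simp only [Finset.mem_insert, Finset.mem_singleton, not_or] at hk
    obtain ⟨a, ha, hS⟩ := exists_linForm_of_isCollinear
      (Projectivization.isCollinear_pair (Projectivization.mk K (v i) (h.ne_zero i))
        (Projectivization.mk K (v k) (h.ne_zero k)))
    refine h.line i j k hne (Ne.symm hk.1) (Ne.symm hk.2) a ha (hS _ (h.ne_zero i) (by simp)) (hS _ (h.ne_zero j) ?_)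
      (hS _ (h.ne_zero k) (by simp))
    left
    exact hij.symm
  no_three_collinear := by
    intro T hT hcol
    obtain ⟨i, j, k, hij, hik, hjk, rfl⟩ := Finset.card_eq_three.1 hT
    obtain ⟨a, ha, hS⟩ := exists_linForm_of_isCollinear hcol
    exact h.line i j k hij hik hjk a ha (hS _ (h.ne_zero i) ⟨i, by simp, rfl⟩)
      (hS _ (h.ne_zero j) ⟨j, by simp, rfl⟩) (hS _ (h.ne_zero k) ⟨k, by simp, rfl⟩)
  no_six_on_conic := by
    rintro T hT ⟨F, ⟨hF0, hF⟩, hv⟩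
    obtain ⟨c, rfl⟩ := exists_eq_formOf expTwo expTwo_injective expTwo_surj hF
    obtain ⟨i, hi, hne⟩ := h.conic T hT c (by rintro rfl; simp [formOf] at hF0)
    apply hne
    rw [← eval_formOf_expTwo]
    exact (vanishesAt_mk_iff hF (h.ne_zero i)).1 (hv i hi)
  no_eight_on_singular_cubic := by
    rintro T hT ⟨F, ⟨hF0, hF⟩, hv, i, hi, hs⟩
    obtain ⟨c, rfl⟩ := exists_eq_formOf expThree expThree_injective expThree_surj hF
    refine h.cubic T hT c (by rintro rfl; simp [formOf] at hF0) ?_ i hi ?_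
    · intro j hj
      rw [← eval_formOf_expThree]
      exact (vanishesAt_mk_iff hF (h.ne_zero j)).1 (hv j hj)
    · funext k
      rw [← eval_pderiv_formOf_expThree]
      exact ((singularAt_mk_iff hF (h.ne_zero i)).1 hs).2 k

theorem exists_quadForm_comp {M N : Matrix (Fin 3) (Fin 3) K} (hMN : M * N = 1) {c : Fin 6 → K}
    (hc : c ≠ 0) : ∃ d : Fin 6 → K, d ≠ 0 ∧ ∀ v, quadForm d v = quadForm c (M.mulVec v) := by
  obtain ⟨d, hd⟩ := exists_eq_formOf expTwo expTwo_injective expTwo_surj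
    (linSubst_isHomogeneous M (formOf_isHomogeneous expTwo expTwo_sum c))
  refine ⟨d, ?_, fun v => ?_⟩
  · rintro rfl
    apply linSubst_ne_zero hMN (formOf_ne_zero expTwo expTwo_injective hc)
    rw [hd]
    simp [formOf]
  · rw [← eval_formOf_expTwo, ← hd, eval_linSubst, eval_formOf_expTwo]

theorem exists_cubForm_comp {M N : Matrix (Fin 3) (Fin 3) K} (hMN : M * N = 1) {c : Fin 10 → K}
    (hc : c ≠ 0) : ∃ d : Fin 10 → K, d ≠ 0 ∧ (∀ v, cubForm d v = cubForm c (M.mulVec v)) ∧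
      ∀ v k, cubGrad d v k = ∑ i, M i k * cubGrad c (M.mulVec v) i := by
  obtain ⟨d, hd⟩ := exists_eq_formOf expThree expThree_injective expThree_surj
    (linSubst_isHomogeneous M (formOf_isHomogeneous expThree expThree_sum c))
  refine ⟨d, ?_, fun v => ?_, fun v k => ?_⟩
  · rintro rfl
    apply linSubst_ne_zero hMN (formOf_ne_zero expThree expThree_injective hc)
    rw [hd]
    simp [formOf]
  · rw [← eval_formOf_expThree, ← hd, eval_linSubst, eval_formOf_expThree]
  · rw [← eval_pderiv_formOf_expThree, ← hd, eval_pderiv_linSubst]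
    simp only [eval_pderiv_formOf_expThree]

theorem linForm_mulVec (M : Matrix (Fin 3) (Fin 3) K) (a v : Fin 3 → K) :
    linForm a (M.mulVec v) = linForm (Matrix.vecMul a M) v := by
  simp only [linForm, Matrix.mulVec, Matrix.vecMul, dotProduct, Fin.sum_univ_three]
  ring

/-- General position is invariant under projective transformations. -/
theorem VecGP.mulVec {r : ℕ} {v : Fin r → Fin 3 → K} (h : VecGP v)
    {M N : Matrix (Fin 3) (Fin 3) K} (hMN : M * N = 1) : VecGP fun i => M.mulVec (v i) where
  ne_zero i h0 := by
    apply h.ne_zero i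
    have := congrArg N.mulVec h0
    rwa [Matrix.mulVec_mulVec, mul_eq_one_comm.1 hMN, Matrix.one_mulVec, Matrix.mulVec_zero] at this
  line i j k hij hik hjk a ha := by
    simp only [linForm_mulVec]
    refine h.line i j k hij hik hjk _ fun h0 => ha ?_
    have := congrArg (Matrix.vecMul · N) h0
    simpa [Matrix.vecMul_vecMul, hMN] using this
  conic T hT c hc := by
    obtain ⟨d, hd, hdc⟩ := exists_quadForm_comp hMN hc
    obtain ⟨i, hi, hne⟩ := h.conic T hT d hd
    exact ⟨i, hi, by rwa [← hdc]⟩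
  cubic T hT c hc hv i hi h0 := by
    obtain ⟨d, hd, hdc, hg⟩ := exists_cubForm_comp hMN hc
    refine h.cubic T hT d hd (fun i hi => by rw [hdc]; exact hv i hi) i hi ?_
    funext k
    rw [hg, h0]
    simp

theorem VecGP.smul {r : ℕ} {v : Fin r → Fin 3 → K} (h : VecGP v) {u : Fin r → K}
    (hu : ∀ i, u i ≠ 0) : VecGP fun i => u i • v i := by
  have hl : ∀ (a : Fin 3 → K) (i), linForm a (u i • v i) = u i * linForm a (v i) := by
    intro a i; simp [linForm]; ring
  have hq : ∀ (c : Fin 6 → K) (i), quadForm c (u i • v i) = u i ^ 2 * quadForm c (v i) := by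
    intro a i; simp [quadForm]; ring
  have hc : ∀ (c : Fin 10 → K) (i), cubForm c (u i • v i) = u i ^ 3 * cubForm c (v i) := by
    intro a i; simp [cubForm]; ring
  have hg : ∀ (c : Fin 10 → K) (i), cubGrad c (u i • v i) = u i ^ 2 • cubGrad c (v i) := by
    intro a i; funext k; fin_cases k <;> simp [cubGrad] <;> ring
  refine ⟨fun i => smul_ne_zero (hu i) (h.ne_zero i), ?_, ?_, ?_⟩
  · intro i j k hij hik hjk a ha h1 h2
    rw [hl] at h1 h2 ⊢
    have h1 := (mul_eq_zero.1 h1).resolve_left (hu i)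
    have h2 := (mul_eq_zero.1 h2).resolve_left (hu j)
    exact mul_ne_zero (hu k) (h.line i j k hij hik hjk a ha h1 h2)
  · intro T hT c h0
    obtain ⟨i, hi, hne⟩ := h.conic T hT c h0
    exact ⟨i, hi, by rw [hq]; exact mul_ne_zero (pow_ne_zero _ (hu i)) hne⟩
  · intro T hT c h0 hv i hi
    rw [hg]
    refine smul_ne_zero (pow_ne_zero _ (hu i)) (h.cubic T hT c h0 (fun j hj => ?_) i hi)
    have := hv j hj
    rw [hc] at this
    exact (mul_eq_zero.1 this).resolve_left (pow_ne_zero _ (hu j))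

theorem _root_.InGeneralPosition.vecGP {r : ℕ} {P : Fin r → ProjPlane K}
    (h : InGeneralPosition P) : VecGP fun i => (P i).rep where
  ne_zero i := (P i).rep_nonzero
  line i j k hij hik hjk a ha h1 h2 h3 := by
    refine h.no_three_collinear {i, j, k} (Finset.card_eq_three.2 ⟨i, j, k, hij, hik, hjk, rfl⟩)
      (isCollinear_of_linForm ha ?_)
    rintro _ ⟨m, hm, rfl⟩
    simp only [Finset.coe_insert, Finset.coe_singleton, Set.mem_insert_iff,
      Set.mem_singleton_iff] at hm
    obtain rfl | rfl | rfl := hm <;> assumption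
  conic T hT c hc := by
    by_contra! hv
    refine h.no_six_on_conic T hT ⟨formOf expTwo c, ⟨formOf_ne_zero _ expTwo_injective hc,
      formOf_isHomogeneous _ expTwo_sum c⟩, fun i hi => ?_⟩
    rw [← (P i).mk_rep, vanishesAt_mk_iff (formOf_isHomogeneous _ expTwo_sum c),
      eval_formOf_expTwo]
    exact hv i hi
  cubic T hT c hc hv i hi h0 := by
    have hom := formOf_isHomogeneous _ expThree_sum c
    refine h.no_eight_on_singular_cubic T hT ⟨formOf expThree c,
      ⟨formOf_ne_zero _ expThree_injective hc, hom⟩, fun i hi => ?_, i, hi, ?_⟩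
    · rw [← (P i).mk_rep, vanishesAt_mk_iff hom, eval_formOf_expThree]
      exact hv i hi
    · rw [← (P i).mk_rep, singularAt_mk_iff hom, eval_formOf_expThree]
      refine ⟨hv i hi, fun j => ?_⟩
      rw [eval_pderiv_formOf_expThree, h0]
      rfl

end Forms

/-! ### Eight points on a cuspidal cubic. -/

section Cuspidal

open Polynomial

variable {K : Type*} [Field K]

/-- Vieta: a nonzero p would be a constant multiple of the product, and its second coefficient would
be minus that constant times the sum of the roots. Forms of degree d restricted to (1, t, t³) have
degree at most 3d and no term t^(3d−1), so this applies with 3, 6 and 9 roots. -/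
theorem eq_zero_of_prod_dvd {s : Multiset K} (hs : s.sum ≠ 0) {p : K[X]}
    (hdeg : p.natDegree ≤ s.card) (hc : p.coeff (s.card - 1) = 0)
    (hd : (s.map fun a => X - C a).prod ∣ p) : p = 0 := by
  by_contra hp
  obtain ⟨g, rfl⟩ := hd
  have h0 : g ≠ 0 := right_ne_zero_of_mul hp
  have hm : (s.map fun a => X - C a).prod.Monic := monic_multiset_prod_of_monic _ _ fun a _ => monic_X_sub_C a
  have hpos : 0 < s.card := by
    rw [Multiset.card_pos]
    rintro rfl
    simp at hs
  rw [hm.natDegree_mul', natDegree_multiset_prod_X_sub_C_eq_card] at hdeg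
  swap
  · rintro rfl
    exact absurd rfl h0
  obtain ⟨a, rfl⟩ : ∃ a, g = C a := ⟨_, eq_C_of_natDegree_eq_zero (by omega)⟩
  rw [coeff_mul_C, multiset_prod_X_sub_C_coeff_card_pred _ hpos] at hc
  have : a = 0 := by
    refine (mul_eq_zero.1 hc).resolve_left (neg_ne_zero.2 hs)
  exact h0 (by rw [this, C_0])

theorem prod_dvd_of_injOn {ι : Type*} {t : ι → K} {T : Finset ι} (ht : Set.InjOn t T) {p : K[X]}
    (h : ∀ i ∈ T, p.IsRoot (t i)) : ((T.val.map t).map fun a => X - C a).prod ∣ p := by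
  rcases eq_or_ne p 0 with rfl | hp
  · exact dvd_zero _
  rw [Multiset.prod_X_sub_C_dvd_iff_le_roots hp, Multiset.le_iff_subset]
  · intro a ha
    obtain ⟨i, hi, rfl⟩ := Multiset.mem_map.1 ha
    exact (mem_roots hp).2 (h i hi)
  · exact Multiset.Nodup.map_on (fun x hx y hy => ht hx hy) T.nodup

/-- A root shared with the derivative counts twice. This supplies the ninth root for a cubic through
eight points that is singular at one of them. -/
theorem prod_dvd_of_double {ι : Type*} [DecidableEq ι] {t : ι → K} {T : Finset ι} (ht : Set.InjOn t T) {p : K[X]}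
    (h : ∀ i ∈ T, p.IsRoot (t i)) {i : ι} (hi : i ∈ T) (hd : p.derivative.IsRoot (t i)) :
    ((t i ::ₘ T.val.map t).map fun a => X - C a).prod ∣ p := by
  classical
  rcases eq_or_ne p 0 with rfl | hp
  · exact dvd_zero _
  have hnd : (T.val.map t).Nodup := Multiset.Nodup.map_on (fun x hx y hy => ht hx hy) T.nodup
  rw [Multiset.prod_X_sub_C_dvd_iff_le_roots hp, Multiset.le_iff_count]
  intro a
  rw [count_roots]
  have h1 := Multiset.nodup_iff_count_le_one.1 hnd a
  rw [Multiset.count_cons]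
  split_ifs with ha
  · have := (one_lt_rootMultiplicity_iff_isRoot hp).2 ⟨h i hi, hd⟩
    rw [ha]
    rw [ha] at h1
    omega
  · rcases Nat.eq_zero_or_pos ((T.val.map t).count a) with h0 | h0
    · omega
    · obtain ⟨j, hj, rfl⟩ := Multiset.mem_map.1 (Multiset.count_pos.1 h0)
      have := (rootMultiplicity_pos hp).2 (h j hj)
      omega

/-- Points of a cuspidal cubic are in general position under conditions on their parameters. -/
theorem vecGP_cuspidal {t : Fin 8 → K} (ht : Function.Injective t)
    (h3 : ∀ T : Finset (Fin 8), T.card = 3 → ∑ i ∈ T, t i ≠ 0)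
    (h6 : ∀ T : Finset (Fin 8), T.card = 6 → ∑ i ∈ T, t i ≠ 0)
    (h9 : ∀ i, t i + ∑ j, t j ≠ 0) : VecGP fun i => ![1, t i, t i ^ 3] where
  ne_zero i h := one_ne_zero (congrFun h 0)
  line i j k hij hik hjk a ha h1 h2 h4 := by
    simp only [linForm, Matrix.cons_val] at h1 h2 h4
    have hc : ({i, j, k} : Finset (Fin 8)).card = 3 := Finset.card_eq_three.2 ⟨i, j, k, hij, hik, hjk, rfl⟩
    have hp : C (a 0) + C (a 1) * X + C (a 2) * X ^ 3 = 0 := by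
      refine eq_zero_of_prod_dvd (s := ({i, j, k} : Finset (Fin 8)).val.map t) (h3 _ hc) ?_ ?_
        (prod_dvd_of_injOn ht.injOn ?_)
      · rw [Multiset.card_map, Finset.card_val, hc]
        compute_degree
      · rw [Multiset.card_map, Finset.card_val, hc]
        simp
      · intro m hm
        simp only [Finset.mem_insert, Finset.mem_singleton] at hm
        simp only [IsRoot, eval_add, eval_mul, eval_C, eval_X, eval_pow]
        obtain rfl | rfl | rfl := hm
        · linear_combination h1
        · linear_combination h2
        · linear_combination h4
    apply ha
    funext m
    fin_cases m
    · simpa [coeff_X, coeff_C] using congrArg (coeff · 0) hp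
    · simpa [coeff_X, coeff_C] using congrArg (coeff · 1) hp
    · simpa [coeff_X, coeff_C] using congrArg (coeff · 3) hp
  conic T hT c hc := by
    by_contra! hv
    simp only [quadForm, Matrix.cons_val] at hv
    have hp : C (c 0) + C (c 1) * X + C (c 3) * X ^ 2 + C (c 2) * X ^ 3 + C (c 4) * X ^ 4 +
        C (c 5) * X ^ 6 = 0 := by
      refine eq_zero_of_prod_dvd (s := T.val.map t) (h6 _ hT) ?_ ?_
        (prod_dvd_of_injOn ht.injOn ?_)
      · rw [Multiset.card_map, Finset.card_val, hT]
        compute_degree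
      · rw [Multiset.card_map, Finset.card_val, hT]
        simp
      · intro m hm
        simp only [IsRoot, eval_add, eval_mul, eval_C, eval_X, eval_pow]
        linear_combination hv m hm
    apply hc
    funext m
    fin_cases m
    · simpa [coeff_X, coeff_C] using congrArg (coeff · 0) hp
    · simpa [coeff_X, coeff_C] using congrArg (coeff · 1) hp
    · simpa [coeff_X, coeff_C] using congrArg (coeff · 3) hp
    · simpa [coeff_X, coeff_C] using congrArg (coeff · 2) hp
    · simpa [coeff_X, coeff_C] using congrArg (coeff · 4) hp
    · simpa [coeff_X, coeff_C] using congrArg (coeff · 6) hp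
  cubic T hT c hc hv i hi hg := by
    obtain rfl : T = Finset.univ := Finset.card_eq_iff_eq_univ T |>.1 hT
    simp only [cubForm, Matrix.cons_val] at hv
    have hg0 := congrFun hg 0
    have hg1 := congrFun hg 1
    have hg2 := congrFun hg 2
    simp only [cubGrad, Matrix.cons_val, Pi.zero_apply] at hg0 hg1 hg2
    -- The monomials x²z and y³ both restrict to t³, so the restriction sees only the sum of their
    -- coefficients; the cuspidal cubic itself restricts to zero.
    obtain ⟨d, hd⟩ : ∃ d, d = c 2 + c 6 := ⟨_, rfl⟩
    have hp : C (c 0) + C (c 1) * X + C (c 3) * X ^ 2 + C d * X ^ 3 + C (c 4) * X ^ 4 +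
        C (c 7) * X ^ 5 + C (c 5) * X ^ 6 + C (c 8) * X ^ 7 + C (c 9) * X ^ 9 = 0 := by
      have hcard : (t i ::ₘ (Finset.univ : Finset (Fin 8)).val.map t).card = 9 := by simp
      refine eq_zero_of_prod_dvd (s := t i ::ₘ Finset.univ.val.map t) ?_ ?_ ?_
        (prod_dvd_of_double ht.injOn ?_ hi ?_)
      · rw [Multiset.sum_cons]
        exact h9 i
      · rw [hcard]
        compute_degree
      · rw [hcard]
        simp
      · intro m hm
        simp only [IsRoot, eval_add, eval_mul, eval_C, eval_X, eval_pow]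
        linear_combination hv m hm + t m ^ 3 * hd
      · simp only [IsRoot, derivative_add, derivative_mul, derivative_C, derivative_X_pow,
          derivative_X, eval_add, eval_mul, eval_C, eval_X, eval_pow, zero_mul,
          eval_zero, eval_one]
        -- The derivative along (1, t, t³) is ∂y + 3t²∂z.
        linear_combination hg1 + 3 * (t i) ^ 2 * hg2 + 3 * t i ^ 2 * hd
    have e0 : c 0 = 0 := by simpa [coeff_X, coeff_C] using congrArg (coeff · 0) hp
    have e1 : c 1 = 0 := by simpa [coeff_X, coeff_C] using congrArg (coeff · 1) hp
    have e3 : c 3 = 0 := by simpa [coeff_X, coeff_C] using congrArg (coeff · 2) hp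
    have e26 : d = 0 := by simpa [coeff_X, coeff_C] using congrArg (coeff · 3) hp
    have e4 : c 4 = 0 := by simpa [coeff_X, coeff_C] using congrArg (coeff · 4) hp
    have e7 : c 7 = 0 := by simpa [coeff_X, coeff_C] using congrArg (coeff · 5) hp
    have e5 : c 5 = 0 := by simpa [coeff_X, coeff_C] using congrArg (coeff · 6) hp
    have e8 : c 8 = 0 := by simpa [coeff_X, coeff_C] using congrArg (coeff · 7) hp
    have e9 : c 9 = 0 := by simpa [coeff_X, coeff_C] using congrArg (coeff · 9) hp
    -- Only a multiple of the cuspidal cubic is left. It is smooth at the point: its z-derivative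
    -- there is just the coefficient of x²z.
    have e2 : c 2 = 0 := by
      rw [e4, e5, e7, e8, e9] at hg2
      linear_combination hg2
    have e6 : c 6 = 0 := by linear_combination e26 - hd - e2
    apply hc
    funext m
    fin_cases m <;> assumption

/-- Integer vectors whose root values are nonzero modulo `p`. -/
def RootFree (p k : ℕ) (n : Fin 8 → Fin k → ℤ) : Prop :=
  (∀ i j, i ≠ j → ∃ m, ¬ (p : ℤ) ∣ n i m - n j m) ∧
  (∀ T ∈ Finset.powersetCard 3 (Finset.univ : Finset (Fin 8)), ∃ m, ¬ (p : ℤ) ∣ ∑ i ∈ T, n i m) ∧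
  (∀ T ∈ Finset.powersetCard 6 (Finset.univ : Finset (Fin 8)), ∃ m, ¬ (p : ℤ) ∣ ∑ i ∈ T, n i m) ∧
  ∀ i, ∃ m, ¬ (p : ℤ) ∣ n i m + ∑ j, n j m

theorem exists_vecGP_of_rootFree {p k : ℕ} {n : Fin 8 → Fin k → ℤ} (hn : RootFree p k n)
    {e : Fin k → K} (he : ∀ c : Fin k → ℤ, ∑ m, (c m : K) * e m = 0 → ∀ m, (p : ℤ) ∣ c m) :
    ∃ v : Fin 8 → Fin 3 → K, VecGP v := by
  obtain ⟨h1, h3, h6, h9⟩ := hn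
  have hsum : ∀ T : Finset (Fin 8), ∑ i ∈ T, ∑ m, (n i m : K) * e m =
      ∑ m, ((∑ i ∈ T, n i m : ℤ) : K) * e m := by
    intro T
    rw [Finset.sum_comm]
    exact Finset.sum_congr rfl fun m _ => by push_cast; rw [Finset.sum_mul]
  have hT : ∀ T : Finset (Fin 8), (∃ m, ¬ (p : ℤ) ∣ ∑ i ∈ T, n i m) →
      ∑ i ∈ T, ∑ m, (n i m : K) * e m ≠ 0 := by
    rintro T ⟨m, hm⟩ h
    rw [hsum] at h
    exact hm (he _ h m)
  refine ⟨_, vecGP_cuspidal (t := fun i => ∑ m, (n i m : K) * e m) ?_ ?_ ?_ ?_⟩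
  · intro i j hij
    by_contra hne
    obtain ⟨m, hm⟩ := h1 i j hne
    refine hm (he (fun m => n i m - n j m) ?_ m)
    push_cast
    simp only [sub_mul, Finset.sum_sub_distrib]
    exact sub_eq_zero.2 hij
  · exact fun T hc => hT T (h3 T (Finset.mem_powersetCard.2 ⟨Finset.subset_univ _, hc⟩))
  · exact fun T hc => hT T (h6 T (Finset.mem_powersetCard.2 ⟨Finset.subset_univ _, hc⟩))
  · intro i h
    obtain ⟨m, hm⟩ := h9 i
    refine hm (he (fun m => n i m + ∑ j, n j m) ?_ m)
    rw [hsum, ← Finset.sum_add_distrib] at h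
    rw [← h]
    exact Finset.sum_congr rfl fun m _ => by push_cast; ring

/-- Part of a basis over the prime field. It turns conditions on integer vectors modulo p into
conditions on elements of K. -/
theorem exists_independent {p : ℕ} [Fact p.Prime] [CharP K p] [Finite K] {N : ℕ}
    (hK : Nat.card K = p ^ N) {k : ℕ} (hk : k ≤ N) :
    ∃ e : Fin k → K, ∀ c : Fin k → ℤ, ∑ m, (c m : K) * e m = 0 → ∀ m, (p : ℤ) ∣ c m := by
  let _ : Algebra (ZMod p) K := ZMod.algebra K p
  have : Module.Finite (ZMod p) K := Module.Finite.of_finite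
  have hN : Module.finrank (ZMod p) K = N := by
    have := Module.natCard_eq_pow_finrank (K := ZMod p) (V := K)
    rw [hK, Nat.card_zmod] at this
    exact (Nat.pow_right_injective (Fact.out : p.Prime).two_le this).symm
  let b := Module.finBasis (ZMod p) K
  have hli := b.linearIndependent.comp (Fin.castLE (hk.trans hN.ge)) (Fin.castLE_injective _)
  refine ⟨fun m => b (Fin.castLE (hk.trans hN.ge) m), fun c hc m => ?_⟩
  have := Fintype.linearIndependent_iff.1 hli (fun m => (c m : ZMod p)) (by
    rw [← hc]
    refine Finset.sum_congr rfl fun m _ => ?_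
    rw [Algebra.smul_def, map_intCast]
    rfl) m
  exact (ZMod.intCast_zmod_eq_zero_iff_dvd _ _).1 this

instance (p k : ℕ) (n : Fin 8 → Fin k → ℤ) : Decidable (RootFree p k n) := by
  unfold RootFree; infer_instance

theorem rootFree_two : RootFree 2 4 ![![0, 0, 0, 0], ![0, 0, 0, 1], ![0, 0, 1, 0], ![0, 1, 0, 0],
    ![0, 1, 1, 1], ![1, 0, 0, 0], ![1, 0, 1, 1], ![1, 1, 0, 1]] := by decide +kernel

theorem rootFree_three : RootFree 3 3 ![![0, 0, 0], ![0, 0, 1], ![0, 1, 0], ![0, 1, 1],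
    ![1, 0, 0], ![1, 0, 1], ![1, 1, 2], ![1, 2, 2]] := by decide +kernel

/-- One choice of integer vectors in the plane serves all these primes; the finitely many conditions
are checked for each. -/
theorem rootFree_lt_thirty {p : ℕ} (hp : p.Prime) (h5 : 5 ≤ p) (h30 : p < 30) :
    RootFree p 2 ![![3, 0], ![-4, -1], ![2, -2], ![-1, 4], ![1, -3], ![3, 2], ![0, 3],
      ![-1, 1]] := by
  have key : ∀ p < 30, 5 ≤ p → p.Prime → RootFree p 2 ![![3, 0], ![-4, -1], ![2, -2], ![-1, 4],
      ![1, -3], ![3, 2], ![0, 3], ![-1, 1]] := by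
    have h : ∀ p ∈ [5, 7, 11, 13, 17, 19, 23, 29], RootFree p 2 ![![3, 0], ![-4, -1], ![2, -2],
      ![-1, 4], ![1, -3], ![3, 2], ![0, 3], ![-1, 1]] := by decide +kernel
    intro p h1 h2 h3
    apply h
    interval_cases p <;> revert h3 <;> decide
  exact key p h30 h5 hp

/-- Consecutive differences and the sum of the first three numbers all equal 3, so every simple root
of E₈ takes the value 3 and every root takes 3 times its height. Heights are at most 29, one less
than the Coxeter number; hence all values are 3w with 0 < |w| < 30, and a prime above 30 divides
none of them. -/
theorem rootFree_gt_thirty {p : ℕ} (hp : p.Prime) (h30 : 30 < p) :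
    RootFree p 1 ![![-2], ![1], ![4], ![7], ![10], ![13], ![16], ![19]] := by
  have hd : ∀ z : ℤ, (3 ∣ z ∧ z ≠ 0 ∧ -90 < z ∧ z < 90) → ¬ (p : ℤ) ∣ z := by
    rintro z ⟨⟨w, rfl⟩, h0, h1, h2⟩ h
    have hp' := Nat.prime_iff_prime_int.1 hp
    rcases hp'.dvd_or_dvd h with h | h
    · have := Int.le_of_dvd (by norm_num) h
      omega
    · have := Int.le_of_dvd (abs_pos.2 (by omega : w ≠ 0)) ((dvd_abs _ _).2 h)
      have := abs_lt.2 (⟨by omega, by omega⟩ : -30 < w ∧ w < 30)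
      omega
  have key : ∀ n : Fin 8 → ℤ, n = ![-2, 1, 4, 7, 10, 13, 16, 19] →
    (∀ i j, i ≠ j → 3 ∣ n i - n j ∧ n i - n j ≠ 0 ∧ -90 < n i - n j ∧ n i - n j < 90) ∧
    (∀ T ∈ Finset.powersetCard 3 (Finset.univ : Finset (Fin 8)), 3 ∣ ∑ i ∈ T, n i ∧
      ∑ i ∈ T, n i ≠ 0 ∧ -90 < ∑ i ∈ T, n i ∧ ∑ i ∈ T, n i < 90) ∧
    (∀ T ∈ Finset.powersetCard 6 (Finset.univ : Finset (Fin 8)), 3 ∣ ∑ i ∈ T, n i ∧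
      ∑ i ∈ T, n i ≠ 0 ∧ -90 < ∑ i ∈ T, n i ∧ ∑ i ∈ T, n i < 90) ∧
    ∀ i, 3 ∣ n i + ∑ j, n j ∧ n i + ∑ j, n j ≠ 0 ∧ -90 < n i + ∑ j, n j ∧
      n i + ∑ j, n j < 90 := by
    rintro _ rfl
    decide +kernel
  have hn : ∀ i, (![![-2], ![1], ![4], ![7], ![10], ![13], ![16], ![19]] : Fin 8 → Fin 1 → ℤ) i 0 =
    (![-2, 1, 4, 7, 10, 13, 16, 19] : Fin 8 → ℤ) i := by decide
  obtain ⟨k1, k3, k6, k9⟩ := key _ rfl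
  refine ⟨fun i j hij => ⟨0, ?_⟩, fun T hT => ⟨0, ?_⟩, fun T hT => ⟨0, ?_⟩, fun i => ⟨0, ?_⟩⟩ <;>
    simp only [hn] <;> apply hd
  · exact k1 i j hij
  · exact k3 T hT
  · exact k6 T hT
  · exact k9 i

/-- Eight points in general position over fields that are not small prime fields. -/
theorem exists_vecGP_of_card_eq_pow {p N : ℕ} (hp : p.Prime) [CharP K p] [Finite K]
    (hK : Nat.card K = p ^ N) (h : 30 < p ∧ 1 ≤ N ∨ 5 ≤ p ∧ 2 ≤ N ∨ p = 3 ∧ 3 ≤ N ∨ p = 2 ∧ 4 ≤ N) :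
    ∃ v : Fin 8 → Fin 3 → K, VecGP v := by
  have : Fact p.Prime := ⟨hp⟩
  have gen : ∀ {k : ℕ} {n : Fin 8 → Fin k → ℤ}, RootFree p k n → k ≤ N →
      ∃ v : Fin 8 → Fin 3 → K, VecGP v := by
    intro k n hn hk
    obtain ⟨e, he⟩ := exists_independent hK hk
    exact exists_vecGP_of_rootFree hn he
  by_cases h30 : 30 < p
  · exact gen (rootFree_gt_thirty hp h30) (by omega)
  · rcases h with h | ⟨h5, hN⟩ | ⟨rfl, hN⟩ | ⟨rfl, hN⟩
    · omega
    · refine gen (rootFree_lt_thirty hp h5 ?_) hN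
      rcases (not_lt.1 h30).lt_or_eq with h | rfl
      · exact h
      · norm_num at hp
    · exact gen rootFree_three hN
    · exact gen rootFree_two hN

end Cuspidal

/-! ### Finite fields coded by natural numbers. -/

section Coding

/-- Arithmetic operations on natural numbers that encode elements of a finite field. -/
structure CodeOps where
  /-- addition of codes -/
  add : ℕ → ℕ → ℕ
  /-- subtraction of codes -/
  sub : ℕ → ℕ → ℕ
  /-- multiplication of codes -/
  mul : ℕ → ℕ → ℕ

variable {K : Type*} [Field K]

/-- The natural numbers below `q` encode the elements of `K` through `val`. -/
structure IsCoding (q : ℕ) (O : CodeOps) (val : ℕ → K) : Prop where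
  one_lt : 1 < q
  add_lt : ∀ {a b}, a < q → b < q → O.add a b < q
  sub_lt : ∀ {a b}, a < q → b < q → O.sub a b < q
  mul_lt : ∀ {a b}, a < q → b < q → O.mul a b < q
  val_add : ∀ {a b}, a < q → b < q → val (O.add a b) = val a + val b
  val_sub : ∀ {a b}, a < q → b < q → val (O.sub a b) = val a - val b
  val_mul : ∀ {a b}, a < q → b < q → val (O.mul a b) = val a * val b
  val_zero : val 0 = 0
  val_one : val 1 = 1
  inj : ∀ {a b}, a < q → b < q → val a = val b → a = b
  surj : ∀ x, ∃ a < q, val a = x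

theorem surj_of_inj {K : Type*} [Finite K] {q : ℕ} (hq : Nat.card K = q) {val : ℕ → K}
    (h : ∀ {a b}, a < q → b < q → val a = val b → a = b) (x : K) : ∃ a < q, val a = x := by
  have hi : Function.Injective fun a : Fin q => val a := fun a b hab =>
    Fin.ext (h a.2 b.2 hab)
  obtain ⟨a, ha⟩ := (hi.bijective_of_nat_card_le (by simp [hq])).2 x
  exact ⟨a, a.2, ha⟩

/-- Arithmetic modulo `p`. -/
def primeOps (p : ℕ) : CodeOps where
  add a b := (a + b) % p
  sub a b := (a + (p - b)) % p
  mul a b := a * b % p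

theorem cast_mod (p : ℕ) [CharP K p] (a : ℕ) : ((a % p : ℕ) : K) = a := by
  conv_rhs => rw [← Nat.mod_add_div a p]
  push_cast
  rw [CharP.cast_eq_zero K p, zero_mul, add_zero]

theorem isCoding_prime [Finite K] {p : ℕ} (hp : p.Prime) [CharP K p] (hq : Nat.card K = p) :
    IsCoding p (primeOps p) (fun a => (a : K)) where
  one_lt := hp.one_lt
  add_lt _ _ := Nat.mod_lt _ hp.pos
  sub_lt _ _ := Nat.mod_lt _ hp.pos
  mul_lt _ _ := Nat.mod_lt _ hp.pos
  val_add _ _ := by simp [primeOps, cast_mod p]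
  val_sub _ hb := by
    simp only [primeOps, cast_mod p]
    rw [Nat.cast_add, Nat.cast_sub hb.le, CharP.cast_eq_zero K p]
    ring
  val_mul _ _ := by simp [primeOps, cast_mod p]
  val_zero := Nat.cast_zero
  val_one := Nat.cast_one
  inj ha hb h := CharP.natCast_injOn_Iio K p ha hb h
  surj := surj_of_inj hq fun ha hb h => CharP.natCast_injOn_Iio K p ha hb h

/-- The code of `a + b α` over the field with three elements. -/
def mkNine (a b : ℕ) : ℕ := a % 3 + 3 * (b % 3)

/-- Arithmetic of the field with nine elements, generated by a square root of `-1`. -/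
def nineOps : CodeOps where
  add a b := mkNine (a % 3 + b % 3) (a / 3 + b / 3)
  sub a b := mkNine (a % 3 + 2 * (b % 3)) (a / 3 + 2 * (b / 3))
  mul a b := mkNine (a % 3 * (b % 3) + 2 * (a / 3 * (b / 3))) (a % 3 * (b / 3) + a / 3 * (b % 3))

/-- The element with a given code in the field with nine elements. -/
def valNine (α : K) (a : ℕ) : K := (a % 3 : ℕ) + (a / 3 : ℕ) * α

theorem valNine_mkNine [CharP K 3] (α : K) (a b : ℕ) : valNine α (mkNine a b) = a + b * α := by
  have h1 : mkNine a b % 3 = a % 3 := by unfold mkNine; omega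
  have h2 : mkNine a b / 3 = b % 3 := by unfold mkNine; omega
  rw [valNine, h1, h2, cast_mod, cast_mod]

theorem isCoding_nine [Finite K] [CharP K 3] (hq : Nat.card K = 9) {α : K} (hα : α ^ 2 = -1) :
    IsCoding 9 nineOps (valNine α) := by
  have h3 : (3 : K) = 0 := by exact_mod_cast CharP.cast_eq_zero K 3
  have hlt : ∀ a b, mkNine a b < 9 := fun a b => by unfold mkNine; omega
  have hsub : ∀ a b, valNine α (nineOps.sub a b) = valNine α a - valNine α b := by
    intro a b
    simp only [nineOps, valNine_mkNine]
    simp only [valNine]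
    push_cast
    linear_combination (((b % 3 : ℕ) : K) + ((b / 3 : ℕ) : K) * α) * h3
  have hmul : ∀ a b, valNine α (nineOps.mul a b) = valNine α a * valNine α b := by
    intro a b
    simp only [nineOps, valNine_mkNine]
    simp only [valNine]
    push_cast
    linear_combination ((a / 3 : ℕ) : K) * ((b / 3 : ℕ) : K) * (h3 - hα)
  have h1 : valNine α 1 = 1 := by simp [valNine]
  have hinj : ∀ {a b}, a < 9 → b < 9 → valNine α a = valNine α b → a = b := by
    intro a b ha hb h
    by_contra hne
    -- A finite check finds an inverse code for the difference of distinct codes, so the difference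
    -- of their values is a unit and cannot be zero.
    obtain ⟨c, hc⟩ : ∃ c, nineOps.mul (nineOps.sub a b) c = 1 := by
      have : ∀ a < 9, ∀ b < 9, a ≠ b → ∃ c < 9, nineOps.mul (nineOps.sub a b) c = 1 := by
        decide +kernel
      obtain ⟨c, -, h⟩ := this a ha b hb hne
      exact ⟨c, h⟩
    apply one_ne_zero (α := K)
    rw [← h1, ← hc, hmul, hsub, h, sub_self, zero_mul]
  exact
  { one_lt := by norm_num
    add_lt _ _ := hlt _ _
    sub_lt _ _ := hlt _ _
    mul_lt _ _ := hlt _ _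
    val_add {a b} _ _ := by
      simp only [nineOps, valNine_mkNine]
      simp only [valNine]
      push_cast
      ring
    val_sub _ _ := hsub _ _
    val_mul _ _ := hmul _ _
    val_zero := by simp [valNine]
    val_one := h1
    inj := hinj
    surj := surj_of_inj hq hinj }

/-- The code of `a + b α + c α²` over the field with two elements. -/
def mkEight (a b c : ℕ) : ℕ := a % 2 + 2 * (b % 2) + 4 * (c % 2)

/-- Arithmetic of the field with eight elements, generated by a root of `x³ + x + 1`. The
multiplication is a table lookup. -/
def eightOps : CodeOps where
  add a b := a ^^^ b
  sub a b := a ^^^ b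
  mul a b := 0x3461257042351760637241501526734021475630571364207654321000000000 >>> (4 * (8 * a + b)) % 8

theorem eightOps_sub : ∀ a < 8, ∀ b < 8, eightOps.sub a b =
    mkEight (a % 2 + b % 2) (a / 2 % 2 + b / 2 % 2) (a / 4 + b / 4) := by
  decide +kernel

theorem eightOps_mul : ∀ a < 8, ∀ b < 8, eightOps.mul a b = mkEight
    (a % 2 * (b % 2) + a / 2 % 2 * (b / 4) + a / 4 * (b / 2 % 2))
    (a % 2 * (b / 2 % 2) + a / 2 % 2 * (b % 2) + a / 2 % 2 * (b / 4) + a / 4 * (b / 2 % 2) +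
      a / 4 * (b / 4))
    (a % 2 * (b / 4) + a / 2 % 2 * (b / 2 % 2) + a / 4 * (b % 2) + a / 4 * (b / 4)) := by
  decide +kernel

/-- The element with a given code in the field with eight elements. -/
def valEight (α : K) (a : ℕ) : K :=
  (a % 2 : ℕ) + (a / 2 % 2 : ℕ) * α + (a / 4 : ℕ) * α ^ 2

theorem valEight_mkEight [CharP K 2] (α : K) (a b c : ℕ) :
    valEight α (mkEight a b c) = a + b * α + c * α ^ 2 := by
  have h1 : mkEight a b c % 2 = a % 2 := by unfold mkEight; omega
  have h2 : mkEight a b c / 2 % 2 = b % 2 := by unfold mkEight; omega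
  have h3 : mkEight a b c / 4 = c % 2 := by unfold mkEight; omega
  rw [valEight, h1, h2, h3, cast_mod, cast_mod, cast_mod]

theorem isCoding_eight [Finite K] [CharP K 2] (hq : Nat.card K = 8) {α : K}
    (hα : α ^ 3 = α + 1) : IsCoding 8 eightOps (valEight α) := by
  have h2 : (2 : K) = 0 := by exact_mod_cast CharP.cast_eq_zero K 2
  have hlt : ∀ a b c, mkEight a b c < 8 := fun a b c => by unfold mkEight; omega
  have hsub : ∀ {a b}, a < 8 → b < 8 →
      valEight α (eightOps.sub a b) = valEight α a - valEight α b := by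
    intro a b ha hb
    simp only [eightOps_sub a ha b hb, valEight_mkEight]
    simp only [valEight]
    push_cast
    linear_combination (((b % 2 : ℕ) : K) + ((b / 2 % 2 : ℕ) : K) * α +
      ((b / 4 : ℕ) : K) * α ^ 2) * h2
  have hmul : ∀ {a b}, a < 8 → b < 8 →
      valEight α (eightOps.mul a b) = valEight α a * valEight α b := by
    intro a b ha hb
    simp only [eightOps_mul a ha b hb, valEight_mkEight]
    simp only [valEight]
    push_cast
    linear_combination (-((a / 2 % 2 : ℕ) : K) * ((b / 4 : ℕ) : K) -
      ((a / 4 : ℕ) : K) * ((b / 2 % 2 : ℕ) : K) - ((a / 4 : ℕ) : K) * ((b / 4 : ℕ) : K) * α) * hα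
  have h1 : valEight α 1 = 1 := by simp [valEight]
  have hinj : ∀ {a b}, a < 8 → b < 8 → valEight α a = valEight α b → a = b := by
    intro a b ha hb h
    by_contra hne
    obtain ⟨c, hc8, hc⟩ : ∃ c < 8, eightOps.mul (eightOps.sub a b) c = 1 := by
      have : ∀ a < 8, ∀ b < 8, a ≠ b → ∃ c < 8, eightOps.mul (eightOps.sub a b) c = 1 := by
        decide +kernel
      exact this a ha b hb hne
    have hlt : eightOps.sub a b < 8 := by
      rw [eightOps_sub a ha b hb]
      exact hlt _ _ _
    apply one_ne_zero (α := K)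
    rw [← h1, ← hc, hmul hlt hc8, hsub ha hb, h, sub_self, zero_mul]
  exact
  { one_lt := by norm_num
    add_lt ha hb := (eightOps_sub _ ha _ hb).trans_lt (hlt _ _ _)
    sub_lt ha hb := (eightOps_sub _ ha _ hb).trans_lt (hlt _ _ _)
    mul_lt ha hb := (eightOps_mul _ ha _ hb).trans_lt (hlt _ _ _)
    val_add {_ b} ha hb := (hsub ha hb).trans (by linear_combination -valEight α b * h2)
    val_sub := hsub
    val_mul := hmul
    val_zero := by simp [valEight]
    val_one := h1
    inj := hinj
    surj := surj_of_inj hq hinj }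

theorem exists_isCoding_nine [Finite K] (hq : Nat.card K = 9) :
    ∃ val : ℕ → K, IsCoding 9 nineOps val := by
  have : Fact (Nat.Prime 3) := ⟨by norm_num⟩
  have := Fintype.ofFinite K
  have : CharP K 3 := charP_of_card_eq_prime_pow (p := 3) (f := 2)
    (by rw [← Nat.card_eq_fintype_card, hq]; norm_num)
  obtain ⟨α, hα⟩ := (FiniteField.isSquare_neg_one_iff (F := K)).2
    (by rw [← Nat.card_eq_fintype_card, hq]; norm_num)
  exact ⟨_, isCoding_nine hq (α := α) (by rw [hα]; ring)⟩

theorem exists_isCoding_eight [Finite K] (hq : Nat.card K = 8) :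
    ∃ val : ℕ → K, IsCoding 8 eightOps val := by
  have : Fact (Nat.Prime 2) := ⟨by norm_num⟩
  have := Fintype.ofFinite K
  have : CharP K 2 := charP_of_card_eq_prime_pow (p := 2) (f := 3)
    (by rw [← Nat.card_eq_fintype_card, hq]; norm_num)
  have h2 : (2 : K) = 0 := by exact_mod_cast CharP.cast_eq_zero K 2
  classical
  obtain ⟨x, hx⟩ : ∃ x : K, x ∉ ({0, 1} : Finset K) := by
    by_contra! hc
    have h1 : (Finset.univ : Finset K) ⊆ {0, 1} := fun x _ => hc x
    have := (Finset.card_le_card h1).trans Finset.card_le_two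
    rw [Finset.card_univ, ← Nat.card_eq_fintype_card, hq] at this
    omega
  simp only [Finset.mem_insert, Finset.mem_singleton, not_or] at hx
  have h7 : x ^ 7 = 1 := by
    have := FiniteField.pow_card_sub_one_eq_one x hx.1
    rwa [← Nat.card_eq_fintype_card, hq] at this
  -- The factorisation of x⁷ − 1 modulo 2.
  have h : (x - 1) * ((x ^ 3 + x + 1) * (x ^ 3 + x ^ 2 + 1)) = 0 := by
    linear_combination h7 + (x ^ 4 - x ^ 3) * h2
  rcases mul_eq_zero.1 ((mul_eq_zero.1 h).resolve_left (sub_ne_zero.2 hx.2)) with h | h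
  · exact ⟨_, isCoding_eight hq (α := x) (by linear_combination h - (x + 1) * h2)⟩
  -- The cubic x³ + x² + 1 is the reciprocal of x³ + x + 1, so the inverse is a root of the wanted
  -- one.
  · refine ⟨_, isCoding_eight hq (α := x⁻¹) ?_⟩
    have hx0 := hx.1
    field_simp
    linear_combination (-1 : K) * h + h2

end Coding

/-! ### Certified Gaussian elimination and explicit configurations. -/

section Elimination

/-- Evaluate a number before passing it on. -/
def force {α : Type*} (x : ℕ) (k : ℕ → α) : α := Nat.rec (k 0) (fun n _ => k n.succ) x

/-- Recursion on x makes evaluation reduce x to a numeral before it enters k; as a function, `force`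
is plain application. -/
theorem force_eq {α : Type*} (x : ℕ) (k : ℕ → α) : force x k = k x := by
  cases x <;> rfl

/-- Evaluate `List.zipWith f l m` entry by entry. -/
def forceZip {α : Type*} (f : ℕ → ℕ → ℕ) : List ℕ → List ℕ → (List ℕ → α) → α
  | a :: l, b :: m, k => force (f a b) fun c => forceZip f l m fun r => k (c :: r)
  | _, _, k => k []

theorem forceZip_eq {α : Type*} (f : ℕ → ℕ → ℕ) (l m : List ℕ) (k : List ℕ → α) :
    forceZip f l m k = k (List.zipWith f l m) := by
  induction l generalizing m k with
  | nil => rfl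
  | cons a l ih =>
    cases m with
    | nil => rfl
    | cons b m => simp only [forceZip, force_eq, ih, List.zipWith]

/-- Evaluate the rows obtained by clearing the first column with the pivot row `r`. -/
def forceReduce {α : Type*} (O : CodeOps) (r₀ : ℕ) (r : List ℕ) :
    List (List ℕ) → (List (List ℕ) → α) → α
  | (s₀ :: s) :: L, k => forceZip (fun a b => O.sub (O.mul r₀ b) (O.mul s₀ a)) r s fun t =>
      forceReduce O r₀ r L fun M => k (t :: M)
  | _, k => k []

/-- Fraction-free elimination: checks that a homogeneous system of linear equations in `n` unknowns
has only the trivial solution. -/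
def elim (O : CodeOps) : ℕ → List (List ℕ) → Bool
  | 0, _ => true
  | n + 1, L =>
    match L.find? (fun r => !(r.headD 0 == 0)) with
    | some (r₀ :: r) => forceReduce O r₀ r L (elim O n)
    | _ => false

variable {K : Type*} [Field K]

/-- The value of the linear form with coded coefficients. -/
def dotCode (val : ℕ → K) : List ℕ → (ℕ → K) → K
  | [], _ => 0
  | a :: l, x => val a * x 0 + dotCode val l fun i => x (i + 1)

theorem forceReduce_eq {α : Type*} (O : CodeOps) (r₀ : ℕ) (r : List ℕ) (L : List (List ℕ))
    (hL : ∀ s ∈ L, s ≠ []) (k : List (List ℕ) → α) :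
    forceReduce O r₀ r L k = k (L.map fun s =>
      List.zipWith (fun a b => O.sub (O.mul r₀ b) (O.mul (s.headD 0) a)) r s.tail) := by
  induction L generalizing k with
  | nil => rfl
  | cons s L ih =>
    cases s with
    | nil => exact absurd rfl (hL [] (by simp))
    | cons s₀ s =>
      rw [forceReduce, forceZip_eq, ih fun t ht => hL t (by simp [ht])]
      rfl

theorem dotCode_zipWith {q : ℕ} {O : CodeOps} {val : ℕ → K} (hO : IsCoding q O val) {r₀ s₀ : ℕ}
    (hr₀ : r₀ < q) (hs₀ : s₀ < q) (r s : List ℕ) (hl : r.length = s.length)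
    (hr : ∀ a ∈ r, a < q) (hs : ∀ a ∈ s, a < q) (x : ℕ → K) :
    dotCode val (List.zipWith (fun a b => O.sub (O.mul r₀ b) (O.mul s₀ a)) r s) x =
      val r₀ * dotCode val s x - val s₀ * dotCode val r x := by
  induction r generalizing s x with
  | nil =>
    cases s with
    | nil => simp [dotCode]
    | cons b s => simp at hl
  | cons a r ih =>
    cases s with
    | nil => simp at hl
    | cons b s =>
      simp only [List.length_cons, Nat.add_right_cancel_iff, List.mem_cons, forall_eq_or_imp] at hl hr hs
      simp only [List.zipWith, dotCode]
      rw [ih s hl hr.2 hs.2, hO.val_sub (hO.mul_lt hr₀ hs.1) (hO.mul_lt hs₀ hr.1),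
        hO.val_mul hr₀ hs.1, hO.val_mul hs₀ hr.1]
      ring

/-- Each reduced row is a combination of two equations from which the first unknown has gone, so by
induction the later unknowns vanish, and the pivot equation then kills the first. The pivot row
stays in the list: it reduces to the harmless zero row. -/
theorem eq_zero_of_elim {q : ℕ} {O : CodeOps} {val : ℕ → K} (hO : IsCoding q O val) (n : ℕ)
    (L : List (List ℕ)) (hL : ∀ r ∈ L, r.length = n ∧ ∀ a ∈ r, a < q) (h : elim O n L = true)
    (x : ℕ → K) (hx : ∀ r ∈ L, dotCode val r x = 0) : ∀ i < n, x i = 0 := by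
  induction n generalizing L x with
  | zero => intro i hi; omega
  | succ n ih =>
    rw [elim] at h
    split at h
    · rename_i r₀ r hfind
      have hmem := List.mem_of_find?_eq_some hfind
      have hr₀ : r₀ ≠ 0 := by
        have := List.find?_some hfind
        simpa using this
      obtain ⟨hlr, hqr⟩ := hL _ hmem
      simp only [List.length_cons, Nat.add_right_cancel_iff, List.mem_cons,
        forall_eq_or_imp] at hlr hqr
      rw [forceReduce_eq _ _ _ _ (fun s hs h0 => by
        have := (hL s hs).1
        rw [h0] at this
        simp at this)] at h
      have htail := ih _ ?_ h (fun i => x (i + 1)) ?_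
      · intro i hi
        cases i with
        | succ i => exact htail i (by omega)
        | zero =>
          have h1 := hx _ hmem
          have h2 : ∀ (l : List ℕ) (y : ℕ → K), (∀ i < l.length, y i = 0) → dotCode val l y = 0 := by
            intro l
            induction l with
            | nil => intro y _; rfl
            | cons a l ihl =>
              intro y hy
              rw [dotCode, hy 0 (by simp), ihl _ fun i hi => hy (i + 1) (by simpa using hi)]
              ring
          rw [dotCode, h2 _ _ (by rw [hlr]; exact htail), add_zero] at h1
          refine (mul_eq_zero.1 h1).resolve_left fun h0 => hr₀ ?_
          exact hO.inj hqr.1 (by have := hO.one_lt; omega) (h0.trans hO.val_zero.symm)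
      · intro t ht
        obtain ⟨s, hs, rfl⟩ := List.mem_map.1 ht
        obtain ⟨hls, hqs⟩ := hL s hs
        cases s with
        | nil => simp at hls
        | cons s₀ s =>
          simp only [List.length_cons, Nat.add_right_cancel_iff, List.mem_cons,
            forall_eq_or_imp] at hls hqs
          refine ⟨by simp [hlr, hls], fun a ha => ?_⟩
          obtain ⟨i, hi, rfl⟩ := List.getElem_of_mem ha
          rw [List.getElem_zipWith]
          exact hO.sub_lt (hO.mul_lt hqr.1 (hqs.2 _ (List.getElem_mem _)))
            (hO.mul_lt hqs.1 (hqr.2 _ (List.getElem_mem _)))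
      · intro t ht
        obtain ⟨s, hs, rfl⟩ := List.mem_map.1 ht
        obtain ⟨hls, hqs⟩ := hL s hs
        have hs0 := hx s hs
        have hr0 := hx _ hmem
        cases s with
        | nil => simp at hls
        | cons s₀ s =>
          simp only [List.length_cons, Nat.add_right_cancel_iff, List.mem_cons,
            forall_eq_or_imp] at hls hqs
          simp only [dotCode] at hs0 hr0
          simp only [List.headD_cons, List.tail_cons]
          rw [dotCode_zipWith hO hqr.1 hqs.1 _ _ (hlr.trans hls.symm) hqr.2 hqs.2]
          linear_combination val r₀ * hs0 - val s₀ * hr0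
    · simp at h

/-- Coefficients of the condition that a quadratic form vanishes at a point. -/
def quadRow (O : CodeOps) (p : ℕ × ℕ × ℕ) : List ℕ :=
  [O.mul p.1 p.1, O.mul p.1 p.2.1, O.mul p.1 p.2.2, O.mul p.2.1 p.2.1, O.mul p.2.1 p.2.2,
    O.mul p.2.2 p.2.2]

/-- Coefficients of the condition that a cubic form vanishes at a point. -/
def cubRow (O : CodeOps) (p : ℕ × ℕ × ℕ) : List ℕ :=
  let x := p.1; let y := p.2.1; let z := p.2.2
  [O.mul (O.mul x x) x, O.mul (O.mul x x) y, O.mul (O.mul x x) z, O.mul x (O.mul y y),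
    O.mul (O.mul x y) z, O.mul x (O.mul z z), O.mul (O.mul y y) y, O.mul (O.mul y y) z,
    O.mul y (O.mul z z), O.mul (O.mul z z) z]

/-- Coefficients of the conditions that the gradient of a cubic form vanishes at a point. -/
def gradRows (O : CodeOps) (p : ℕ × ℕ × ℕ) : List (List ℕ) :=
  let x := p.1; let y := p.2.1; let z := p.2.2
  let d := fun a => O.add a a
  let t := fun a => O.add (O.add a a) a
  [[t (O.mul x x), d (O.mul x y), d (O.mul x z), O.mul y y, O.mul y z, O.mul z z, 0, 0, 0, 0],
    [0, O.mul x x, 0, d (O.mul x y), O.mul x z, 0, t (O.mul y y), d (O.mul y z), O.mul z z, 0],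
    [0, 0, O.mul x x, 0, O.mul x y, d (O.mul x z), 0, O.mul y y, d (O.mul y z), t (O.mul z z)]]

/-- The points with given codes are in general position. -/
def checkGP (O : CodeOps) (r : ℕ) (pt : ℕ → ℕ × ℕ × ℕ) : Bool :=
  ((List.range r).sublistsLen 3).all (fun l =>
    elim O 3 (l.map fun i => [(pt i).1, (pt i).2.1, (pt i).2.2])) &&
  ((List.range r).sublistsLen 6).all (fun l => elim O 6 (l.map fun i => quadRow O (pt i))) &&
  (r != 8 || (List.range r).all fun i =>
    elim O 10 (((List.range r).map fun i => cubRow O (pt i)) ++ gradRows O (pt i)))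

/-- Every clause of general position says that a linear system in the 3, 6 or 10 coefficients of a
form has only the trivial solution. For cubics the system consists of eight values and the three
partial derivatives at one point; it matters only when r = 8. -/
theorem vecGP_of_checkGP {q : ℕ} {O : CodeOps} {val : ℕ → K} (hO : IsCoding q O val) {r : ℕ}
    (hr : 3 ≤ r) (hr8 : r ≤ 8) {pt : ℕ → ℕ × ℕ × ℕ}
    (hpt : ∀ i < r, (pt i).1 < q ∧ (pt i).2.1 < q ∧ (pt i).2.2 < q)
    (hpt0 : ∀ i < r, pt i ≠ (0, 0, 0)) (h : checkGP O r pt = true) :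
    VecGP fun i : Fin r => ![val (pt i).1, val (pt i).2.1, val (pt i).2.2] := by
  simp only [checkGP, Bool.and_eq_true, List.all_eq_true, Bool.or_eq_true] at h
  obtain ⟨⟨h3, h6⟩, h8⟩ := h
  have h0q : 0 < q := by have := hO.one_lt; omega
  have hsub : ∀ (T : Finset (Fin r)) (n : ℕ), T.card = n → ∃ l ∈ (List.range r).sublistsLen n,
      ∀ i ∈ l, ∃ j ∈ T, (j : ℕ) = i := by
    intro T n hn
    refine ⟨(List.range r).filter (fun i => i ∈ T.map Fin.valEmbedding), ?_, ?_⟩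
    · rw [List.mem_sublistsLen]
      refine ⟨List.filter_sublist, ?_⟩
      rw [← hn, ← Finset.card_map Fin.valEmbedding, ← List.toFinset_card_of_nodup
        (List.nodup_range.filter _)]
      congr 1
      ext i
      simp only [List.mem_toFinset, List.mem_filter, List.mem_range, decide_eq_true_eq]
      constructor
      · exact fun h => h.2
      · intro h
        refine ⟨?_, h⟩
        obtain ⟨j, -, rfl⟩ := Finset.mem_map.1 h
        exact j.2
    · intro i hi
      rw [List.mem_filter, decide_eq_true_eq] at hi
      obtain ⟨j, hj, rfl⟩ := Finset.mem_map.1 hi.2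
      exact ⟨j, hj, rfl⟩
  have hline : ∀ T : Finset (Fin r), T.card = 3 → ∀ a : Fin 3 → K, a ≠ 0 →
      ¬ ∀ i ∈ T, linForm a ![val (pt i).1, val (pt i).2.1, val (pt i).2.2] = 0 := by
    intro T hT a ha hv
    obtain ⟨l, hl, hlT⟩ := hsub T 3 hT
    have key := eq_zero_of_elim hO 3 _ ?_ (h3 l hl) (fun i => if h : i < 3 then a ⟨i, h⟩ else 0) ?_
    · apply ha
      funext i
      simpa using key i i.2
    · intro s hs
      obtain ⟨i, hi, rfl⟩ := List.mem_map.1 hs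
      obtain ⟨j, -, rfl⟩ := hlT i hi
      refine ⟨rfl, ?_⟩
      obtain ⟨p1, p2, p3⟩ := hpt j j.2
      simp [p1, p2, p3]
    · intro s hs
      obtain ⟨i, hi, rfl⟩ := List.mem_map.1 hs
      obtain ⟨j, hj, rfl⟩ := hlT i hi
      have := hv j hj
      simp only [linForm, Matrix.cons_val] at this
      simp [dotCode]
      linear_combination this
  refine ⟨?_, ?_, ?_, ?_⟩
  · intro i h0
    obtain ⟨p1, p2, p3⟩ := hpt i i.2
    have e : ∀ {a}, a < q → val a = 0 → a = 0 := fun ha h => hO.inj ha h0q (h.trans hO.val_zero.symm)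
    exact hpt0 i i.2 (Prod.ext (e p1 (congrFun h0 0)) (Prod.ext (e p2 (congrFun h0 1))
      (e p3 (congrFun h0 2))))
  · intro i j k hij hik hjk a ha h1 h2 h4
    refine hline {i, j, k} (Finset.card_eq_three.2 ⟨i, j, k, hij, hik, hjk, rfl⟩) a ha ?_
    intro m hm
    simp only [Finset.mem_insert, Finset.mem_singleton] at hm
    obtain rfl | rfl | rfl := hm <;> assumption
  · intro T hT c hc
    by_contra! hv
    obtain ⟨l, hl, hlT⟩ := hsub T 6 hT
    have key := eq_zero_of_elim hO 6 _ ?_ (h6 l hl) (fun i => if h : i < 6 then c ⟨i, h⟩ else 0) ?_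
    · apply hc
      funext i
      simpa using key i i.2
    · intro s hs
      obtain ⟨i, hi, rfl⟩ := List.mem_map.1 hs
      obtain ⟨j, -, rfl⟩ := hlT i hi
      refine ⟨rfl, ?_⟩
      obtain ⟨p1, p2, p3⟩ := hpt j j.2
      simp [quadRow, hO.mul_lt, p1, p2, p3]
    · intro s hs
      obtain ⟨i, hi, rfl⟩ := List.mem_map.1 hs
      obtain ⟨j, hj, rfl⟩ := hlT i hi
      obtain ⟨p1, p2, p3⟩ := hpt j j.2
      have := hv j hj
      simp only [quadForm, Matrix.cons_val] at this
      simp [dotCode, quadRow, hO.val_mul, p1, p2, p3]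
      linear_combination this
  · intro T hT c hc hv i hi hg
    obtain rfl : r = 8 := by
      have := T.card_le_univ
      rw [hT, Fintype.card_fin] at this
      omega
    obtain rfl : T = Finset.univ := Finset.card_eq_iff_eq_univ T |>.1 hT
    have h8 := h8.resolve_left (by simp)
    have hd : ∀ {a}, a < q → O.add a a < q := fun h => hO.add_lt h h
    have ht : ∀ {a}, a < q → O.add (O.add a a) a < q := fun h => hO.add_lt (hd h) h
    have vt : ∀ {a}, a < q → val (O.add (O.add a a) a) = 3 * val a := fun h => by
      rw [hO.val_add (hd h) h, hO.val_add h h]; ring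
    have key := eq_zero_of_elim hO 10 _ ?_ (h8 i (List.mem_range.2 i.2))
      (fun i => if h : i < 10 then c ⟨i, h⟩ else 0) ?_
    · apply hc
      funext i
      simpa using key i i.2
    · intro s hs
      rcases List.mem_append.1 hs with hs | hs
      · obtain ⟨j, hj, rfl⟩ := List.mem_map.1 hs
        refine ⟨rfl, ?_⟩
        obtain ⟨p1, p2, p3⟩ := hpt j (List.mem_range.1 hj)
        simp [cubRow, hO.mul_lt, p1, p2, p3]
      · obtain ⟨p1, p2, p3⟩ := hpt i i.2
        simp only [gradRows, List.mem_cons, List.not_mem_nil, or_false] at hs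
        obtain rfl | rfl | rfl := hs <;>
          exact ⟨rfl, by simp [hO.mul_lt, hd, ht, p1, p2, p3, h0q]⟩
    · intro s hs
      rcases List.mem_append.1 hs with hs | hs
      · obtain ⟨j, hj, rfl⟩ := List.mem_map.1 hs
        have hj := List.mem_range.1 hj
        obtain ⟨p1, p2, p3⟩ := hpt j hj
        have := hv ⟨j, hj⟩ (Finset.mem_univ _)
        simp only [cubForm, Matrix.cons_val] at this
        simp [dotCode, cubRow, hO.val_mul, hO.mul_lt, p1, p2, p3]
        linear_combination this
      · obtain ⟨p1, p2, p3⟩ := hpt i i.2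
        have g0 := congrFun hg 0
        have g1 := congrFun hg 1
        have g2 := congrFun hg 2
        simp only [cubGrad, Matrix.cons_val, Pi.zero_apply] at g0 g1 g2
        simp only [gradRows, List.mem_cons, List.not_mem_nil, or_false] at hs
        obtain rfl | rfl | rfl := hs <;>
          simp [dotCode, hO.val_mul, hO.mul_lt, hO.val_add, vt, p1, p2, p3, hO.val_zero]
        · linear_combination g0
        · linear_combination g1
        · linear_combination g2

/-- The `i`-th point of the standard frame followed by a list of affine points. -/
def framePt (l : List (ℕ × ℕ)) (i : ℕ) : ℕ × ℕ × ℕ :=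
  ([(1, 0, 0), (0, 1, 0), (0, 0, 1), (1, 1, 1)] ++ l.map fun a => (1, a)).getD i (0, 0, 0)

theorem vecGP_of_framePt {q : ℕ} {O : CodeOps} {val : ℕ → K} (hO : IsCoding q O val) {r : ℕ}
    (hr : 3 ≤ r) (hr8 : r ≤ 8) (l : List (ℕ × ℕ))
    (h : (∀ i < r, ((framePt l i).1 < q ∧ (framePt l i).2.1 < q ∧ (framePt l i).2.2 < q) ∧
      framePt l i ≠ (0, 0, 0)) ∧ checkGP O r (framePt l) = true) :
    ∃ v : Fin r → Fin 3 → K, VecGP v :=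
  ⟨_, vecGP_of_checkGP hO hr hr8 (fun i hi => (h.1 i hi).1) (fun i hi => (h.1 i hi).2) h.2⟩

/-- These prime fields are out of reach of the cuspidal construction above; the four listed affine
points complete the standard frame. -/
theorem exists_vecGP_of_small_prime [Finite K] {p : ℕ} (hp : p.Prime) [CharP K p]
    (hK : Nat.card K = p) (h : p = 19 ∨ p = 23 ∨ p = 29) : ∃ v : Fin 8 → Fin 3 → K, VecGP v := by
  have hO := isCoding_prime hp hK
  obtain rfl | rfl | rfl := h
  · exact vecGP_of_framePt hO (by norm_num) le_rfl [(2, 3), (3, 2), (5, 8), (11, 12)]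
      (by decide +kernel)
  · exact vecGP_of_framePt hO (by norm_num) le_rfl [(2, 3), (3, 2), (4, 8), (8, 7)]
      (by decide +kernel)
  · exact vecGP_of_framePt hO (by norm_num) le_rfl [(2, 3), (3, 2), (4, 5), (5, 11)]
      (by decide +kernel)

theorem exists_seven_vecGP_of_small_prime [Finite K] {p : ℕ} (hp : p.Prime) [CharP K p]
    (hK : Nat.card K = p) (h : p = 11 ∨ p = 13 ∨ p = 17) :
    ∃ v : Fin 7 → Fin 3 → K, VecGP v := by
  have hO := isCoding_prime hp hK
  obtain rfl | rfl | rfl := h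
  · exact vecGP_of_framePt hO (by norm_num) (by norm_num) [(2, 3), (3, 2), (6, 8)]
      (by decide +kernel)
  · exact vecGP_of_framePt hO (by norm_num) (by norm_num) [(2, 3), (3, 2), (4, 8)]
      (by decide +kernel)
  · exact vecGP_of_framePt hO (by norm_num) (by norm_num) [(2, 3), (3, 2), (4, 5)]
      (by decide +kernel)

theorem exists_seven_vecGP_of_card_eq_nine [Finite K] (hK : Nat.card K = 9) :
    ∃ v : Fin 7 → Fin 3 → K, VecGP v := by
  obtain ⟨val, hO⟩ := exists_isCoding_nine hK
  exact vecGP_of_framePt hO (by norm_num) (by norm_num) [(2, 3), (4, 2), (7, 6)]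
    (by decide +kernel)

end Elimination

/-! ### A bracket criterion for six points on a conic, and the standard frame. -/

section Brackets

variable {K : Type*} [Field K]

/-- The determinant of three vectors. -/
def bracket (u v w : Fin 3 → K) : K :=
  u 0 * (v 1 * w 2 - v 2 * w 1) - u 1 * (v 0 * w 2 - v 2 * w 0) + u 2 * (v 0 * w 1 - v 1 * w 0)

/-- The coefficients of the line through two points. -/
def cross (u v : Fin 3 → K) : Fin 3 → K :=
  ![u 1 * v 2 - u 2 * v 1, u 2 * v 0 - u 0 * v 2, u 0 * v 1 - u 1 * v 0]

theorem linForm_cross (u v w : Fin 3 → K) : linForm (cross u v) w = bracket u v w := by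
  simp [linForm, cross, bracket]
  ring

/-- The product of two linear forms. -/
def mulLin (a b : Fin 3 → K) : Fin 6 → K :=
  ![a 0 * b 0, a 0 * b 1 + a 1 * b 0, a 0 * b 2 + a 2 * b 0, a 1 * b 1, a 1 * b 2 + a 2 * b 1,
    a 2 * b 2]

theorem quadForm_mulLin (a b v : Fin 3 → K) :
    quadForm (mulLin a b) v = linForm a v * linForm b v := by
  simp [quadForm, mulLin, linForm]
  ring

theorem VecGP.det_ne_zero {r : ℕ} {v : Fin r → Fin 3 → K} (h : VecGP v) {i j k : Fin r}
    (hij : i ≠ j) (hik : i ≠ k) (hjk : j ≠ k) : (Matrix.of ![v i, v j, v k]).det ≠ 0 := by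
  intro h0
  obtain ⟨a, ha, hM⟩ := Matrix.exists_mulVec_eq_zero_iff.2 h0
  have e : ∀ m, linForm a (![v i, v j, v k] m) = 0 := by
    intro m
    have := congrFun hM m
    simp only [Matrix.mulVec, dotProduct, Fin.sum_univ_three, Matrix.of_apply,
      Pi.zero_apply] at this
    simp only [linForm]
    linear_combination this
  exact h.line i j k hij hik hjk a ha (e 0) (e 1) (e 2)

theorem bracket_eq_det (u v w : Fin 3 → K) : bracket u v w = (Matrix.of ![u, v, w]).det := by
  rw [Matrix.det_fin_three]
  simp [bracket]
  ring

theorem VecGP.bracket_ne_zero {r : ℕ} {v : Fin r → Fin 3 → K} (h : VecGP v) {i j k : Fin r}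
    (hij : i ≠ j) (hik : i ≠ k) (hjk : j ≠ k) : bracket (v i) (v j) (v k) ≠ 0 := by
  rw [bracket_eq_det]
  exact h.det_ne_zero hij hik hjk

/-- The line pairs (01)(23) and (02)(13) span a pencil of conics through the points 0, 1, 2, 3. The
weights μ and ν select a member through point 4, and equality of the two bracket products would put
point 5 on it too. -/
theorem VecGP.bracket_conic {r : ℕ} {v : Fin r → Fin 3 → K} (h : VecGP v) {i : Fin 6 → Fin r}
    (hi : Function.Injective i) :
    bracket (v (i 0)) (v (i 1)) (v (i 5)) * bracket (v (i 2)) (v (i 3)) (v (i 5)) *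
      (bracket (v (i 0)) (v (i 2)) (v (i 4)) * bracket (v (i 1)) (v (i 3)) (v (i 4))) ≠
    bracket (v (i 0)) (v (i 2)) (v (i 5)) * bracket (v (i 1)) (v (i 3)) (v (i 5)) *
      (bracket (v (i 0)) (v (i 1)) (v (i 4)) * bracket (v (i 2)) (v (i 3)) (v (i 4))) := by
  intro heq
  have hb : ∀ {a b c : Fin 6}, a ≠ b → a ≠ c → b ≠ c →
      bracket (v (i a)) (v (i b)) (v (i c)) ≠ 0 := fun h1 h2 h3 =>
    h.bracket_ne_zero (hi.ne h1) (hi.ne h2) (hi.ne h3)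
  obtain ⟨μ, hμ⟩ : ∃ μ, μ = bracket (v (i 0)) (v (i 2)) (v (i 4)) *
    bracket (v (i 1)) (v (i 3)) (v (i 4)) := ⟨_, rfl⟩
  obtain ⟨ν, hν⟩ : ∃ ν, ν = bracket (v (i 0)) (v (i 1)) (v (i 4)) *
    bracket (v (i 2)) (v (i 3)) (v (i 4)) := ⟨_, rfl⟩
  have hν0 : ν ≠ 0 := by
    rw [hν]
    exact mul_ne_zero (hb (by decide) (by decide) (by decide)) (hb (by decide) (by decide) (by decide))
  obtain ⟨c, hcdef⟩ : ∃ c : Fin 6 → K, c = fun m =>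
    μ * mulLin (cross (v (i 0)) (v (i 1))) (cross (v (i 2)) (v (i 3))) m -
      ν * mulLin (cross (v (i 0)) (v (i 2))) (cross (v (i 1)) (v (i 3))) m := ⟨_, rfl⟩
  have hc : ∀ w, quadForm c w =
      μ * (bracket (v (i 0)) (v (i 1)) w * bracket (v (i 2)) (v (i 3)) w) -
      ν * (bracket (v (i 0)) (v (i 2)) w * bracket (v (i 1)) (v (i 3)) w) := by
    intro w
    simp only [← linForm_cross, ← quadForm_mulLin]
    rw [hcdef]
    simp only [quadForm]
    ring
  -- The conic is not the zero form: at the sum of the vectors 0 and 1 the first line pair vanishes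
  -- and the second does not.
  obtain ⟨k, hk, hne⟩ := h.conic (Finset.univ.map ⟨i, hi⟩) (by simp) c (by
    intro h0
    have h1 := hc (v (i 0) + v (i 1))
    rw [h0] at h1
    have e1 : bracket (v (i 0)) (v (i 1)) (v (i 0) + v (i 1)) = 0 := by
      simp [bracket]; ring
    have e2 : bracket (v (i 0)) (v (i 2)) (v (i 0) + v (i 1)) =
        -bracket (v (i 0)) (v (i 1)) (v (i 2)) := by
      simp [bracket]; ring
    have e3 : bracket (v (i 1)) (v (i 3)) (v (i 0) + v (i 1)) =
        bracket (v (i 0)) (v (i 1)) (v (i 3)) := by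
      simp [bracket]; ring
    rw [e1, e2, e3] at h1
    have : ν * (bracket (v (i 0)) (v (i 1)) (v (i 2)) * bracket (v (i 0)) (v (i 1)) (v (i 3))) = 0 := by
      have hz : quadForm (0 : Fin 6 → K) (v (i 0) + v (i 1)) = 0 := by simp [quadForm]
      linear_combination hz - h1
    exact mul_ne_zero hν0 (mul_ne_zero (hb (by decide) (by decide) (by decide))
      (hb (by decide) (by decide) (by decide))) this)
  obtain ⟨m, -, rfl⟩ := Finset.mem_map.1 hk
  apply hne
  rw [hc]
  simp only [Function.Embedding.coeFn_mk]
  have z1 : ∀ u w : Fin 3 → K, bracket u w u = 0 := fun u w => by simp [bracket]; ring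
  have z2 : ∀ u w : Fin 3 → K, bracket u w w = 0 := fun u w => by simp [bracket]; ring
  fin_cases m <;> simp only [Fin.reduceFinMk, Fin.zero_eta, Fin.mk_one, z1, z2]
  · ring
  · ring
  · ring
  · ring
  · rw [hμ, hν]; ring
  · rw [hμ, hν]; linear_combination heq

/-- Any four points in general position can be moved to the standard frame. -/
theorem VecGP.exists_frame {v : Fin 7 → Fin 3 → K} (h : VecGP v) :
    ∃ w : Fin 7 → Fin 3 → K, VecGP w ∧ w 0 = ![1, 0, 0] ∧ w 1 = ![0, 1, 0] ∧ w 2 = ![0, 0, 1] ∧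
      w 3 = ![1, 1, 1] ∧ ∀ i, 3 < i → w i 0 = 1 := by
  obtain ⟨M, hM⟩ : ∃ M, M = (Matrix.of ![v 0, v 1, v 2]).transpose := ⟨_, rfl⟩
  have hu : IsUnit M.det := by
    rw [hM, Matrix.det_transpose]
    exact (h.det_ne_zero (by decide) (by decide) (by decide)).isUnit
  have hinv := Matrix.nonsing_inv_mul M hu
  have h1 := h.mulVec hinv
  have hcol : ∀ m : Fin 3, M.mulVec (Pi.single m 1) = ![v 0, v 1, v 2] m := by
    intro m
    rw [Matrix.mulVec_single_one, hM]
    rfl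
  have hb : ∀ m : Fin 3, (M⁻¹).mulVec (![v 0, v 1, v 2] m) = Pi.single m 1 := by
    intro m
    rw [← hcol, Matrix.mulVec_mulVec, hinv, Matrix.one_mulVec]
  have b0 : (M⁻¹).mulVec (v 0) = Pi.single 0 1 := hb 0
  have b1 : (M⁻¹).mulVec (v 1) = Pi.single 1 1 := hb 1
  have b2 : (M⁻¹).mulVec (v 2) = Pi.single 2 1 := hb 2
  obtain ⟨x, hx⟩ : ∃ x, x = fun i => (M⁻¹).mulVec (v i) := ⟨_, rfl⟩
  rw [← hx] at h1
  have b0 : x 0 = Pi.single 0 1 := by rw [hx]; exact b0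
  have b1 : x 1 = Pi.single 1 1 := by rw [hx]; exact b1
  have b2 : x 2 = Pi.single 2 1 := by rw [hx]; exact b2
  -- A zero coordinate would put the point on a side of the coordinate triangle, collinear with two
  -- of its vertices.
  have hne : ∀ i, 2 < i → ∀ m, x i m ≠ 0 := by
    intro i hi m h0
    have key : ∀ j k : Fin 7, j ≠ k → j < 3 → k < 3 → linForm (Pi.single m 1) (x j) = 0 →
        linForm (Pi.single m 1) (x k) = 0 → False := by
      intro j k hjk hj hk e1 e2
      refine h1.line j k i hjk (by rintro rfl; omega) (by rintro rfl; omega) _ ?_ e1 e2 ?_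
      · exact fun h => one_ne_zero (α := K) (by simpa using congrFun h m)
      · fin_cases m <;> simpa [linForm] using h0
    fin_cases m
    · exact key 1 2 (by decide) (by decide) (by decide) (by simp [linForm, b1]) (by simp [linForm, b2])
    · exact key 0 2 (by decide) (by decide) (by decide) (by simp [linForm, b0]) (by simp [linForm, b2])
    · exact key 0 1 (by decide) (by decide) (by decide) (by simp [linForm, b0]) (by simp [linForm, b1])
  have hD : Matrix.diagonal (fun m => (x 3 m)⁻¹) * Matrix.diagonal (fun m => x 3 m) = 1 := by
    rw [Matrix.diagonal_mul_diagonal, ← Matrix.diagonal_one]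
    congr 1
    funext m
    exact inv_mul_cancel₀ (hne 3 (by decide) m)
  -- The diagonal map sends the fourth point to (1, 1, 1). The scalars restore the three unit
  -- vectors and make the first coordinate of the last three points equal to 1.
  have h2 := (h1.mulVec hD).smul (u := ![x 3 0, x 3 1, x 3 2, 1, x 3 0 / x 4 0, x 3 0 / x 5 0,
    x 3 0 / x 6 0]) (by
      have := hne 3 (by decide)
      have := hne 4 (by decide) 0
      have := hne 5 (by decide) 0
      have := hne 6 (by decide) 0
      intro i
      fin_cases i <;> simp_all)
  have n3 := hne 3 (by decide)
  refine ⟨_, h2, ?_, ?_, ?_, ?_, ?_⟩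
  · funext m; fin_cases m <;> simp [b0, n3]
  · funext m; fin_cases m <;> simp [b1, n3]
  · funext m; fin_cases m <;> simp [b2, n3]
  · funext m; fin_cases m <;> simp [Matrix.mulVec_diagonal, n3]
  · intro i hi
    have n0 := n3 0
    have n4 := hne 4 (by decide) 0
    have n5 := hne 5 (by decide) 0
    have n6 := hne 6 (by decide) 0
    fin_cases i
    · simp at hi
    · simp at hi
    · simp at hi
    · simp at hi
    all_goals
      simp [Matrix.mulVec_diagonal]
      field_simp

end Brackets

/-! ### No seven points over a field with at most eight elements. -/

section SevenSearch

/-- Multiplication after evaluation of the factors. -/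
def fmul (O : CodeOps) (a b : ℕ) : ℕ := force a fun a => force b fun b => O.mul a b

/-- Subtraction after evaluation of the terms. -/
def fsub (O : CodeOps) (a b : ℕ) : ℕ := force a fun a => force b fun b => O.sub a b

/-- The determinant of three coded vectors. -/
def brCode (O : CodeOps) (u v w : ℕ × ℕ × ℕ) : ℕ :=
  let d := fun a b c d => fsub O (fmul O a d) (fmul O b c)
  fsub O (fmul O u.1 (d v.2.1 v.2.2 w.2.1 w.2.2))
    (fsub O (fmul O u.2.1 (d v.1 v.2.2 w.1 w.2.2)) (fmul O u.2.2 (d v.1 v.2.1 w.1 w.2.1)))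

/-- A coded point is not collinear with two of the points in a list, nor on a conic with five of
them. -/
def arcCheck (O : CodeOps) (L : List (ℕ × ℕ × ℕ)) (f : ℕ × ℕ × ℕ) : Bool :=
  (L.sublistsLen 2).all (fun l => match l with
    | [a, b] => !(brCode O a b f == 0)
    | _ => true) &&
  (L.sublistsLen 5).all (fun l => match l with
    | [a, b, c, d, e] =>
      !(fmul O (fmul O (brCode O a b f) (brCode O c d f)) (fmul O (brCode O a c e) (brCode O b d e)) ==
        fmul O (fmul O (brCode O a c f) (brCode O b d f)) (fmul O (brCode O a b e) (brCode O c d e)))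
    | _ => true)

/-- The standard frame followed by other points. -/
def frameAnd (l : List (ℕ × ℕ × ℕ)) : List (ℕ × ℕ × ℕ) :=
  (1, 0, 0) :: (0, 1, 0) :: (0, 0, 1) :: (1, 1, 1) :: l

/-- Filter a list and pass on the result. -/
def forceFilter {α β : Type*} (f : β → Bool) : List β → (List β → α) → α
  | [], k => k []
  | b :: l, k => bif f b then forceFilter f l fun m => k (b :: m) else forceFilter f l k

/-- The codes of the affine points not on the lines of the frame. -/
def affinePts (q : ℕ) : List (ℕ × ℕ × ℕ) :=
  (List.range q).flatMap fun a => (List.range q).map fun b => (1, a, b)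

/-- There is no set of seven points in general position that contains the frame. -/
def noSeven (O : CodeOps) (q : ℕ) : Bool :=
  forceFilter (arcCheck O (frameAnd [])) (affinePts q) fun c =>
    c.all fun p => forceFilter (arcCheck O (frameAnd [p])) c fun c =>
      c.all fun s => c.all fun t => !(arcCheck O (frameAnd [s]) t && arcCheck O (frameAnd [p, s]) t)

theorem noSeven_five : noSeven (primeOps 5) 5 = true := by decide +kernel

theorem noSeven_seven : noSeven (primeOps 7) 7 = true := by decide +kernel

theorem noSeven_eight : noSeven eightOps 8 = true := by decide +kernel

theorem forceFilter_eq {α β : Type*} (f : β → Bool) (l : List β) (k : List β → α) :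
    forceFilter f l k = k (l.filter f) := by
  induction l generalizing k with
  | nil => rfl
  | cons b l ih =>
    cases h : f b <;> simp [forceFilter, h, ih]

theorem fmul_eq (O : CodeOps) (a b : ℕ) : fmul O a b = O.mul a b := by
  simp only [fmul, force_eq]

theorem fsub_eq (O : CodeOps) (a b : ℕ) : fsub O a b = O.sub a b := by
  simp only [fsub, force_eq]

variable {K : Type*} [Field K]

/-- The vector with coded entries. -/
def vecOf (val : ℕ → K) (p : ℕ × ℕ × ℕ) : Fin 3 → K := ![val p.1, val p.2.1, val p.2.2]

/-- The entries of a coded vector are codes. -/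
def CodeLt (q : ℕ) (p : ℕ × ℕ × ℕ) : Prop := p.1 < q ∧ p.2.1 < q ∧ p.2.2 < q

theorem val_brCode {q : ℕ} {O : CodeOps} {val : ℕ → K} (hO : IsCoding q O val)
    {u v w : ℕ × ℕ × ℕ} (hu : CodeLt q u) (hv : CodeLt q v) (hw : CodeLt q w) :
    brCode O u v w < q ∧
      val (brCode O u v w) = bracket (vecOf val u) (vecOf val v) (vecOf val w) := by
  obtain ⟨u1, u2, u3⟩ := hu
  obtain ⟨v1, v2, v3⟩ := hv
  obtain ⟨w1, w2, w3⟩ := hw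
  simp only [brCode, fmul_eq, fsub_eq]
  have hd : ∀ {x a b c d}, x < q → a < q → b < q → c < q → d < q →
      O.mul x (O.sub (O.mul a d) (O.mul b c)) < q ∧
      val (O.mul x (O.sub (O.mul a d) (O.mul b c))) = val x * (val a * val d - val b * val c) := by
    intro x a b c d hx ha hb hc hd
    have h1 := hO.mul_lt ha hd
    have h2 := hO.mul_lt hb hc
    have h3 := hO.sub_lt h1 h2
    exact ⟨hO.mul_lt hx h3, by rw [hO.val_mul hx h3, hO.val_sub h1 h2, hO.val_mul ha hd,
      hO.val_mul hb hc]⟩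
  obtain ⟨l1, e1⟩ := hd u1 v2 v3 w2 w3
  obtain ⟨l2, e2⟩ := hd u2 v1 v3 w1 w3
  obtain ⟨l3, e3⟩ := hd u3 v1 v2 w1 w2
  have l4 := hO.sub_lt l2 l3
  refine ⟨hO.sub_lt l1 l4, ?_⟩
  rw [hO.val_sub l1 l4, hO.val_sub l2 l3, e1, e2, e3]
  simp [bracket, vecOf]
  ring

/-- Soundness of the pruning: a configuration in general position passes the test for every choice
of points already placed. -/
theorem arcCheck_of_vecGP {q : ℕ} {O : CodeOps} {val : ℕ → K} (hO : IsCoding q O val) {r : ℕ}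
    {c : Fin r → ℕ × ℕ × ℕ} (hc : ∀ i, CodeLt q (c i)) (h : VecGP fun i => vecOf val (c i))
    (l : List (Fin r)) (j : Fin r) (hl : (j :: l).Nodup) :
    arcCheck O (l.map c) (c j) = true := by
  have h0q : 0 < q := by have := hO.one_lt; omega
  have hb := fun i j k => val_brCode hO (hc i) (hc j) (hc k)
  have hsub : ∀ {m : List (Fin r)}, m.Sublist l → (j :: m).Nodup := fun hm =>
    hl.sublist (hm.cons_cons j)
  simp only [arcCheck, Bool.and_eq_true, List.all_eq_true, List.mem_sublistsLen, and_imp,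
    List.sublist_map_iff]
  constructor
  · rintro _ ⟨m, hm, rfl⟩ hlen
    rw [List.length_map] at hlen
    obtain ⟨a, b, rfl⟩ := List.length_eq_two.1 hlen
    have hnd := hsub hm
    simp only [List.nodup_cons, List.mem_cons, List.not_mem_nil, not_or] at hnd
    simp only [List.map_cons, List.map_nil, Bool.not_eq_true', beq_eq_false_iff_ne]
    intro h0
    refine h.bracket_ne_zero (i := a) (j := b) (k := j) (by tauto) (by tauto) (by tauto) ?_
    rw [← (hb a b j).2, h0, hO.val_zero]
  · rintro _ ⟨m, hm, rfl⟩ hlen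
    rw [List.length_map] at hlen
    have hnd := hsub hm
    match m, hlen with
    | [a, b, c', d, e], _ =>
      simp only [List.map_cons, List.map_nil, Bool.not_eq_true', beq_eq_false_iff_ne]
      intro h0
      have hinj : Function.Injective ![a, b, c', d, e, j] := by
        rw [← List.nodup_ofFn]
        simp only [List.ofFn_succ, List.ofFn_zero]
        simp only [Matrix.cons_val_zero, Matrix.cons_val_succ]
        exact (List.perm_append_comm (l₁ := [j]) (l₂ := [a, b, c', d, e])).nodup_iff.1 hnd
      refine h.bracket_conic hinj ?_
      have := congrArg val h0
      simp only [fmul_eq] at this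
      rw [hO.val_mul, hO.val_mul, hO.val_mul, hO.val_mul, hO.val_mul, hO.val_mul] at this
      · simp only [(hb _ _ _).2] at this
        exact this
      all_goals first
        | exact (hb _ _ _).1
        | exact hO.mul_lt (hb _ _ _).1 (hb _ _ _).1

/-- A projective map takes four of the points to the frame, and the other three then have the form
(1, a, b), so the search would have met them. -/
theorem not_vecGP_of_noSeven {q : ℕ} {O : CodeOps} {val : ℕ → K} (hO : IsCoding q O val)
    (h : noSeven O q = true) (v : Fin 7 → Fin 3 → K) : ¬ VecGP v := by
  intro hv
  obtain ⟨w, hw, w0, w1, w2, w3, hw4⟩ := hv.exists_frame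
  choose code hlt hcode using hO.surj
  have hc1 : code 1 = 1 := hO.inj (hlt _) hO.one_lt ((hcode 1).trans hO.val_one.symm)
  have hc0 : code 0 = 0 :=
    hO.inj (hlt _) (by have := hO.one_lt; omega) ((hcode 0).trans hO.val_zero.symm)
  obtain ⟨c, hcdef⟩ : ∃ c : Fin 7 → ℕ × ℕ × ℕ, c = fun i => (code (w i 0), code (w i 1), code (w i 2)) :=
    ⟨_, rfl⟩
  have hc : ∀ i, CodeLt q (c i) := fun i => by rw [hcdef]; exact ⟨hlt _, hlt _, hlt _⟩
  have hwc : (fun i => vecOf val (c i)) = w := by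
    funext i m
    rw [hcdef]
    fin_cases m <;> simp [vecOf, hcode]
  have key := arcCheck_of_vecGP hO hc (by rw [hwc]; exact hw)
  have c0 : c 0 = (1, 0, 0) := by simp [hcdef, w0, hc0, hc1]
  have c1 : c 1 = (0, 1, 0) := by simp [hcdef, w1, hc0, hc1]
  have c2 : c 2 = (0, 0, 1) := by simp [hcdef, w2, hc0, hc1]
  have c3 : c 3 = (1, 1, 1) := by simp [hcdef, w3, hc1]
  have hframe : ∀ l : List (Fin 7), frameAnd (l.map c) = (0 :: 1 :: 2 :: 3 :: l).map c := by
    intro l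
    simp [frameAnd, c0, c1, c2, c3]
  have hmem : ∀ i, 3 < i → c i ∈ affinePts q := by
    intro i hi
    simp only [affinePts, List.mem_flatMap, List.mem_map, List.mem_range]
    exact ⟨_, (hc i).2.1, _, (hc i).2.2, by simp [hcdef, hw4 i hi, hc1]⟩
  simp only [noSeven, forceFilter_eq, List.all_eq_true, List.mem_filter, Bool.not_eq_true', and_imp] at h
  have k0 : ∀ i, 3 < i → arcCheck O (frameAnd []) (c i) = true := by
    intro i hi
    have := hframe []
    rw [List.map_nil] at this
    rw [this]
    refine key _ _ ?_
    revert i; decide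
  have k1 : ∀ i j, 3 < i → 3 < j → i ≠ j → arcCheck O (frameAnd [c i]) (c j) = true := by
    intro i j hi hj hij
    have := hframe [i]
    rw [List.map_singleton] at this
    rw [this]
    clear this
    refine key _ _ ?_
    revert i j; decide
  have h5 := h (c 4) (hmem 4 (by decide)) (k0 4 (by decide)) (c 5) (hmem 5 (by decide))
    (k0 5 (by decide)) (k1 4 5 (by decide) (by decide) (by decide)) (c 6) (hmem 6 (by decide))
    (k0 6 (by decide)) (k1 4 6 (by decide) (by decide) (by decide))
  rw [k1 5 6 (by decide) (by decide) (by decide), Bool.true_and] at h5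
  have := hframe [4, 5]
  rw [List.map_cons, List.map_singleton] at this
  rw [this, key _ _ (by decide)] at h5
  simp at h5

theorem not_vecGP_seven [Finite K] (hK : Nat.card K ≤ 8) (v : Fin 7 → Fin 3 → K) : ¬ VecGP v := by
  intro hv
  have hne : Nat.card K ≠ 1 := Finite.one_lt_card.ne'
  obtain ⟨p, hp⟩ := CharP.exists K
  have := Fintype.ofFinite K
  obtain ⟨N, hpp, hN⟩ := FiniteField.card K p
  rw [← Nat.card_eq_fintype_card] at hN
  have hle : 5 ≤ Nat.card K := by
    obtain ⟨w, hw, w0, w1, w2, w3, hw4⟩ := hv.exists_frame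
    classical
    -- These are the slopes of the lines joining point 2 to the points 0, 3, 4, 5, 6. The lines are
    -- distinct, so the field has at least five elements; the line to point 1 has infinite slope.
    have hinj : Function.Injective ![0, 1, w 4 1, w 5 1, w 6 1] := by
      have a0 : ∀ i, 3 < i → w i 1 ≠ 0 := fun i hi h0 =>
        hw.bracket_ne_zero (i := 0) (j := 2) (k := i) (by decide) (by rintro rfl; omega)
          (by rintro rfl; omega) (by simp [bracket, w0, w2, h0])
      have a1 : ∀ i, 3 < i → w i 1 ≠ 1 := fun i hi h0 =>
        hw.bracket_ne_zero (i := 2) (j := 3) (k := i) (by decide) (by rintro rfl; omega)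
          (by rintro rfl; omega) (by simp [bracket, w2, w3, h0, hw4 i hi])
      have a2 : ∀ i j, 3 < i → 3 < j → i ≠ j → w i 1 ≠ w j 1 := fun i j hi hj hij h0 =>
        hw.bracket_ne_zero (i := 2) (j := i) (k := j) (by rintro rfl; omega)
          (by rintro rfl; omega) hij (by simp [bracket, w2, h0, hw4 i hi, hw4 j hj])
      rw [← List.nodup_ofFn]
      have b4 := a0 4 (by decide)
      have b5 := a0 5 (by decide)
      have b6 := a0 6 (by decide)
      have c4 := a1 4 (by decide)
      have c5 := a1 5 (by decide)
      have c6 := a1 6 (by decide)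
      have d45 := a2 4 5 (by decide) (by decide) (by decide)
      have d46 := a2 4 6 (by decide) (by decide) (by decide)
      have d56 := a2 5 6 (by decide) (by decide) (by decide)
      simp [List.ofFn_succ, b4.symm, b5.symm, b6.symm, c4.symm, c5.symm, c6.symm, d45, d46, d56]
    have := Nat.card_le_card_of_injective _ hinj
    simpa using this
  have hcases : (p = 5 ∧ Nat.card K = 5) ∨ (p = 7 ∧ Nat.card K = 7) ∨ Nat.card K = 8 := by
    have hp2 := hpp.two_le
    have hN0 := N.pos
    have hpK : p ≤ 8 := (Nat.le_self_pow hN0.ne' p).trans (hN ▸ hK)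
    have hN3 : (N : ℕ) ≤ 3 := by
      by_contra! h
      have h1 : 2 ^ 4 ≤ p ^ (N : ℕ) := (Nat.pow_le_pow_left hp2 4).trans
        (Nat.pow_le_pow_right (by omega) h)
      omega
    rw [hN] at hK hle ⊢
    generalize (N : ℕ) = n at *
    interval_cases p <;> interval_cases n <;> simp at hK hle hpp ⊢ <;> norm_num at hpp
  obtain ⟨rfl, h⟩ | ⟨rfl, h⟩ | h := hcases
  · exact not_vecGP_of_noSeven (isCoding_prime hpp h) noSeven_five v hv
  · exact not_vecGP_of_noSeven (isCoding_prime hpp h) noSeven_seven v hv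
  · obtain ⟨val, hO⟩ := exists_isCoding_eight h
    exact not_vecGP_of_noSeven hO noSeven_eight v hv

end SevenSearch

/-! ### The pencil of cubics through eight points and its ninth base point. -/

section Pencil

variable {K : Type*} [Field K]

/-- At most two of the points lie on the line, which leaves six for the conic. Hence a cubic through
the eight points has no linear factor over K. -/
theorem VecGP.not_line_conic {v : Fin 8 → Fin 3 → K} (h : VecGP v)
    {F : (Fin 3 → K) → K} {a : Fin 3 → K} {d : Fin 6 → K} (ha : a ≠ 0) (hd : d ≠ 0)
    (hF : ∀ x, F x = linForm a x * quadForm d x) (hv : ∀ i, F (v i) = 0) :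
    False := by
  classical
  obtain ⟨S, hS⟩ : ∃ S : Finset (Fin 8), S = Finset.univ.filter fun i => linForm a (v i) = 0 :=
    ⟨_, rfl⟩
  have hcard : S.card ≤ 2 := by
    by_contra! h3
    obtain ⟨i, j, k, hi, hj, hk, hij, hik, hjk⟩ := Finset.two_lt_card_iff.1 h3
    rw [hS, Finset.mem_filter] at hi hj hk
    exact h.line i j k hij hik hjk a ha hi.2 hj.2 hk.2
  have hcompl : 6 ≤ Sᶜ.card := by
    rw [Finset.card_compl, Fintype.card_fin]
    omega
  obtain ⟨T, hT, hT6⟩ := Finset.exists_subset_card_eq hcompl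
  obtain ⟨i, hi, hne⟩ := h.conic T hT6 d hd
  have hi' := hT hi
  rw [Finset.mem_compl, hS, Finset.mem_filter] at hi'
  have := hv i
  rw [hF] at this
  rcases mul_eq_zero.1 this with h0 | h0
  · exact hi' ⟨Finset.mem_univ _, h0⟩
  · exact hne h0

theorem cubForm_add_smul (α β : K) (c d : Fin 10 → K) (v : Fin 3 → K) :
    cubForm (α • c + β • d) v = α * cubForm c v + β * cubForm d v := by
  simp [cubForm]
  ring

theorem cubGrad_add_smul (α β : K) (c d : Fin 10 → K) (v : Fin 3 → K) :
    cubGrad (α • c + β • d) v = α • cubGrad c v + β • cubGrad d v := by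
  funext k
  fin_cases k <;> simp [cubGrad] <;> ring

/-- Evaluation of cubic forms at eight points. -/
def evalMap (v : Fin 8 → Fin 3 → K) : (Fin 10 → K) →ₗ[K] (Fin 8 → K) where
  toFun c i := cubForm c (v i)
  map_add' x y := by funext i; simp [cubForm]; ring
  map_smul' c x := by funext i; simp [cubForm]; ring

/-- Ten coefficients against eight linear conditions. -/
theorem exists_pencil (v : Fin 8 → Fin 3 → K) : ∃ c d : Fin 10 → K,
    (∀ i, cubForm c (v i) = 0) ∧ (∀ i, cubForm d (v i) = 0) ∧
      ∀ α β : K, α • c + β • d = 0 → α = 0 ∧ β = 0 := by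
  have h1 := LinearMap.finrank_range_add_finrank_ker (evalMap v)
  have h2 : Module.finrank K (LinearMap.range (evalMap v)) ≤ 8 := by
    simpa using Submodule.finrank_le (LinearMap.range (evalMap v))
  have h3 : 1 < Module.finrank K (LinearMap.ker (evalMap v)) := by
    simp at h1
    omega
  have : Nontrivial (LinearMap.ker (evalMap v)) :=
    Module.nontrivial_of_finrank_pos (R := K) (by omega)
  obtain ⟨x, hx⟩ := exists_ne (0 : LinearMap.ker (evalMap v))
  obtain ⟨y, hy⟩ := exists_linearIndependent_pair_of_one_lt_finrank h3 hx
  refine ⟨x, y, fun i => congrFun x.2 i, fun i => congrFun y.2 i, fun α β h => ?_⟩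
  exact LinearIndependent.pair_iff.1 hy α β (Subtype.ext (by simpa using h))

/-- Eight points in coordinates adapted to the first one. -/
structure AdaptedPts (w : Fin 8 → Fin 3 → K) : Prop where
  gp : VecGP w
  zero : w 0 = ![0, 0, 1]
  one : ∀ i, i ≠ 0 → w i 0 = 1

/-- Once the first point is (0 : 0 : 1), the lines ax + y = 0 pass through it and each of the other
seven points lies on at most one of them. As K has more than seven elements, one of these lines
misses all seven; it becomes x = 0. -/
theorem VecGP.exists_adapted [Finite K] (hK : 7 < Nat.card K) {v : Fin 8 → Fin 3 → K}
    (h : VecGP v) : ∃ w : Fin 8 → Fin 3 → K, AdaptedPts w := by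
  classical
  have := Fintype.ofFinite K
  obtain ⟨M, hM⟩ : ∃ M, M = (Matrix.of ![v 1, v 2, v 0]).transpose := ⟨_, rfl⟩
  have hu : IsUnit M.det := by
    rw [hM, Matrix.det_transpose]
    exact (h.det_ne_zero (by decide) (by decide) (by decide)).isUnit
  have hinv := Matrix.nonsing_inv_mul M hu
  have h1 := h.mulVec hinv
  obtain ⟨x, hx⟩ : ∃ x, x = fun i => (M⁻¹).mulVec (v i) := ⟨_, rfl⟩
  rw [← hx] at h1
  have hx0 : x 0 = Pi.single 2 1 := by
    have : M.mulVec (Pi.single 2 1) = v 0 := by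
      rw [Matrix.mulVec_single_one, hM]
      rfl
    rw [hx]
    simp only
    rw [← this, Matrix.mulVec_mulVec, hinv, Matrix.one_mulVec]
  have hxy : ∀ i, i ≠ 0 → x i 0 ≠ 0 ∨ x i 1 ≠ 0 := by
    intro i hi
    by_contra! hc
    obtain ⟨k, hk0, hki⟩ : ∃ k : Fin 8, k ≠ 0 ∧ k ≠ i := by
      have : ∀ i : Fin 8, ∃ k : Fin 8, k ≠ 0 ∧ k ≠ i := by decide
      exact this i
    refine h1.bracket_ne_zero hi.symm hk0.symm hki.symm ?_
    simp [bracket, hx0, hc.1, hc.2]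
  obtain ⟨a, ha⟩ : ∃ a : K, ∀ i, i ≠ 0 → a * x i 0 + x i 1 ≠ 0 := by
    by_contra! hc
    have hsub : (Finset.univ : Finset K) ⊆
        (Finset.univ.erase (0 : Fin 8)).image fun i => -x i 1 / x i 0 := by
      intro a _
      obtain ⟨i, hi, hia⟩ := hc a
      refine Finset.mem_image.2 ⟨i, Finset.mem_erase.2 ⟨hi, Finset.mem_univ _⟩, ?_⟩
      rcases hxy i hi with h0 | h0
      · field_simp
        linear_combination -hia
      · have hne : x i 0 ≠ 0 := by
          intro h2
          rw [h2] at hia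
          exact h0 (by linear_combination hia)
        field_simp
        linear_combination -hia
    have := (Finset.card_le_card hsub).trans Finset.card_image_le
    rw [Finset.card_univ, ← Nat.card_eq_fintype_card, Finset.card_erase_of_mem (Finset.mem_univ _),
      Finset.card_univ, Fintype.card_fin] at this
    omega
  have hN : (!![a, 1, 0; 1, 0, 0; 0, 0, 1] : Matrix (Fin 3) (Fin 3) K) *
      !![0, 1, 0; 1, -a, 0; 0, 0, 1] = 1 := by
    ext i j
    fin_cases i <;> fin_cases j <;> simp [Matrix.mul_apply, Fin.sum_univ_three]
  have h2 := (h1.mulVec hN).smul (u := fun i => if i = 0 then 1 else (a * x i 0 + x i 1)⁻¹) (by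
    intro i
    split_ifs with hi
    · exact one_ne_zero
    · exact inv_ne_zero (ha i hi))
  refine ⟨_, h2, ?_, ?_⟩
  · funext m
    fin_cases m <;> simp [Matrix.mulVec, dotProduct, Fin.sum_univ_three, hx0]
  · intro i hi
    have := ha i hi
    simp [Matrix.mulVec, dotProduct, Fin.sum_univ_three, hi]
    field_simp

/-- A pencil of cubics through eight points whose members have given tangents at the first one. -/
structure AdaptedPencil (w : Fin 8 → Fin 3 → K) (f g : Fin 10 → K) : Prop where
  f_zero : ∀ i, cubForm f (w i) = 0
  g_zero : ∀ i, cubForm g (w i) = 0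
  f5 : f 5 = 1
  f8 : f 8 = 0
  f9 : f 9 = 0
  g5 : g 5 = 0
  g8 : g 8 = 1
  g9 : g 9 = 0

theorem AdaptedPencil.ne_zero {w : Fin 8 → Fin 3 → K} {f g : Fin 10 → K}
    (hfg : AdaptedPencil w f g) {α β : K} (h : α ≠ 0 ∨ β ≠ 0) : α • f + β • g ≠ 0 := by
  intro h0
  have h5 := congrFun h0 5
  have h8 := congrFun h0 8
  simp [hfg.f5, hfg.f8, hfg.g5, hfg.g8] at h5 h8
  tauto

/-- The coefficients of xz² and yz² give the tangent at the first point. No nonzero member is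
singular there, so this map from the two-dimensional pencil to K² is injective, hence bijective, and
f and g are the preimages of the unit vectors. -/
theorem AdaptedPts.exists_pencil {w : Fin 8 → Fin 3 → K} (h : AdaptedPts w) :
    ∃ f g, AdaptedPencil w f g := by
  obtain ⟨c, d, hc, hd, hcd⟩ := PlanePoints.exists_pencil w
  have h9 : ∀ c : Fin 10 → K, cubForm c (w 0) = 0 → c 9 = 0 := by
    intro c hc
    simpa [cubForm, h.zero] using hc
  have hsm : ∀ α β : K, (α ≠ 0 ∨ β ≠ 0) → α * c 5 + β * d 5 = 0 → α * c 8 + β * d 8 ≠ 0 := by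
    intro α β hαβ h5 h8
    refine h.gp.cubic Finset.univ (by simp) (α • c + β • d) (fun h0 => ?_) (fun i _ => ?_) 0
      (Finset.mem_univ _) ?_
    · have := hcd α β h0
      tauto
    · rw [cubForm_add_smul, hc, hd]
      ring
    · have c9 := h9 c (hc 0)
      have d9 := h9 d (hd 0)
      rw [h.zero]
      funext k
      fin_cases k <;> simp [cubGrad, c9, d9, h5, h8]
  have hdet : c 5 * d 8 - c 8 * d 5 ≠ 0 := by
    intro h0
    by_cases h5 : c 5 = 0 ∧ d 5 = 0
    · by_cases h8 : c 8 = 0 ∧ d 8 = 0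
      · exact hsm 1 0 (by simp) (by simp [h5.1]) (by simp [h8.1])
      · exact hsm (d 8) (-c 8) (by rw [neg_ne_zero]; tauto) (by simp [h5.1, h5.2]) (by ring)
    · exact hsm (d 5) (-c 5) (by rw [neg_ne_zero]; tauto) (by ring) (by linear_combination -h0)
  obtain ⟨D, hD⟩ : ∃ D, D = c 5 * d 8 - c 8 * d 5 := ⟨_, rfl⟩
  rw [← hD] at hdet
  have hz : ∀ (α β : K) (i), cubForm (α • c + β • d) (w i) = 0 := fun α β i => by
    rw [cubForm_add_smul, hc, hd]
    ring
  refine ⟨(d 8 / D) • c + (-c 8 / D) • d, (-d 5 / D) • c + (c 5 / D) • d, hz _ _, hz _ _,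
    ?_, ?_, h9 _ (hz _ _ 0), ?_, ?_, h9 _ (hz _ _ 0)⟩ <;>
  · simp
    field_simp
    try rw [hD]
    try ring

open Polynomial in
theorem coeff_mul_of_natDegree_le {p q : K[X]} {m n k : ℕ} (hk : m + n = k)
    (hp : p.natDegree ≤ m) (hq : q.natDegree ≤ n) : (p * q).coeff k = p.coeff m * q.coeff n := by
  rw [← hk, coeff_mul_add_eq_of_natDegree_le hp hq]

open Polynomial in
/-- The cubics through eight points in general position have a ninth common point. -/
theorem AdaptedPts.exists_ninth {w : Fin 8 → Fin 3 → K} (h : AdaptedPts w) {f g : Fin 10 → K}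
    (hfg : AdaptedPencil w f g) : ∃ p : Fin 3 → K, p ≠ 0 ∧ cubForm f p = 0 ∧ cubForm g p = 0 ∧
      ∀ i (s : K), p ≠ s • w i := by
  obtain ⟨hf, hg, f5, f8, f9, g5, g8, g9⟩ := hfg
  have hw : ∀ i, i ≠ 0 → w i = ![1, w i 1, w i 2] := by
    intro i hi
    funext m
    fin_cases m
    · exact h.one i hi
    · rfl
    · rfl
  have ht : Set.InjOn (fun i => w i 1) ((Finset.univ.erase (0 : Fin 8) : Finset (Fin 8)) : Set (Fin 8)) := by
    intro i hi j hj hij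
    by_contra hne
    have hi0 : i ≠ 0 := by simpa using hi
    have hj0 : j ≠ 0 := by simpa using hj
    refine h.gp.bracket_ne_zero (i := 0) (j := i) (k := j) hi0.symm hj0.symm hne ?_
    simp only at hij
    simp [bracket, h.zero, h.one i hi0, h.one j hj0, hij]
  obtain ⟨Q, hQ⟩ : ∃ Q : K[X], Q = C (f 2) + C (f 4) * X + C (f 7) * X ^ 2 := ⟨_, rfl⟩
  obtain ⟨Q', hQ'⟩ : ∃ Q : K[X], Q = C (g 2) + C (g 4) * X + C (g 7) * X ^ 2 := ⟨_, rfl⟩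
  obtain ⟨D, hD⟩ : ∃ D : K[X], D = C (f 0) + C (f 1) * X + C (f 3) * X ^ 2 + C (f 6) * X ^ 3 :=
    ⟨_, rfl⟩
  obtain ⟨D', hD'⟩ : ∃ D : K[X], D = C (g 0) + C (g 1) * X + C (g 3) * X ^ 2 + C (g 6) * X ^ 3 :=
    ⟨_, rfl⟩
  -- On x = 1, y = t the cubics are z² + Qz + D and tz² + Q'z + D', so g − tf = Az + B. Since E = QB
  -- − AD, the polynomial R = B² − AE is the resultant in z of f and Az + B. Written as QD' − Q'D, E
  -- has degree at most 5, so R has degree at most 8: the nine intersections less the transversal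
  -- one at (0 : 0 : 1).
  obtain ⟨A, hA⟩ : ∃ A : K[X], A = Q' - X * Q := ⟨_, rfl⟩
  obtain ⟨B, hB⟩ : ∃ B : K[X], B = D' - X * D := ⟨_, rfl⟩
  obtain ⟨E, hE⟩ : ∃ E : K[X], E = Q * D' - Q' * D := ⟨_, rfl⟩
  obtain ⟨R, hR⟩ : ∃ R : K[X], R = B * B - A * E := ⟨_, rfl⟩
  have eQ : ∀ t, Q.eval t = f 2 + f 4 * t + f 7 * t ^ 2 := fun t => by simp [hQ]
  have eQ' : ∀ t, Q'.eval t = g 2 + g 4 * t + g 7 * t ^ 2 := fun t => by simp [hQ']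
  have eD : ∀ t, D.eval t = f 0 + f 1 * t + f 3 * t ^ 2 + f 6 * t ^ 3 := fun t => by simp [hD]
  have eD' : ∀ t, D'.eval t = g 0 + g 1 * t + g 3 * t ^ 2 + g 6 * t ^ 3 := fun t => by simp [hD']
  have eA : ∀ t, A.eval t = Q'.eval t - t * Q.eval t := fun t => by simp [hA]
  have eB : ∀ t, B.eval t = D'.eval t - t * D.eval t := fun t => by simp [hB]
  have eE : ∀ t, E.eval t = Q.eval t * D'.eval t - Q'.eval t * D.eval t := fun t => by simp [hE]
  have eR : ∀ t, R.eval t = B.eval t ^ 2 - A.eval t * E.eval t := fun t => by simp [hR]; ring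
  have cf : ∀ t z, cubForm f ![1, t, z] = z ^ 2 + z * Q.eval t + D.eval t := by
    intro t z
    simp [cubForm, f5, f8, f9, eQ, eD]
    ring
  have cg : ∀ t z, cubForm g ![1, t, z] = t * z ^ 2 + z * Q'.eval t + D'.eval t := by
    intro t z
    simp [cubForm, g5, g8, g9, eQ', eD']
    ring
  -- no member of the pencil contains a line through the first point
  have hA0 : ∀ t, A.eval t = 0 → B.eval t ≠ 0 := by
    intro t ha hb
    rw [eA, eQ, eQ'] at ha
    rw [eB, eD, eD'] at hb
    refine h.gp.not_line_conic (F := cubForm (t • f + (-1 : K) • g)) (a := ![-t, 1, 0])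
      (d := ![(t * f 1 - g 1) + (t * f 3 - g 3) * t + (t * f 6 - g 6) * t ^ 2,
        (t * f 3 - g 3) + (t * f 6 - g 6) * t, (t * f 4 - g 4) + (t * f 7 - g 7) * t,
        t * f 6 - g 6, t * f 7 - g 7, -1]) ?_ ?_ ?_ ?_
    · exact fun h => one_ne_zero (congrFun h 1)
    · intro h
      have := congrFun h 5
      simp at this
    · intro x
      rw [cubForm_add_smul]
      simp [cubForm, linForm, quadForm, f5, f8, f9, g5, g8, g9]
      linear_combination (-x 0 ^ 2 * x 2) * ha - x 0 ^ 3 * hb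
    · intro i
      rw [cubForm_add_smul, hf, hg]
      ring
  have hroot : ∀ t, R.eval t = 0 → A.eval t ≠ 0 := by
    intro t hr ha
    rw [eR, ha] at hr
    exact hA0 t ha (pow_eq_zero_iff two_ne_zero |>.1 (by linear_combination hr))
  have hpt : ∀ t, R.eval t = 0 → cubForm f ![1, t, -B.eval t / A.eval t] = 0 ∧
      cubForm g ![1, t, -B.eval t / A.eval t] = 0 := by
    intro t hr
    have ha := hroot t hr
    rw [eR, eE] at hr
    rw [cf, cg]
    constructor
    · field_simp
      rw [eA, eB] at hr ⊢
      linear_combination hr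
    · field_simp
      rw [eA, eB] at hr ⊢
      linear_combination t * hr
  have hzj : ∀ i, i ≠ 0 → w i 2 * A.eval (w i 1) + B.eval (w i 1) = 0 := by
    intro i hi
    have h1 := hf i
    have h2 := hg i
    rw [hw i hi, cf] at h1
    rw [hw i hi, cg] at h2
    rw [eA, eB]
    linear_combination h2 - w i 1 * h1
  have hRj : ∀ i ∈ Finset.univ.erase (0 : Fin 8), R.IsRoot (w i 1) := by
    intro i hi
    have hi0 : i ≠ 0 := by simpa using hi
    have h1 := hf i
    have hz := hzj i hi0
    rw [hw i hi0, cf] at h1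
    rw [IsRoot, eR, eE]
    have hb : B.eval (w i 1) = -(w i 2 * A.eval (w i 1)) := by linear_combination hz
    have hb' := hb
    rw [eA, eB] at hb'
    rw [hb, eA]
    rw [eA] at hz
    linear_combination (Polynomial.eval (w i 1) Q' - w i 1 * Polynomial.eval (w i 1) Q) ^ 2 * h1 -
      (Polynomial.eval (w i 1) Q' - w i 1 * Polynomial.eval (w i 1) Q) * Polynomial.eval (w i 1) Q *
        hb'
  have hdvd := prod_dvd_of_injOn ht hRj
  have dQ : Q.natDegree ≤ 2 := by rw [hQ]; compute_degree
  have dQ' : Q'.natDegree ≤ 2 := by rw [hQ']; compute_degree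
  have dD : D.natDegree ≤ 3 := by rw [hD]; compute_degree
  have dD' : D'.natDegree ≤ 3 := by rw [hD']; compute_degree
  have kQ : Q.coeff 2 = f 7 := by rw [hQ]; simp
  have kQ' : Q'.coeff 2 = g 7 := by rw [hQ']; simp
  have kD : D.coeff 3 = f 6 := by rw [hD]; simp
  have kD' : D'.coeff 3 = g 6 := by rw [hD']; simp
  have dA : A.natDegree ≤ 3 := by
    rw [hA]
    exact natDegree_sub_le_of_le (dQ'.trans (by norm_num : 2 ≤ 3))
      (natDegree_mul_le_of_le (m := 1) natDegree_X_le dQ)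
  have dB : B.natDegree ≤ 4 := by
    rw [hB]
    exact natDegree_sub_le_of_le (dD'.trans (by norm_num : 3 ≤ 4))
      (natDegree_mul_le_of_le (m := 1) natDegree_X_le dD)
  have dE : E.natDegree ≤ 5 := by
    rw [hE]
    exact natDegree_sub_le_of_le (natDegree_mul_le_of_le dQ dD') (natDegree_mul_le_of_le dQ' dD)
  have dR : R.natDegree ≤ 8 := by
    rw [hR]
    exact natDegree_sub_le_of_le (natDegree_mul_le_of_le dB dB) (natDegree_mul_le_of_le dA dE)
  have kA : A.coeff 3 = -f 7 := by
    rw [hA, coeff_sub, coeff_X_mul, kQ, coeff_eq_zero_of_natDegree_lt (by omega)]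
    ring
  have kB : B.coeff 4 = -f 6 := by
    rw [hB, coeff_sub, coeff_X_mul, kD, coeff_eq_zero_of_natDegree_lt (by omega)]
    ring
  have kE : E.coeff 5 = f 7 * g 6 - g 7 * f 6 := by
    rw [hE, coeff_sub, coeff_mul_of_natDegree_le (m := 2) (n := 3) rfl dQ dD',
      coeff_mul_of_natDegree_le (m := 2) (n := 3) rfl dQ' dD, kQ, kQ', kD, kD']
  have kR : R.coeff 8 = f 6 ^ 2 + f 7 * (f 7 * g 6 - g 7 * f 6) := by
    rw [hR, coeff_sub, coeff_mul_of_natDegree_le (m := 4) (n := 4) rfl dB dB,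
      coeff_mul_of_natDegree_le (m := 3) (n := 5) rfl dA dE, kA, kB, kE]
    ring
  -- If the degree drops, the missing intersection is on the line x = 0. Otherwise R is the product
  -- of the seven known factors and a linear one, whose root gives the ninth point.
  by_cases h8 : R.coeff 8 = 0
  · rw [kR] at h8
    have hf7 : f 7 ≠ 0 := by
      intro h7
      have h6 : f 6 = 0 := by
        rw [h7] at h8
        exact pow_eq_zero_iff two_ne_zero |>.1 (by linear_combination h8)
      refine h.gp.not_line_conic (F := cubForm f) (a := ![1, 0, 0])
        (d := ![f 0, f 1, f 2, f 3, f 4, 1]) ?_ ?_ ?_ hf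
      · exact fun h => one_ne_zero (congrFun h 0)
      · exact fun h => one_ne_zero (congrFun h 5)
      · intro x
        simp [cubForm, linForm, quadForm, f5, f8, f9, h6, h7]
        ring
    refine ⟨![0, 1, -f 6 / f 7], fun h => one_ne_zero (congrFun h 1), ?_, ?_, ?_⟩
    · simp [cubForm, f8, f9]
      field_simp
      ring
    · simp [cubForm, g8, g9]
      field_simp
      linear_combination h8
    · intro i s hs
      rcases eq_or_ne i 0 with rfl | hi
      · have := congrFun hs 1
        simp [h.zero] at this
      · have h0 := congrFun hs 0
        have h1 := congrFun hs 1
        simp [h.one i hi] at h0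
        simp [← h0] at h1
  · obtain ⟨S, hS⟩ := hdvd
    obtain ⟨P, hP⟩ : ∃ P, P = (((Finset.univ.erase (0 : Fin 8)).val.map fun i => w i 1).map
      fun a => X - C a).prod := ⟨_, rfl⟩
    rw [← hP] at hS
    have hPm : P.Monic := by
      rw [hP]
      exact monic_multiset_prod_of_monic _ _ fun a _ => monic_X_sub_C a
    have hPd : P.natDegree = 7 := by
      rw [hP, natDegree_multiset_prod_X_sub_C_eq_card]
      simp
    have hS0 : S ≠ 0 := by
      rintro rfl
      rw [hS] at h8
      simp at h8
    have hSd : S.natDegree ≤ 1 := by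
      have := hPm.natDegree_mul' hS0
      rw [← hS, hPd] at this
      omega
    have hSc : S.coeff 1 ≠ 0 := by
      intro h1
      apply h8
      rw [hS, coeff_mul_of_natDegree_le (m := 7) (n := 1) rfl hPd.le hSd, h1, mul_zero]
    obtain ⟨t, hSt⟩ : ∃ t, S.eval t = 0 := by
      refine ⟨-S.coeff 0 / S.coeff 1, ?_⟩
      rw [eval_eq_sum_range' (n := 2) (by omega)]
      simp [Finset.sum_range_succ]
      field_simp
      ring
    have hRt : R.eval t = 0 := by rw [hS, eval_mul, hSt, mul_zero]
    -- If the eighth root repeats a known one, R has a double root there. Then the gradients of f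
    -- and g at that point are proportional, and some member of the pencil is singular at it,
    -- against general position.
    by_cases hmem : ∃ i, i ≠ 0 ∧ w i 1 = t
    · exfalso
      obtain ⟨i, hi, rfl⟩ := hmem
      have hPt : P.eval (w i 1) = 0 := by
        have : X - C (w i 1) ∣ P := by
          rw [hP]
          refine Multiset.dvd_prod (Multiset.mem_map.2 ⟨w i 1, Multiset.mem_map.2 ⟨i, ?_, rfl⟩, rfl⟩)
          exact Finset.mem_erase.2 ⟨hi, Finset.mem_univ _⟩
        exact dvd_iff_isRoot.1 this
      have hder : R.derivative.eval (w i 1) = 0 := by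
        rw [hS, derivative_mul, eval_add, eval_mul, eval_mul, hSt, hPt]
        ring
      have ha := hroot _ hRt
      have hz := hzj i hi
      have hfi := hf i
      have hgi := hg i
      rw [hw i hi, cf] at hfi
      rw [hw i hi, cg] at hgi
      obtain ⟨t, rt⟩ : ∃ t, t = w i 1 := ⟨_, rfl⟩
      obtain ⟨z, rz⟩ : ∃ z, z = w i 2 := ⟨_, rfl⟩
      have hwi := hw i hi
      rw [← rt] at hder ha hz hfi hgi hwi
      rw [← rz] at hz hfi hgi hwi
      obtain ⟨q₁, hq₁⟩ : ∃ q, q = Q.derivative.eval t := ⟨_, rfl⟩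
      obtain ⟨q₁', hq₁'⟩ : ∃ q, q = Q'.derivative.eval t := ⟨_, rfl⟩
      obtain ⟨d₁, hd₁⟩ : ∃ q, q = D.derivative.eval t := ⟨_, rfl⟩
      obtain ⟨d₁', hd₁'⟩ : ∃ q, q = D'.derivative.eval t := ⟨_, rfl⟩
      have dA1 : A.derivative.eval t = q₁' - Q.eval t - t * q₁ := by
        rw [hA, hq₁, hq₁']; simp; ring
      have dB1 : B.derivative.eval t = d₁' - D.eval t - t * d₁ := by
        rw [hB, hd₁, hd₁']; simp; ring
      have dE1 : E.derivative.eval t = q₁ * D'.eval t + Q.eval t * d₁' - q₁' * D.eval t -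
          Q'.eval t * d₁ := by
        rw [hE, hd₁, hd₁', hq₁, hq₁']; simp; ring
      have gfz : cubGrad f (w i) 2 = 2 * z + Q.eval t := by
        rw [hwi]; simp [cubGrad, f5, f8, f9, eQ]; ring
      have ggz : cubGrad g (w i) 2 = 2 * t * z + Q'.eval t := by
        rw [hwi]; simp [cubGrad, g5, g8, g9, eQ']; ring
      have gfy : cubGrad f (w i) 1 = z * q₁ + d₁ := by
        rw [hwi, hq₁, hd₁, hQ, hD]; simp [cubGrad, f8]; ring
      have ggy : cubGrad g (w i) 1 = z ^ 2 + z * q₁' + d₁' := by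
        rw [hwi, hq₁', hd₁', hQ', hD']; simp [cubGrad, g8]; ring
      -- Euler's identity with first coordinate 1 determines the x-derivative in every
      -- characteristic.
      have heuler : ∀ c : Fin 10 → K, cubForm c (w i) = 0 → cubGrad c (w i) 1 = 0 →
          cubGrad c (w i) 2 = 0 → cubGrad c (w i) = 0 := by
        intro c h0 h1 h2
        have : cubGrad c (w i) 0 = 0 := by
          rw [hwi] at h0 h1 h2 ⊢
          simp [cubGrad, cubForm] at h0 h1 h2 ⊢
          linear_combination 3 * h0 - t * h1 - z * h2
        funext m
        fin_cases m <;> assumption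
      have hD0 : D.eval t = -(z ^ 2 + z * Q.eval t) := by linear_combination hfi
      have hD0' : D'.eval t = -(t * z ^ 2 + z * Q'.eval t) := by linear_combination hgi
      have hder' : B.derivative.eval t * B.eval t + B.eval t * B.derivative.eval t -
          (A.derivative.eval t * E.eval t + A.eval t * E.derivative.eval t) = 0 := by
        rw [← hder, hR]; simp
      rw [dA1, dB1, dE1, eB, eE, eA, hD0, hD0'] at hder'
      have ha' := ha
      rw [eA] at ha'
      obtain ⟨τ, hτ⟩ : ∃ τ, τ = d₁' + (z ^ 2 + z * Q.eval t) - t * d₁ +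
        z * (q₁' - Q.eval t - t * q₁) := ⟨_, rfl⟩
      -- The vanishing of the derivative of R means A ∂y = τ ∂z for both f and g, so a combination
      -- that kills ∂z also kills ∂y.
      have key1 : (Q'.eval t - t * Q.eval t) * (z * q₁ + d₁) = τ * (2 * z + Q.eval t) := by
        apply mul_left_cancel₀ ha'
        rw [hτ]
        linear_combination hder'
      have key2 : (Q'.eval t - t * Q.eval t) * (z ^ 2 + z * q₁' + d₁') =
          τ * (2 * t * z + Q'.eval t) := by
        apply mul_left_cancel₀ ha'
        rw [hτ]
        linear_combination t * hder'
      have sing : ∀ α β : K, (α ≠ 0 ∨ β ≠ 0) →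
          α * (2 * z + Q.eval t) + β * (2 * t * z + Q'.eval t) = 0 → False := by
        intro α β hαβ h2
        have h1 : α * (z * q₁ + d₁) + β * (z ^ 2 + z * q₁' + d₁') = 0 := by
          refine (mul_eq_zero.1 (?_ : (Q'.eval t - t * Q.eval t) * _ = 0)).resolve_left ha'
          linear_combination α * key1 + β * key2 + τ * h2
        have hv : ∀ j, cubForm (α • f + β • g) (w j) = 0 := fun j => by
          rw [cubForm_add_smul, hf, hg]
          ring
        refine h.gp.cubic Finset.univ (by simp) (α • f + β • g)
          (AdaptedPencil.ne_zero ⟨hf, hg, f5, f8, f9, g5, g8, g9⟩ hαβ) (fun j _ => hv j) i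
          (Finset.mem_univ _) (heuler _ (hv i) ?_ ?_)
        · rw [cubGrad_add_smul, Pi.add_apply, Pi.smul_apply, Pi.smul_apply, gfy, ggy]
          exact h1
        · rw [cubGrad_add_smul, Pi.add_apply, Pi.smul_apply, Pi.smul_apply, gfz, ggz]
          exact h2
      by_cases h0 : 2 * z + Q.eval t = 0
      · exact sing 1 0 (by simp) (by rw [h0]; ring)
      · exact sing (2 * t * z + Q'.eval t) (-(2 * z + Q.eval t)) (Or.inr (neg_ne_zero.2 h0)) (by ring)
    · push Not at hmem
      obtain ⟨p1, p2⟩ := hpt t hRt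
      refine ⟨_, fun h => one_ne_zero (congrFun h 0), p1, p2, ?_⟩
      intro i s hs
      have h0 := congrFun hs 0
      have h1 := congrFun hs 1
      rcases eq_or_ne i 0 with rfl | hi
      · simp [h.zero] at h0
      · simp [h.one i hi] at h0 h1
        rw [← h0, one_mul] at h1
        exact hmem i hi h1.symm

end Pencil

/-! ### A member of the pencil with many points. -/

section DoubleCount

variable {K : Type*} [Field K]

theorem VecGP.ne_smul {w : Fin 8 → Fin 3 → K} (h : VecGP w) {i j : Fin 8} (hij : i ≠ j) (s : K) :
    w i ≠ s • w j := by
  intro hs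
  obtain ⟨k, hki, hkj⟩ : ∃ k : Fin 8, k ≠ i ∧ k ≠ j := by
    have : ∀ i j : Fin 8, ∃ k : Fin 8, k ≠ i ∧ k ≠ j := by decide
    exact this i j
  refine h.bracket_ne_zero hij hki.symm hkj.symm ?_
  rw [hs]
  simp [bracket]
  ring

/-- The members through a point fill at least a line of the parameter plane. -/
theorem card_le_members [Fintype K] [DecidableEq K] (x y : K) :
    Fintype.card K - 1 ≤ (Finset.univ.filter fun s : K × K =>
      s ≠ 0 ∧ s.1 * x + s.2 * y = 0).card := by
  rw [← Finset.card_univ, ← Finset.card_erase_of_mem (Finset.mem_univ (0 : K))]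
  by_cases hxy : x = 0 ∧ y = 0
  · refine Finset.card_le_card_of_injOn (fun t => (t, 0)) ?_ ?_
    · intro t ht
      have : t ≠ 0 := by simpa using ht
      simp [this, hxy.1, hxy.2]
    · intro s _ t _ hst
      exact (Prod.ext_iff.1 hst).1
  · refine Finset.card_le_card_of_injOn (fun t => (t * y, -(t * x))) ?_ ?_
    · intro t ht
      have : t ≠ 0 := by simpa using ht
      simp only [Finset.coe_filter, Finset.mem_univ, true_and, Set.mem_ofPred_eq]
      refine ⟨fun h => hxy ?_, by ring⟩
      have h1 := (Prod.ext_iff.1 h).1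
      have h2 := (Prod.ext_iff.1 h).2
      simp [this] at h1 h2
      exact ⟨h2, h1⟩
    · intro s _ t _ hst
      have h1 := (Prod.ext_iff.1 hst).1
      have h2 := (Prod.ext_iff.1 hst).2
      simp only [neg_inj] at h1 h2
      by_cases hx : x = 0
      · exact mul_right_cancel₀ (fun hy => hxy ⟨hx, hy⟩) h1
      · exact mul_right_cancel₀ hx h2

theorem nine_mul_le_card_base [Fintype K] [DecidableEq K] {w : Fin 8 → Fin 3 → K}
    (h : AdaptedPts w) {f g : Fin 10 → K} (hfg : AdaptedPencil w f g) :
    9 * (Fintype.card K - 1) ≤ (Finset.univ.filter fun v : Fin 3 → K =>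
      v ≠ 0 ∧ cubForm f v = 0 ∧ cubForm g v = 0).card := by
  obtain ⟨p, hp0, hfp, hgp, hp⟩ := h.exists_ninth hfg
  obtain ⟨P, hP⟩ : ∃ P : Option (Fin 8) → Fin 3 → K, P = fun o => o.elim p w := ⟨_, rfl⟩
  have hP0 : ∀ o, P o ≠ 0 ∧ cubForm f (P o) = 0 ∧ cubForm g (P o) = 0 := by
    intro o
    rw [hP]
    cases o with
    | none => exact ⟨hp0, hfp, hgp⟩
    | some i => exact ⟨h.gp.ne_zero i, hfg.f_zero i, hfg.g_zero i⟩
  have hPs : ∀ o o' (s : K), o ≠ o' → P o ≠ s • P o' := by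
    intro o o' s hne
    rw [hP]
    match o, o', hne with
    | none, some i, _ => exact hp i s
    | some i, some j, hne => exact h.gp.ne_smul (fun h => hne (by rw [h])) s
    | some i, none, _ =>
      intro hs
      have hs : w i = s • p := hs
      have hs0 : s ≠ 0 := by
        rintro rfl
        exact h.gp.ne_zero i (by rw [hs, zero_smul])
      exact hp i s⁻¹ (by rw [hs, smul_smul, inv_mul_cancel₀ hs0, one_smul])
    | none, none, hne => exact absurd rfl hne
  have hcube : ∀ (c : Fin 10 → K) (s : K) (v), cubForm c (s • v) = s ^ 3 * cubForm c v := by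
    intro c s v
    simp [cubForm]
    ring
  have hcard : 9 * (Fintype.card K - 1) =
      ((Finset.univ : Finset (Option (Fin 8))) ×ˢ Finset.univ.erase (0 : K)).card := by
    rw [Finset.card_product, Finset.card_erase_of_mem (Finset.mem_univ _)]
    simp
  rw [hcard]
  refine Finset.card_le_card_of_injOn (fun x => x.2 • P x.1) ?_ ?_
  · rintro ⟨o, s⟩ hs
    have hs0 : s ≠ 0 := by simpa using hs
    simp only [Finset.coe_filter, Finset.mem_univ, true_and, Set.mem_ofPred_eq]
    obtain ⟨h1, h2, h3⟩ := hP0 o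
    exact ⟨smul_ne_zero hs0 h1, by rw [hcube, h2, mul_zero], by rw [hcube, h3, mul_zero]⟩
  · rintro ⟨o, s⟩ hs ⟨o', t⟩ ht hst
    have hs0 : s ≠ 0 := by simpa using hs
    have hst : s • P o = t • P o' := hst
    by_cases ho : o = o'
    · subst ho
      rw [smul_left_injective K (hP0 o).1 hst]
    · exact absurd (by rw [mul_smul, ← hst, smul_smul, inv_mul_cancel₀ hs0, one_smul])
        (hPs o o' (s⁻¹ * t) ho)

/-- With q = |K|, each of the q² + q + 1 points lies on at least one of the q + 1 members, and nine
base points lie on all of them. That makes at least q² + 10q + 1 incidences, too many if every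
member had at most m points. The count is made with nonzero vectors, which multiplies both sides by
(q − 1)². -/
theorem AdaptedPts.exists_member [Finite K] {w : Fin 8 → Fin 3 → K} (h : AdaptedPts w)
    {f g : Fin 10 → K} (hfg : AdaptedPencil w f g) {m : ℕ}
    (hm : (Nat.card K + 1) * m < Nat.card K ^ 2 + 10 * Nat.card K + 1) :
    ∃ α β : K, (α ≠ 0 ∨ β ≠ 0) ∧
      (Nat.card K - 1) * m < Nat.card {v // v ≠ 0 ∧ cubForm (α • f + β • g) v = 0} := by
  classical
  have := Fintype.ofFinite K
  by_contra! hc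
  have h1 : ∀ s : K × K, s ≠ 0 → (Finset.univ.filter fun v : Fin 3 → K =>
      v ≠ 0 ∧ s.1 * cubForm f v + s.2 * cubForm g v = 0).card ≤ (Fintype.card K - 1) * m := by
    intro s hs
    have := hc s.1 s.2 (by
      by_contra! h0
      exact hs (Prod.ext h0.1 h0.2))
    simp only [cubForm_add_smul] at this
    rwa [Nat.card_eq_fintype_card, Fintype.card_subtype, Nat.card_eq_fintype_card] at this
  have h2 := Finset.sum_card_bipartiteAbove_eq_sum_card_bipartiteBelow
    (s := Finset.univ.filter fun s : K × K => s ≠ 0)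
    (t := Finset.univ.filter fun v : Fin 3 → K => v ≠ 0)
    (fun s v => s.1 * cubForm f v + s.2 * cubForm g v = 0)
  simp only [Finset.bipartiteAbove, Finset.bipartiteBelow, Finset.filter_filter] at h2
  -- From here on q is |K| − 1, which avoids truncated subtraction.
  obtain ⟨q, hq⟩ : ∃ q, q + 1 = Fintype.card K := ⟨Fintype.card K - 1, by
    have := Fintype.card_pos (α := K); omega⟩
  have hS : (Finset.univ.filter fun s : K × K => s ≠ 0).card = (q + 1) ^ 2 - 1 := by
    rw [Finset.filter_ne', Finset.card_erase_of_mem (Finset.mem_univ _), Finset.card_univ,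
      Fintype.card_prod, ← hq, sq]
  have hV : (Finset.univ.filter fun v : Fin 3 → K => v ≠ 0).card = (q + 1) ^ 3 - 1 := by
    rw [Finset.filter_ne', Finset.card_erase_of_mem (Finset.mem_univ _), Finset.card_univ,
      Fintype.card_fun, ← hq, Fintype.card_fin]
  have hupper := Finset.sum_le_sum (s := Finset.univ.filter fun s : K × K => s ≠ 0)
    fun s hs => h1 s (Finset.mem_filter.1 hs).2
  rw [h2, Finset.sum_const, hS, smul_eq_mul, ← hq, Nat.add_sub_cancel] at hupper
  have hlow : ∀ v : Fin 3 → K, q + (if cubForm f v = 0 ∧ cubForm g v = 0 then q * (q + 1) else 0) ≤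
      (Finset.univ.filter fun s : K × K =>
        s ≠ 0 ∧ s.1 * cubForm f v + s.2 * cubForm g v = 0).card := by
    intro v
    split_ifs with hv
    · rw [hv.1, hv.2]
      simp only [mul_zero, add_zero, and_true, hS]
      have : (q + 1) ^ 2 = q + q * (q + 1) + 1 := by ring
      omega
    · have := card_le_members (cubForm f v) (cubForm g v)
      rwa [← hq] at this
  have hlower := Finset.sum_le_sum (s := Finset.univ.filter fun v : Fin 3 → K => v ≠ 0)
    fun v _ => hlow v
  rw [Finset.sum_add_distrib, Finset.sum_const, hV, smul_eq_mul, ← Finset.sum_filter,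
    Finset.sum_const, smul_eq_mul, Finset.filter_filter] at hlower
  have hb := nine_mul_le_card_base h hfg
  rw [← hq, Nat.add_sub_cancel] at hb
  have htot := (Nat.add_le_add_left (Nat.mul_le_mul_right (q * (q + 1)) hb) _).trans
    (hlower.trans hupper)
  rw [Nat.card_eq_fintype_card, ← hq] at hm
  have e1 : (q + 1) ^ 3 - 1 = q * (q ^ 2 + 3 * q + 3) := by
    rw [Nat.sub_eq_iff_eq_add (Nat.one_le_pow _ _ (by omega))]
    ring
  have e2 : (q + 1) ^ 2 - 1 = q * (q + 2) := by
    rw [Nat.sub_eq_iff_eq_add (Nat.one_le_pow _ _ (by omega))]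
    ring
  rw [e1, e2] at htot
  have hq0 : 0 < q := by
    have := Fintype.one_lt_card (α := K)
    omega
  have : q * q * ((q + 1) ^ 2 + 10 * (q + 1) + 1) ≤ q * q * ((q + 1 + 1) * m) := by
    nlinarith
  have := Nat.le_of_mul_le_mul_left this (Nat.mul_pos hq0 hq0)
  omega

end DoubleCount

/-! ### Normal forms of plane cubics in odd characteristic. -/

section NormalForm

variable {K : Type*} [Field K]

/-- The curve `F = 0` contains eight points in general position, and `F` has more than `n` nontrivial
zeros. -/
structure Carries (F : (Fin 3 → K) → K) (n : ℕ) : Prop where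
  pts : ∃ v : Fin 8 → Fin 3 → K, VecGP v ∧ ∀ i, F (v i) = 0
  card : n < Nat.card {v // v ≠ 0 ∧ F v = 0}

theorem Carries.transform {F G : (Fin 3 → K) → K} {n : ℕ} (h : Carries F n)
    {M N : Matrix (Fin 3) (Fin 3) K} (hMN : M * N = 1) {u : K} (hu : u ≠ 0)
    (hG : ∀ v, G v = u * F (M.mulVec v)) : Carries G n := by
  have hNM : N * M = 1 := mul_eq_one_comm.1 hMN
  constructor
  · obtain ⟨v, hv, hF⟩ := h.pts
    refine ⟨_, hv.mulVec hNM, fun i => ?_⟩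
    rw [hG, Matrix.mulVec_mulVec, hMN, Matrix.one_mulVec, hF, mul_zero]
  · refine h.card.trans_eq (Nat.card_congr ?_)
    exact
    { toFun v := ⟨N.mulVec v, fun h0 => v.2.1 (by
          rw [← Matrix.one_mulVec v.1, ← hMN, ← Matrix.mulVec_mulVec, h0, Matrix.mulVec_zero]), by
          rw [hG, Matrix.mulVec_mulVec, hMN, Matrix.one_mulVec, v.2.2, mul_zero]⟩
      invFun v := ⟨M.mulVec v, fun h0 => v.2.1 (by
          rw [← Matrix.one_mulVec v.1, ← hNM, ← Matrix.mulVec_mulVec, h0, Matrix.mulVec_zero]), by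
          have := v.2.2
          rw [hG] at this
          exact (mul_eq_zero.1 this).resolve_left hu⟩
      left_inv v := Subtype.ext (by simp [hMN])
      right_inv v := Subtype.ext (by simp [hNM]) }

theorem Carries.not_line {F : (Fin 3 → K) → K} {n : ℕ} (h : Carries F n)
    {a : Fin 3 → K} {d : Fin 6 → K} (ha : a ≠ 0) (hd : d ≠ 0) :
    ¬ ∀ x, F x = linForm a x * quadForm d x := by
  intro hF
  obtain ⟨v, hv, hz⟩ := h.pts
  exact hv.not_line_conic ha hd hF hz

theorem card_zeros_le [Finite K] {ι : Type*} [Finite ι] {F : (Fin 3 → K) → K} (p : ι → Fin 3 → K)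
    (h : ∀ v, v ≠ 0 → F v = 0 → ∃ i, ∃ u : K, u ≠ 0 ∧ v = u • p i) :
    Nat.card {v // v ≠ 0 ∧ F v = 0} ≤ (Nat.card K - 1) * Nat.card ι := by
  have hle : Nat.card {v // v ≠ 0 ∧ F v = 0} ≤ Nat.card (Kˣ × ι) := by
    have : ∀ v : {v // v ≠ 0 ∧ F v = 0}, ∃ x : Kˣ × ι, v.1 = (x.1 : K) • p x.2 := by
      intro v
      obtain ⟨i, u, hu, h⟩ := h v.1 v.2.1 v.2.2
      exact ⟨(Units.mk0 u hu, i), h⟩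
    choose φ hφ using this
    refine Nat.card_le_card_of_injective φ fun x y hxy => Subtype.ext ?_
    rw [hφ, hφ, hxy]
  rwa [Nat.card_prod, Nat.card_units] at hle

/-- A cubic form whose curve has the tangent `v 1 = 0` at `(0 : 0 : 1)`, which is not a flex. -/
def nonflexForm (a b c : K) (v : Fin 3 → K) : K :=
  v 1 * v 2 ^ 2 + v 0 ^ 2 * v 2 + v 1 * (a * v 0 ^ 2 + b * v 0 * v 1 + c * v 1 ^ 2)

/-- The Weierstrass cubic form with `v 1 = 0` as the line at infinity. -/
def weierstrassForm (a b c : K) (v : Fin 3 → K) : K :=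
  v 1 * v 2 ^ 2 - (v 0 ^ 3 + a * v 0 ^ 2 * v 1 + b * v 0 * v 1 ^ 2 + c * v 1 ^ 3)

/-- Where y = 1, the substitution w = 2z + x² completes the square. The line y = 0 contributes only
(0 : 0 : 1) and (1 : 0 : 0). -/
theorem card_nonflexForm_le [Finite K] (h2 : (2 : K) ≠ 0) (a b c : K) :
    Nat.card {v // v ≠ 0 ∧ nonflexForm a b c v = 0} ≤ (Nat.card K - 1) *
      (Nat.card {x : K × K // x.2 ^ 2 = x.1 ^ 4 - 4 * (a * x.1 ^ 2 + b * x.1 + c)} + 2) := by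
  have h := card_zeros_le (K := K) (F := nonflexForm a b c)
    (ι := Option (Option {x : K × K // x.2 ^ 2 = x.1 ^ 4 - 4 * (a * x.1 ^ 2 + b * x.1 + c)}))
    (fun o => o.elim ![0, 0, 1] fun o => o.elim ![1, 0, 0] fun x =>
      ![x.1.1, 1, (x.1.2 - x.1.1 ^ 2) / 2]) ?_
  · rwa [Finite.card_option, Finite.card_option, add_assoc] at h
  intro v hv hF
  rw [nonflexForm] at hF
  by_cases h1 : v 1 = 0
  · rw [h1] at hF
    have : v 0 = 0 ∨ v 2 = 0 := by
      have : v 0 ^ 2 * v 2 = 0 := by linear_combination hF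
      simpa using this
    rcases this with h0 | h0
    · refine ⟨none, v 2, fun h => hv ?_, ?_⟩
      · funext k; fin_cases k <;> assumption
      · funext k; fin_cases k <;> simp [h0, h1]
    · refine ⟨some none, v 0, fun h => hv ?_, ?_⟩
      · funext k; fin_cases k <;> assumption
      · funext k; fin_cases k <;> simp [h0, h1]
  · refine ⟨some (some ⟨(v 0 / v 1, 2 * (v 2 / v 1) + (v 0 / v 1) ^ 2), ?_⟩), v 1, h1, ?_⟩
    · simp only
      field_simp
      linear_combination 4 * v 1 * hF
    · funext k; fin_cases k <;> simp <;> field_simp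

theorem card_weierstrassForm_le [Finite K] (a b c : K) :
    Nat.card {v // v ≠ 0 ∧ weierstrassForm a b c v = 0} ≤ (Nat.card K - 1) *
      (Nat.card {x : K × K // x.2 ^ 2 = x.1 ^ 3 + a * x.1 ^ 2 + b * x.1 + c} + 1) := by
  have h := card_zeros_le (K := K) (F := weierstrassForm a b c)
    (ι := Option {x : K × K // x.2 ^ 2 = x.1 ^ 3 + a * x.1 ^ 2 + b * x.1 + c})
    (fun o => o.elim ![0, 0, 1] fun x => ![x.1.1, 1, x.1.2]) ?_
  · rwa [Finite.card_option] at h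
  intro v hv hF
  rw [weierstrassForm] at hF
  by_cases h1 : v 1 = 0
  · rw [h1] at hF
    have h0 : v 0 = 0 := by
      have : v 0 ^ 3 = 0 := by linear_combination -hF
      simpa using this
    refine ⟨none, v 2, fun h => hv ?_, ?_⟩
    · funext k; fin_cases k <;> assumption
    · funext k; fin_cases k <;> simp [h0, h1]
  · refine ⟨some ⟨(v 0 / v 1, v 2 / v 1), ?_⟩, v 1, h1, ?_⟩
    · simp only
      field_simp
      linear_combination hF
    · funext k; fin_cases k <;> simp <;> field_simp

/-- The line y = 0 meets the curve three times at (0 : 0 : 1), a smooth point because e₀ ≠ 0, so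
this is a flex. Completing the square in z and rescaling y and the form suffice; characteristic 3 is
allowed. -/
theorem Carries.exists_weierstrass (h2 : (2 : K) ≠ 0) {n : ℕ} {s e₀ e₁ e₂ e₃ e₄ e₅ : K}
    (hs : s ≠ 0) (he : e₀ ≠ 0)
    (h : Carries (fun v => s * v 0 ^ 3 + v 1 * (e₀ * v 2 ^ 2 + e₁ * v 0 * v 2 + e₂ * v 1 * v 2 +
      e₃ * v 0 ^ 2 + e₄ * v 0 * v 1 + e₅ * v 1 ^ 2)) n) :
    ∃ a b c : K, Carries (weierstrassForm a b c) n := by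
  obtain ⟨k, rfl⟩ : ∃ k, e₁ = 2 * e₀ * k := ⟨e₁ / (2 * e₀), by field_simp⟩
  obtain ⟨l, rfl⟩ : ∃ l, e₂ = 2 * e₀ * l := ⟨e₂ / (2 * e₀), by field_simp⟩
  have hMN : (!![1, 0, 0; 0, -s / e₀, 0; -k, l * s / e₀, 1] : Matrix (Fin 3) (Fin 3) K) *
      !![1, 0, 0; 0, -e₀ / s, 0; k, l, 1] = 1 := by
    ext i j
    fin_cases i <;> fin_cases j <;> simp [Matrix.mul_apply, Fin.sum_univ_three] <;> field_simp <;>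
      ring
  refine ⟨-(e₃ - e₀ * k ^ 2) / e₀, (e₄ - 2 * e₀ * k * l) * s / e₀ ^ 2,
    -(e₅ - e₀ * l ^ 2) * s ^ 2 / e₀ ^ 3,
    h.transform hMN (u := -s⁻¹) (neg_ne_zero.2 (inv_ne_zero hs)) fun v => ?_⟩
  simp [weierstrassForm, Matrix.mulVec, dotProduct, Fin.sum_univ_three]
  field_simp
  ring

/-- A cubic curve through `(0 : 0 : 1)` that is smooth there has one of two normal forms. -/
theorem Carries.exists_normalForm (h2 : (2 : K) ≠ 0) {n : ℕ} {c : Fin 10 → K} (h9 : c 9 = 0)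
    (h58 : c 5 ≠ 0 ∨ c 8 ≠ 0) (h : Carries (cubForm c) n) :
    (∃ a b d : K, Carries (weierstrassForm a b d) n) ∨
      ∃ a b d : K, Carries (nonflexForm a b d) n := by
  obtain ⟨q₀, q₁, q₂, c₀, c₁, c₂, c₃, h⟩ : ∃ q₀ q₁ q₂ c₀ c₁ c₂ c₃ : K, Carries (fun v =>
      v 1 * v 2 ^ 2 + v 2 * (q₀ * v 0 ^ 2 + q₁ * v 0 * v 1 + q₂ * v 1 ^ 2) + c₀ * v 0 ^ 3 +
        c₁ * v 0 ^ 2 * v 1 + c₂ * v 0 * v 1 ^ 2 + c₃ * v 1 ^ 3) n := by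
    by_cases h8 : c 8 = 0
    · have h5 : c 5 ≠ 0 := by tauto
      refine ⟨c 7 / c 5, c 4 / c 5, c 2 / c 5, c 6 / c 5, c 3 / c 5, c 1 / c 5, c 0 / c 5,
        h.transform (M := !![0, 1, 0; 1, 0, 0; 0, 0, 1]) (N := !![0, 1, 0; 1, 0, 0; 0, 0, 1]) ?_
          (inv_ne_zero h5) fun v => ?_⟩
      · ext i j
        fin_cases i <;> fin_cases j <;> simp [Matrix.mul_apply, Fin.sum_univ_three]
      · simp [cubForm, Matrix.mulVec, dotProduct, Fin.sum_univ_three, h8, h9]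
        field_simp
        ring
    · -- the tangent `c 5 * x + c 8 * y` becomes `c 8 * y`
      obtain ⟨t, ht⟩ : ∃ t, c 5 = t * c 8 := ⟨c 5 / c 8, by field_simp⟩
      refine ⟨(c 2 - t * c 4 + t ^ 2 * c 7) / c 8, (c 4 - 2 * t * c 7) / c 8, c 7 / c 8,
        (c 0 - t * c 1 + t ^ 2 * c 3 - t ^ 3 * c 6) / c 8,
        (c 1 - 2 * t * c 3 + 3 * t ^ 2 * c 6) / c 8, (c 3 - 3 * t * c 6) / c 8, c 6 / c 8,
        h.transform (M := !![1, 0, 0; -t, 1, 0; 0, 0, 1]) (N := !![1, 0, 0; t, 1, 0; 0, 0, 1]) ?_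
          (inv_ne_zero h8) fun v => ?_⟩
      · ext i j
        fin_cases i <;> fin_cases j <;> simp [Matrix.mul_apply, Fin.sum_univ_three]
      · simp [cubForm, Matrix.mulVec, dotProduct, Fin.sum_univ_three, h9, ht]
        field_simp
        ring
  -- On the tangent y = 0 the form restricts to q₀x²z + c₀x³. So q₀ = 0 means a flex, or a line
  -- component if c₀ = 0 as well.
  by_cases hq : q₀ = 0
  · left
    subst hq
    by_cases hc : c₀ = 0
    · exfalso
      refine h.not_line (a := ![0, 1, 0]) (d := ![c₁, c₂, q₁, c₃, q₂, 1]) ?_ ?_ fun v => ?_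
      · exact fun h => one_ne_zero (congrFun h 1)
      · exact fun h => one_ne_zero (congrFun h 5)
      · simp [linForm, quadForm, hc]
        ring
    · refine Carries.exists_weierstrass h2 (e₀ := 1) (e₁ := q₁) (e₂ := q₂) (e₃ := c₁) (e₄ := c₂)
        (e₅ := c₃) hc one_ne_zero (h.transform (mul_one 1) one_ne_zero fun v => ?_)
      simp
      ring
  · right
    obtain ⟨k, rfl⟩ : ∃ k, q₁ = 2 * k := ⟨q₁ / 2, by field_simp⟩
    obtain ⟨l, rfl⟩ : ∃ l, q₂ = 2 * l := ⟨q₂ / 2, by field_simp⟩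
    -- first `z` becomes `z - k x - l y`
    obtain ⟨d₀, d₁, d₂, d₃, h⟩ : ∃ d₀ d₁ d₂ d₃ : K, Carries (fun v => v 1 * v 2 ^ 2 +
        v 0 ^ 2 * v 2 + d₀ * v 0 ^ 3 + d₁ * v 0 ^ 2 * v 1 + d₂ * v 0 * v 1 ^ 2 + d₃ * v 1 ^ 3) n := by
      refine ⟨(c₀ - q₀ * k) / q₀ ^ 2, (c₁ - k ^ 2 - q₀ * l) / q₀ ^ 2, (c₂ - 2 * k * l) / q₀ ^ 2,
        (c₃ - l ^ 2) / q₀ ^ 2,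
        h.transform (M := !![1, 0, 0; 0, 1, 0; -k, -l, q₀])
          (N := !![1, 0, 0; 0, 1, 0; k / q₀, l / q₀, q₀⁻¹]) ?_
          (inv_ne_zero (pow_ne_zero 2 hq)) fun v => ?_⟩
      · ext i j
        fin_cases i <;> fin_cases j <;> simp [Matrix.mul_apply, Fin.sum_univ_three] <;>
          field_simp <;> ring
      · simp [Matrix.mulVec, dotProduct, Fin.sum_univ_three]
        field_simp
        ring
    -- then `x` becomes `x + d₀ y` and `z` becomes `z - d₀ x - d₀ ^ 2 / 2 y`
    refine ⟨d₁ + d₀ ^ 2 * (3 / 2), d₂ + 2 * d₀ * d₁ + d₀ ^ 3 * 2,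
      d₃ + d₀ * d₂ + d₀ ^ 2 * d₁ + d₀ ^ 4 * (3 / 2 ^ 2),
      h.transform (M := !![1, d₀, 0; 0, 1, 0; -d₀, -d₀ ^ 2 / 2, 1])
        (N := !![1, -d₀, 0; 0, 1, 0; d₀, -d₀ ^ 2 / 2, 1]) ?_ one_ne_zero fun v => ?_⟩
    · ext i j
      fin_cases i <;> fin_cases j <;> simp [Matrix.mul_apply, Fin.sum_univ_three] <;>
          field_simp <;> ring
    · simp [nonflexForm, Matrix.mulVec, dotProduct, Fin.sum_univ_three]
      field_simp
      ring

/-- For b = 0 the point (1 : 0 : 0) is a flex with tangent z + ay = 0, unless a² + c = 0, when that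
line is a component. In the latter case the associated quartic is the square (x² − 2a)², which has
too many points for a uniform bound; this is why b = 0 is treated apart. -/
theorem Carries.weierstrass_of_nonflex (h2 : (2 : K) ≠ 0) {n : ℕ} {a c : K}
    (h : Carries (nonflexForm a 0 c) n) : ∃ a b c : K, Carries (weierstrassForm a b c) n := by
  by_cases hs : a ^ 2 + c = 0
  · exfalso
    obtain rfl : c = -a ^ 2 := by linear_combination hs
    refine h.not_line (a := ![0, a, 1]) (d := ![1, 0, 0, -a, 1, 0]) ?_ ?_ fun v => ?_
    · exact fun h => one_ne_zero (congrFun h 2)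
    · exact fun h => one_ne_zero (congrFun h 0)
    · simp [nonflexForm, linForm, quadForm]
      ring
  · refine Carries.exists_weierstrass h2 (e₀ := 1) (e₁ := 0) (e₂ := 0) (e₃ := -2 * a) (e₄ := 1)
      (e₅ := 0) hs one_ne_zero (h.transform (M := !![0, 0, 1; 1, 0, 0; -a, 1, 0])
        (N := !![0, 1, 0; 0, a, 1; 1, 0, 0]) ?_ one_ne_zero fun v => ?_)
    · ext i j
      fin_cases i <;> fin_cases j <;> simp [Matrix.mul_apply, Fin.sum_univ_three]
    · simp [nonflexForm, Matrix.mulVec, dotProduct, Fin.sum_univ_three]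
      ring

/-- The three equations say that the line through (x : 1 : z) in the direction (1, 0, s) meets the
curve there to order at least three. The cubic coefficient along it is s, so s ≠ 0 keeps it from
being a component, and 2z + x² ≠ 0 is smoothness at the point. -/
theorem Carries.weierstrass_of_flex (h2 : (2 : K) ≠ 0) {n : ℕ} {a b c x z s : K}
    (h : Carries (nonflexForm a b c) n) (hs : s ≠ 0) (he : 2 * z + x ^ 2 ≠ 0)
    (h0 : z ^ 2 + x ^ 2 * z + a * x ^ 2 + b * x + c = 0)
    (h1 : 2 * z * s + x ^ 2 * s + 2 * x * z + 2 * a * x + b = 0)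
    (h3 : s ^ 2 + 2 * x * s + z + a = 0) : ∃ a b c : K, Carries (weierstrassForm a b c) n := by
  refine Carries.exists_weierstrass h2 (e₀ := 2 * z + x ^ 2) (e₁ := 2 * s + 2 * x) (e₂ := 1)
    (e₃ := 1) (e₄ := 0) (e₅ := 0) hs he (h.transform (M := !![1, 0, x; 0, 0, 1; s, 1, z])
      (N := !![1, -x, 0; -s, s * x - z, 1; 0, 1, 0]) ?_ one_ne_zero fun v => ?_)
  · ext i j
    fin_cases i <;> fin_cases j <;> simp [Matrix.mul_apply, Fin.sum_univ_three]
    ring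
  · simp [nonflexForm, Matrix.mulVec, dotProduct, Fin.sum_univ_three]
    linear_combination -v 2 ^ 3 * h0 - v 0 * v 2 ^ 2 * h1 - v 0 ^ 2 * v 2 * h3

end NormalForm

/-! ### Point counts for all normal forms over the small fields. -/

section Count

/-- Evaluate `l.map f` entry by entry. -/
def forceMap {α : Type*} (f : ℕ → ℕ) (l : List ℕ) : (List ℕ → α) → α :=
  List.rec (fun k => k []) (fun a _ ih k => force (f a) fun b => ih fun r => k (b :: r)) l

theorem forceMap_eq {α : Type*} (f : ℕ → ℕ) (l : List ℕ) (k : List ℕ → α) :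
    forceMap f l k = k (l.map f) := by
  induction l generalizing k with
  | nil => rfl
  | cons a l ih =>
    change force (f a) (fun b => forceMap f l fun r => k (b :: r)) = _
    rw [force_eq, ih, List.map_cons]

/-- The numbers of square roots, as the digits of a number in base four. -/
def sqTable (O : CodeOps) (q : ℕ) : ℕ :=
  ((List.range q).map fun w => 4 ^ O.mul w w).sum

/-- The entry of a table for a given code. -/
def digit (T d : ℕ) : ℕ := (T >>> (2 * d)) % 4

/-- The table has the right entries. -/
def tableCheck (O : CodeOps) (q T : ℕ) : Bool :=
  (List.range q).all fun d => ((List.range q).filter fun w => O.mul w w == d).length ≤ digit T d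

/-- The sum of the entries of a table for the translates of a list of codes. -/
def tally (O : CodeOps) (T C : ℕ) (l : List ℕ) : ℕ :=
  l.foldr (fun e n => digit T (O.add e C) + n) 0

/-- A test, for all curves `w ^ 2 = g A B x + C`, of the coefficients and the number of points. -/
def countCheck (O : CodeOps) (q : ℕ) (g : ℕ → ℕ → ℕ → ℕ) (test : ℕ → ℕ → ℕ → ℕ → Bool) : Bool :=
  force (sqTable O q) fun T => tableCheck O q T &&
    (List.range q).all fun A => (List.range q).all fun B =>
      forceMap (g A B) (List.range q) fun l => (List.range q).all fun C =>
        test A B C (tally O T C l)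

/-- `x ^ 4 + A x ^ 2 + B x`. -/
def quarticCode (O : CodeOps) (A B x : ℕ) : ℕ :=
  fmul O x (force (fmul O x (force (fmul O x x) fun y => O.add y A)) fun y => O.add y B)

/-- `x ^ 3 + A x ^ 2 + B x`. -/
def cubicCode (O : CodeOps) (A B x : ℕ) : ℕ :=
  fmul O x (force (fmul O x (O.add x A)) fun y => O.add y B)

/-- At most `m` points, or an even polynomial. -/
def quarticTest (m _A B _C n : ℕ) : Bool := B == 0 || n.ble m

/-- At most `m` points. -/
def cubicTest (m _A _B _C n : ℕ) : Bool := n.ble m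

/-- The curve `y z ^ 2 + x ^ 2 z + y (a x ^ 2 + b x y + c y ^ 2) = 0` over the field with 17 elements,
where `A, B, C` are `-4 a, -4 b, -4 c`, has a rational flex. -/
def flexTest (A B C : ℕ) : Bool :=
  (List.range 17).any fun x => (List.range 17).any fun z =>
    (z * z + x * x * z + 4 * (A * x * x + B * x + C)) % 17 == 0 && !((2 * z + x * x) % 17 == 0) &&
      (List.range 17).any fun s => !(s == 0) && (s * s + 2 * x * s + z + 4 * A) % 17 == 0 &&
        (2 * z * s + x * x * s + 2 * x * z + 4 * (2 * A * x + B)) % 17 == 0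

/-- For q = 9, 11, 13 the double count yields a member with at least 18, 20, 22 points. The affine
bounds 15, 17, 19 here plus two points on y = 0, and 16, 18, 20 in Weierstrass form plus one, leave
at most 17, 19, 21. -/
theorem countCheck_quartic_nine : countCheck nineOps 9 (quarticCode nineOps)
    (quarticTest 15) = true := by decide +kernel

theorem countCheck_quartic_eleven : countCheck (primeOps 11) 11 (quarticCode (primeOps 11))
    (quarticTest 17) = true := by decide +kernel

theorem countCheck_quartic_thirteen : countCheck (primeOps 13) 13 (quarticCode (primeOps 13))
    (quarticTest 19) = true := by decide +kernel

/-- The double count gives 26 points, which is the Hasse–Weil maximum, so counting alone does not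
conclude. The curves above the bound have a rational flex instead, as expected since tripling is
bijective on a group of order 26. -/
theorem countCheck_quartic_seventeen : countCheck (primeOps 17) 17 (quarticCode (primeOps 17))
    (fun A B C n => quarticTest 23 A B C n || flexTest A B C) = true := by
  decide +kernel

theorem countCheck_cubic_nine : countCheck nineOps 9 (cubicCode nineOps)
    (cubicTest 16) = true := by decide +kernel

theorem countCheck_cubic_eleven : countCheck (primeOps 11) 11 (cubicCode (primeOps 11))
    (cubicTest 18) = true := by decide +kernel

theorem countCheck_cubic_thirteen : countCheck (primeOps 13) 13 (cubicCode (primeOps 13))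
    (cubicTest 20) = true := by decide +kernel

/-- Only A = 0 matters, because the cube can be completed modulo 17. The exceptional values of B are
3 times the nonzero fourth powers. -/
theorem countCheck_cubic_seventeen : countCheck (primeOps 17) 17 (cubicCode (primeOps 17))
    (fun A B C n => !(A == 0) || n.ble 24 || (C == 0 && [3, 5, 12, 14].contains B)) = true := by
  decide +kernel

end Count

/-! ### From the tables to bounds on cubics through eight points. -/

section CountSound

variable {K : Type*} [Field K]

theorem digit_lt (O : CodeOps) {q T : ℕ} (h : tableCheck O q T = true) {d : ℕ} (hd : d < q) :
    ((Finset.range q).filter fun w => O.mul w w = d).card ≤ digit T d := by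
  simp only [tableCheck, List.all_eq_true, List.mem_range, decide_eq_true_eq] at h
  convert h d hd using 1
  rw [← List.toFinset_card_of_nodup (List.nodup_range.filter _)]
  congr 1
  ext w
  simp

theorem card_le_tally {q : ℕ} {O : CodeOps} {val : ℕ → K} (hO : IsCoding q O val) {T : ℕ}
    (hT : tableCheck O q T = true) {g : ℕ → ℕ} (hg : ∀ x < q, g x < q) {G : K → K}
    (hG : ∀ x < q, val (g x) = G (val x)) {C : ℕ} (hC : C < q) :
    Nat.card {x : K × K // x.2 ^ 2 = G x.1 + val C} ≤ tally O T C ((List.range q).map g) := by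
  choose code hlt hcode using hO.surj
  have h1 : tally O T C ((List.range q).map g) =
      ∑ x ∈ Finset.range q, digit T (O.add (g x) C) := by
    have : ∀ l : List ℕ, tally O T C (l.map g) =
        (l.map fun x => digit T (O.add (g x) C)).sum := by
      intro l
      induction l with
      | nil => rfl
      | cons a l ih =>
        simp only [List.map_cons, List.sum_cons, ← ih]
        rfl
    rw [this]
    rfl
  rw [h1]
  refine le_trans ?_ (Finset.sum_le_sum fun x hx =>
    digit_lt O hT (hO.add_lt (hg x (Finset.mem_range.1 hx)) hC))
  rw [← Finset.card_sigma, ← Nat.card_eq_finsetCard]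
  refine Nat.card_le_card_of_injective (fun x => ⟨⟨code x.1.1, code x.1.2⟩, ?_⟩) fun x y hxy => ?_
  · rw [Finset.mem_sigma, Finset.mem_range, Finset.mem_filter, Finset.mem_range]
    refine ⟨hlt _, hlt _, hO.inj (hO.mul_lt (hlt _) (hlt _))
      (hO.add_lt (hg _ (hlt _)) hC) ?_⟩
    rw [hO.val_mul (hlt _) (hlt _), hO.val_add (hg _ (hlt _)) hC, hG _ (hlt _), hcode, hcode, ← x.2,
      sq]
  · simp only [Subtype.mk.injEq, Sigma.mk.injEq, heq_eq_eq] at hxy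
    refine Subtype.ext (Prod.ext ?_ ?_)
    · rw [← hcode x.1.1, hxy.1, hcode]
    · rw [← hcode x.1.2, hxy.2, hcode]

theorem exists_of_countCheck {q : ℕ} {O : CodeOps} {val : ℕ → K} (hO : IsCoding q O val)
    {g : ℕ → ℕ → ℕ → ℕ} {test : ℕ → ℕ → ℕ → ℕ → Bool} (h : countCheck O q g test = true)
    (hg : ∀ A < q, ∀ B < q, ∀ x < q, g A B x < q) {G : K → K → K → K}
    (hG : ∀ A < q, ∀ B < q, ∀ x < q, val (g A B x) = G (val A) (val B) (val x)) (a b c : K) :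
    ∃ A B C n, A < q ∧ B < q ∧ C < q ∧ val A = a ∧ val B = b ∧ val C = c ∧
      Nat.card {x : K × K // x.2 ^ 2 = G a b x.1 + c} ≤ n ∧ test A B C n = true := by
  simp only [countCheck, force_eq, forceMap_eq, Bool.and_eq_true, List.all_eq_true,
    List.mem_range] at h
  obtain ⟨A, hA, rfl⟩ := hO.surj a
  obtain ⟨B, hB, rfl⟩ := hO.surj b
  obtain ⟨C, hC, rfl⟩ := hO.surj c
  exact ⟨A, B, C, _, hA, hB, hC, rfl, rfl, rfl,
    card_le_tally hO h.1 (hg A hA B hB) (hG A hA B hB) hC, h.2 A hA B hB C hC⟩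

theorem quarticCode_spec {q : ℕ} {O : CodeOps} {val : ℕ → K} (hO : IsCoding q O val) {A B x : ℕ}
    (hA : A < q) (hB : B < q) (hx : x < q) : quarticCode O A B x < q ∧
      val (quarticCode O A B x) = val x ^ 4 + val A * val x ^ 2 + val B * val x := by
  have h1 := hO.mul_lt hx hx
  have h2 := hO.add_lt h1 hA
  have h3 := hO.mul_lt hx h2
  have h4 := hO.add_lt h3 hB
  simp only [quarticCode, fmul_eq, force_eq]
  refine ⟨hO.mul_lt hx h4, ?_⟩
  rw [hO.val_mul hx h4, hO.val_add h3 hB, hO.val_mul hx h2, hO.val_add h1 hA, hO.val_mul hx hx]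
  ring

theorem cubicCode_spec {q : ℕ} {O : CodeOps} {val : ℕ → K} (hO : IsCoding q O val) {A B x : ℕ}
    (hA : A < q) (hB : B < q) (hx : x < q) : cubicCode O A B x < q ∧
      val (cubicCode O A B x) = val x ^ 3 + val A * val x ^ 2 + val B * val x := by
  have h2 := hO.add_lt hx hA
  have h3 := hO.mul_lt hx h2
  have h4 := hO.add_lt h3 hB
  simp only [cubicCode, fmul_eq, force_eq]
  refine ⟨hO.mul_lt hx h4, ?_⟩
  rw [hO.val_mul hx h4, hO.val_add h3 hB, hO.val_mul hx h2, hO.val_add hx hA]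
  ring

theorem exists_of_countCheck_quartic [Finite K] {q m : ℕ} {O : CodeOps} {val : ℕ → K}
    (hO : IsCoding q O val) (h2 : (2 : K) ≠ 0) {test : ℕ → ℕ → ℕ → ℕ → Bool}
    (h : countCheck O q (quarticCode O) test = true) {a b c : K}
    (hc : Carries (nonflexForm a b c) ((Nat.card K - 1) * m)) :
    ∃ A B C n, A < q ∧ B < q ∧ C < q ∧ val A = -4 * a ∧ val B = -4 * b ∧ val C = -4 * c ∧
      m < n + 2 ∧ test A B C n = true := by
  obtain ⟨A, B, C, n, hA, hB, hC, ha, hb, hc', hn, ht⟩ := exists_of_countCheck hO h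
    (fun A hA B hB x hx => (quarticCode_spec hO hA hB hx).1)
    (G := fun a b x => x ^ 4 + a * x ^ 2 + b * x)
    (fun A hA B hB x hx => (quarticCode_spec hO hA hB hx).2) (-4 * a) (-4 * b) (-4 * c)
  refine ⟨A, B, C, n, hA, hB, hC, ha, hb, hc', ?_, ht⟩
  have h1 := hc.card.trans_le (card_nonflexForm_le h2 a b c)
  have h3 := Nat.lt_of_mul_lt_mul_left h1
  have h4 : Nat.card {x : K × K // x.2 ^ 2 = x.1 ^ 4 - 4 * (a * x.1 ^ 2 + b * x.1 + c)} ≤ n := by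
    refine le_of_eq_of_le (Nat.card_congr (Equiv.subtypeEquivRight fun x => ?_)) hn
    rw [iff_eq_eq]
    congr 1
    ring
  omega

theorem exists_of_countCheck_cubic [Finite K] {q m : ℕ} {O : CodeOps} {val : ℕ → K}
    (hO : IsCoding q O val) {test : ℕ → ℕ → ℕ → ℕ → Bool}
    (h : countCheck O q (cubicCode O) test = true) {a b c : K}
    (hc : Carries (weierstrassForm a b c) ((Nat.card K - 1) * m)) :
    ∃ A B C n, A < q ∧ B < q ∧ C < q ∧ val A = a ∧ val B = b ∧ val C = c ∧
      m < n + 1 ∧ test A B C n = true := by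
  obtain ⟨A, B, C, n, hA, hB, hC, ha, hb, hc', hn, ht⟩ := exists_of_countCheck hO h
    (fun A hA B hB x hx => (cubicCode_spec hO hA hB hx).1)
    (G := fun a b x => x ^ 3 + a * x ^ 2 + b * x)
    (fun A hA B hB x hx => (cubicCode_spec hO hA hB hx).2) a b c
  refine ⟨A, B, C, n, hA, hB, hC, ha, hb, hc', ?_, ht⟩
  have h1 := hc.card.trans_le (card_weierstrassForm_le a b c)
  have h3 := Nat.lt_of_mul_lt_mul_left h1
  omega

theorem two_ne_zero_of_card [Finite K] (h : Odd (Nat.card K)) : (2 : K) ≠ 0 := by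
  intro h2
  have : CharP K 2 := CharTwo.of_one_ne_zero_of_two_eq_zero one_ne_zero h2
  have := Fintype.ofFinite K
  obtain ⟨n, -, hn⟩ := FiniteField.card K 2
  rw [Nat.card_eq_fintype_card, hn] at h
  exact Nat.not_odd_iff_even.2 ((even_two).pow_of_ne_zero n.ne_zero) h

theorem VecGP.exists_carries [Finite K] (h2 : (2 : K) ≠ 0) (hK : 7 < Nat.card K) {m : ℕ}
    (hm : (Nat.card K + 1) * m < Nat.card K ^ 2 + 10 * Nat.card K + 1) {v : Fin 8 → Fin 3 → K}
    (h : VecGP v) :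
    (∃ a b d : K, Carries (weierstrassForm a b d) ((Nat.card K - 1) * m)) ∨
      ∃ a b d : K, Carries (nonflexForm a b d) ((Nat.card K - 1) * m) := by
  obtain ⟨w, hw⟩ := h.exists_adapted hK
  obtain ⟨f, g, hfg⟩ := hw.exists_pencil
  obtain ⟨α, β, hαβ, hc⟩ := hw.exists_member hfg hm
  refine Carries.exists_normalForm h2 (c := α • f + β • g) ?_ ?_ ⟨⟨w, hw.gp, fun i => ?_⟩, hc⟩
  · simp [hfg.f9, hfg.g9]
  -- The tangent of the member at (0 : 0 : 1) is αx + βy, so the member is smooth there.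
  · simpa [hfg.f5, hfg.g5, hfg.f8, hfg.g8] using hαβ
  · rw [cubForm_add_smul, hfg.f_zero, hfg.g_zero]
    ring

/-- Averaging gives a cubic with more than m + 2 points, while both tables allow at most m + 2; the
even quartics, exempt from their table, are moved to Weierstrass form first. -/
theorem not_vecGP_of_countCheck [Finite K] {q m : ℕ} {O : CodeOps} {val : ℕ → K}
    (hO : IsCoding q O val) (hq : Nat.card K = q) (hodd : Odd q) (hq7 : 7 < q)
    (hm : (q + 1) * (m + 2) < q ^ 2 + 10 * q + 1)
    (h4 : countCheck O q (quarticCode O) (quarticTest m) = true)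
    (h3 : countCheck O q (cubicCode O) (cubicTest (m + 1)) = true) (v : Fin 8 → Fin 3 → K) :
    ¬ VecGP v := by
  intro h
  subst hq
  have h2 := two_ne_zero_of_card hodd
  have hw : ∀ a b c : K, ¬ Carries (weierstrassForm a b c) ((Nat.card K - 1) * (m + 2)) := by
    intro a b c hc
    obtain ⟨A, B, C, n, -, -, -, -, -, -, hn, ht⟩ := exists_of_countCheck_cubic hO h3 hc
    simp only [cubicTest, Nat.ble_eq] at ht
    omega
  obtain ⟨a, b, c, hc⟩ | ⟨a, b, c, hc⟩ := h.exists_carries h2 hq7 hm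
  · exact hw a b c hc
  · obtain ⟨A, B, C, n, -, -, -, -, hb, -, hn, ht⟩ := exists_of_countCheck_quartic hO h2 h4 hc
    simp only [quarticTest, Bool.or_eq_true, beq_iff_eq, Nat.ble_eq] at ht
    rcases ht with rfl | ht
    · rw [hO.val_zero] at hb
      have h40 : (2 * 2 : K) ≠ 0 := mul_ne_zero h2 h2
      obtain rfl : b = 0 := (mul_eq_zero.1 (by linear_combination hb : 2 * 2 * b = 0)).resolve_left h40
      obtain ⟨a, b, c, hc⟩ := hc.weierstrass_of_nonflex h2
      exact hw a b c hc
    · omega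

end CountSound

/-! ### The curve with 26 points over the field with 17 elements: group labels and the search. -/

section Labels

/-- The points of the curve `y z ^ 2 = x ^ 3 + 3 x y ^ 2` over the field with 17 elements: the
multiples of a generator of its group. -/
def curvePts : List (ℕ × ℕ × ℕ) := 
  [(0, 0, 1), (3, 1, 6), (13, 1, 3), (5, 1, 15), (8, 1, 14), (14, 1, 7), (9, 1, 12), (6, 1, 8),
  (16, 1, 8), (11, 1, 15), (4, 1, 12), (12, 1, 8), (1, 1, 2), (0, 1, 0), (1, 1, 15), (12, 1, 9),
  (4, 1, 5), (11, 1, 2), (16, 1, 9), (6, 1, 9), (9, 1, 5), (14, 1, 10), (8, 1, 3), (5, 1, 2),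
  (13, 1, 14), (3, 1, 11)]

/-- The point with a given label. -/
def curvePt (a : ℕ) : ℕ × ℕ × ℕ := curvePts.getD a (0, 0, 1)

/-- The six points are on a conic. -/
def conicRel (a b c d e f : ℕ × ℕ × ℕ) : Bool :=
  let O := primeOps 17
  fmul O (fmul O (brCode O a b f) (brCode O c d f)) (fmul O (brCode O a c e) (brCode O b d e)) ==
    fmul O (fmul O (brCode O a c f) (brCode O b d f)) (fmul O (brCode O a b e) (brCode O c d e))

/-- Three points whose labels have sum zero are collinear. -/
def lineCheck : Bool :=
  (List.range 26).all fun a => (List.range 26).all fun b => (List.range 26).all fun c =>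
    !((a + b + c) % 26 == 0) || brCode (primeOps 17) (curvePt a) (curvePt b) (curvePt c) == 0

/-- Six points whose labels have sum zero are on a conic. -/
def conicCheck : Bool :=
  (List.range 26).all fun a => (List.range a).all fun b => (List.range b).all fun c =>
    (List.range c).all fun d => (List.range d).all fun e => 
      force ((156 - (a + b + c + d + e)) % 26) fun f => e.ble f ||
        conicRel (curvePt a) (curvePt b) (curvePt c) (curvePt d) (curvePt e) (curvePt f)

/-- The chord law with the flex (0 : 0 : 1) as origin, verified on coordinates. Only the direction
from zero sum to incidence is used, here and for conics. -/
theorem lineCheck_eq : lineCheck = true := by decide +kernel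

theorem conicCheck_eq : conicCheck = true := by decide +kernel

/-- The product of a packed vector of ten entries with a packed covector. -/
def packedDot (f g : ℕ) : ℕ := Nat.mod (Nat.mod (Nat.shiftRight (Nat.mul f g) 576) (Nat.pow 2 64)) 17

/-- Restrict the span of a list of packed vectors to the kernel of a packed covector. -/
def cutBy {α : Type*} (g : ℕ) (l : List ℕ) : List ℕ → (List ℕ → α) → α :=
  List.rec (fun acc k => k acc)
    (fun f l ih acc k => force (packedDot f g) fun d =>
      Bool.rec
        -- By Fermat d¹⁵ inverts d modulo 17. The vectors still in the list are corrected by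
        -- multiples of f until g kills them, and f is dropped; those already set aside are killed
        -- by g.
        (force (Nat.mod (Nat.pow d 15) 17) fun e =>
          forceMap (fun h => Nat.add h (Nat.mul (Nat.mod
            (Nat.mul (Nat.sub 17 (packedDot h g)) e) 17) f)) l fun m => k (List.append acc m))
        (ih (f :: acc) k) (Nat.beq d 0)) l

/-- Restrict the span of a list of packed vectors to the kernel of several packed covectors. -/
def cutByAll {α : Type*} (gs : List ℕ) : List ℕ → (List ℕ → α) → α :=
  List.rec (fun l k => k l) (fun g _ ih l k => cutBy g l [] fun m => ih m k) gs

/-- Pack a covector. -/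
def pack (l : List ℕ) : ℕ := l.foldl (fun n a => n * 2 ^ 64 + a % 17) 0

/-- The evaluation of cubics, and of their gradients, at a point. -/
def covectors : ℕ × ℕ × ℕ → List ℕ
  | (x, y, z) =>
    [pack [x * x * x, x * x * y, x * x * z, x * y * y, x * y * z, x * z * z,
      y * y * y, y * y * z, y * z * z, z * z * z],
    pack [3 * x * x, 2 * x * y, 2 * x * z, y * y, y * z, z * z, 0, 0, 0, 0],
    pack [0, x * x, 0, 2 * x * y, x * z, 0, 3 * y * y, 2 * y * z, z * z, 0],
    pack [0, 0, x * x, 0, x * y, 2 * x * z, 0, y * y, 2 * y * z, 3 * z * z]]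

/-- The covectors of all points of the curve. -/
def covectorTable : ℕ := (curvePts.flatMap covectors).foldr (fun a n => n * 2 ^ 640 + a) 0

/-- An entry of the table of covectors. -/
def covector (T k : ℕ) : ℕ := Nat.mod (Nat.shiftRight T (Nat.mul 640 k)) (Nat.pow 2 640)

/-- The sum of three numbers. -/
def sum3 (a b c : ℕ) : ℕ := Nat.add a (Nat.add b c)

/-- The product of four numbers. -/
def mul4 (a b c d : ℕ) : ℕ := Nat.mul (Nat.mul a b) (Nat.mul c d)

/-- The cubic with given coefficients passes through a point. -/
def passes : List ℕ → ℕ × ℕ × ℕ → Bool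
  | [a, b, c, d, e, f, g, h, i, j], (x, y, z) =>
    Nat.beq (Nat.mod (sum3
      (sum3 (mul4 a x x x) (mul4 b x x y) (mul4 c x x z))
      (sum3 (mul4 d x y y) (mul4 e x y z) (mul4 f x z z))
      (Nat.add (sum3 (mul4 g y y y) (mul4 h y y z) (mul4 i y z z)) (mul4 j z z z))) 17) 0
  | _, _ => false

/-- The partial derivatives of the cubic with given coefficients vanish at a point. -/
def critical : List ℕ → ℕ × ℕ × ℕ → Bool
  | [a, b, c, d, e, f, g, h, i, j], (x, y, z) =>
    (3 * a * x * x + 2 * b * x * y + 2 * c * x * z + d * y * y + e * y * z + f * z * z) % 17 == 0 &&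
    (b * x * x + 2 * d * x * y + e * x * z + 3 * g * y * y + 2 * h * y * z + i * z * z) % 17 == 0 &&
    (c * x * x + e * x * y + 2 * f * x * z + h * y * y + 2 * i * y * z + 3 * j * z * z) % 17 == 0
  | _, _ => false

/-- The cubic with given coefficients is nonzero, passes through all points in a list, and is
singular at a point. -/
def singularCubic (l : List ℕ) (i : ℕ) (c : List ℕ) : Bool :=
  c.any (fun a => !(a % 17 == 0)) && critical c (curvePt i) && l.all fun k => passes c (curvePt k)

/-- Some labelled points, whose labels have a given sum, are on a nonzero cubic that is singular at
one of them. -/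
def cubicCheck (T : ℕ) (basis l : List ℕ) (n : ℕ) : Bool :=
  l.any fun i => Bool.rec false
    (forceMap (covector T)
      -- The table holds four covectors per point: the value at index 4i, followed by the three
      -- partial derivatives.
      (Nat.add (Nat.mul 4 i) 1 :: Nat.add (Nat.mul 4 i) 2 :: Nat.add (Nat.mul 4 i) 3 ::
        l.map (Nat.mul 4)) fun gs =>
      cutByAll gs basis fun m => match m with
        | f :: _ => forceMap
            (fun i => Nat.mod (Nat.mod (Nat.shiftRight f (Nat.mul 64 i)) (Nat.pow 2 64)) 17)
            (List.range 10) fun c => singularCubic l i c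
        | [] => false)
    (Nat.beq (Nat.mod (Nat.add n i) 26) 0)

/-- The sum of a list of labels. -/
def labelSum (l : List ℕ) : ℕ := List.rec 0 (fun a _ n => Nat.add a n) l

/-- Reduction modulo 26 of the positions of the bits. -/
def foldBits (m : ℕ) : ℕ := Nat.lor (Nat.mod m 67108864) (Nat.shiftRight m 26)

/-- The bit of a number at a position is zero. -/
def bitZero (F x : ℕ) : Bool := Nat.beq (Nat.mod (Nat.shiftRight F x) 2) 0

/-- The search for `n` further labels, in a list, that extend a given list of labels. The bits of `R`
are the negatives of the labels, the bits of `F` the negatives of their sums in pairs. -/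
def labelSearch (leaf : List ℕ → ℕ → Bool) (n : ℕ) : List ℕ → List ℕ → ℕ → ℕ → Bool :=
  Nat.rec (fun _ L _ F => leaf L F)
    (fun _ ih cs => List.rec (fun _ _ _ => true)
      (fun x cs ihl L R F => Bool.rec (ihl L R F)
        (Bool.rec false (ihl L R F)
          (force (Nat.lor F (foldBits (Nat.shiftLeft R (Nat.sub 26 x)))) fun F' =>
            force (Nat.lor R (Nat.shiftLeft 1 (Nat.sub 26 x))) fun R' => ih cs (x :: L) R' F'))
        (bitZero F x)) cs) n

/-- The final test for eight labels: six of them have sum zero, or the points are on a singular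
cubic. -/
def labelLeaf (T : ℕ) (basis L : List ℕ) (F : ℕ) : Bool :=
  force (labelSum L) fun n =>
    Bool.rec true (cubicCheck T basis L n) (bitZero F (Nat.mod (Nat.sub 208 n) 26))

/-- No eight labels belong to points in general position. -/
def labelCheck : Bool :=
  force covectorTable fun T => forceMap (fun i => 2 ^ (64 * i)) (List.range 10) fun basis =>
    labelSearch (labelLeaf T basis) 8 (List.range 26) [] 0 0

/-- When no three and no six of the eight labels have sum zero, the search finds a label i for which
i plus the total is zero. The reason a singular cubic exists is that some cubic then cuts out the
eight points with the i-th doubled, and adding a multiple of the curve makes it singular at that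
point. -/
theorem labelCheck_eq : labelCheck = true := by decide +kernel

end Labels

/-! ### Soundness of the label search. -/

section LabelSound

theorem testBit_of_bitZero {F x : ℕ} (h : bitZero F x = false) : F.testBit x = true := by
  rw [Nat.testBit_eq_decide_div_mod_eq]
  change Nat.beq (F >>> x % 2) 0 = false at h
  rw [Nat.shiftRight_eq_div_pow] at h
  have h1 : F / 2 ^ x % 2 ≠ 0 := fun h0 => by
    rw [h0] at h
    exact absurd h (by decide)
  simp only [decide_eq_true_eq]
  omega

theorem testBit_foldBits {m y : ℕ} (h : (foldBits m).testBit y = true) :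
    m.testBit y = true ∨ m.testBit (26 + y) = true := by
  change ((m % 2 ^ 26) ||| (m >>> 26)).testBit y = true at h
  rw [Nat.testBit_or, Bool.or_eq_true, Nat.testBit_mod_two_pow, Nat.testBit_shiftRight,
    Bool.and_eq_true] at h
  exact h.imp (·.2) id

/-- The bits of `R` are negatives of labels, the bits of `F` negatives of sums of two labels. -/
structure LabelInv (L : List ℕ) (R F : ℕ) : Prop where
  single : ∀ j, R.testBit j = true → ∃ a ∈ L, a + j = 26
  pair : ∀ j, F.testBit j = true → ∃ a b, [a, b].Sublist L ∧ (a + b + j) % 26 = 0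

theorem LabelInv.cons {L : List ℕ} {R F x : ℕ} (h : LabelInv L R F) (hx : x < 26) :
    LabelInv (x :: L) (Nat.lor R (Nat.shiftLeft 1 (Nat.sub 26 x)))
      (Nat.lor F (foldBits (Nat.shiftLeft R (Nat.sub 26 x)))) := by
  -- The bit 26 − a of a label a moves to 52 − a − x, which represents −(a + x) modulo 26.
  have key : ∀ j, (R <<< (26 - x)).testBit j = true → ∃ a ∈ L, a + x + j = 52 := by
    intro j hj
    rw [Nat.testBit_shiftLeft, Bool.and_eq_true, decide_eq_true_eq] at hj
    obtain ⟨a, ha, h1⟩ := h.single _ hj.2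
    exact ⟨a, ha, by omega⟩
  constructor
  · intro j hj
    change (R ||| (1 <<< (26 - x))).testBit j = true at hj
    rw [Nat.testBit_or, Bool.or_eq_true] at hj
    rcases hj with hj | hj
    · obtain ⟨a, ha, h1⟩ := h.single j hj
      exact ⟨a, List.mem_cons_of_mem _ ha, h1⟩
    · rw [Nat.one_shiftLeft, Nat.testBit_two_pow, decide_eq_true_eq] at hj
      exact ⟨x, List.mem_cons_self, by omega⟩
  · intro j hj
    change (F ||| (foldBits (R <<< (26 - x)))).testBit j = true at hj
    rw [Nat.testBit_or, Bool.or_eq_true] at hj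
    rcases hj with hj | hj
    · obtain ⟨a, b, hab, h1⟩ := h.pair j hj
      exact ⟨a, b, hab.trans (List.sublist_cons_self _ _), h1⟩
    · rcases testBit_foldBits hj with hj | hj <;> obtain ⟨a, ha, h1⟩ := key _ hj <;>
        exact ⟨x, a, (List.singleton_sublist.2 ha).cons_cons x, by omega⟩

theorem boolRec_eq (b s t : Bool) :
    Bool.rec (motive := fun _ => Bool) s t b = bif b then t else s := by
  cases b <;> rfl

/-- A label is pruned only when F records two chosen labels that complete it to a zero sum. A list
without such triples is never pruned, so its leaf has been tested. -/
theorem exists_leaf_of_labelSearch {leaf : List ℕ → ℕ → Bool} (n : ℕ) (cs L : List ℕ) (R F : ℕ)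
    (h : labelSearch leaf n cs L R F = true) (hcs : ∀ x ∈ cs, x < 26) (hi : LabelInv L R F)
    {M : List ℕ} (hM : M.Sublist cs) (hn : M.length = n)
    (hno : ∀ a b c, [a, b, c].Sublist (M.reverse ++ L) → (a + b + c) % 26 ≠ 0) :
    ∃ R' F', LabelInv (M.reverse ++ L) R' F' ∧ leaf (M.reverse ++ L) F' = true := by
  induction n generalizing cs L R F M with
  | zero =>
    obtain rfl := List.length_eq_zero_iff.1 hn
    exact ⟨R, F, hi, h⟩
  | succ n ih =>
    induction cs with
    | nil =>
      obtain rfl := List.sublist_nil.1 hM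
      simp at hn
    | cons x cs ihl =>
      have hx := hcs x List.mem_cons_self
      have hcs' : ∀ y ∈ cs, y < 26 := fun y hy => hcs y (List.mem_cons_of_mem _ hy)
      have hstep : labelSearch leaf (n + 1) (x :: cs) L R F =
        bif bitZero F x then
          bif labelSearch leaf n cs (x :: L) (Nat.lor R (Nat.shiftLeft 1 (Nat.sub 26 x)))
            (Nat.lor F (foldBits (Nat.shiftLeft R (Nat.sub 26 x)))) then
            labelSearch leaf (n + 1) cs L R F else false
        else labelSearch leaf (n + 1) cs L R F := by
        simp only [labelSearch, force_eq, boolRec_eq]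
      rw [hstep] at h
      cases hM with
      | cons _ hM =>
        refine ihl ?_ hcs' hM
        revert h
        cases bitZero F x
        · exact id
        · cases labelSearch leaf n cs (x :: L) (Nat.lor R (Nat.shiftLeft 1 (Nat.sub 26 x)))
            (Nat.lor F (foldBits (Nat.shiftLeft R (Nat.sub 26 x))))
          · exact fun h => absurd h (by simp)
          · exact id
      | cons_cons _ hM =>
        rename_i M'
        have hrev : (x :: M').reverse ++ L = M'.reverse ++ x :: L := by simp
        rw [hrev] at hno ⊢
        cases hb : bitZero F x
        · obtain ⟨a, b, hab, h0⟩ := hi.pair x (testBit_of_bitZero hb)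
          exact absurd (by omega : (x + a + b) % 26 = 0) (hno x a b
            ((hab.cons_cons x).trans (List.sublist_append_right _ _)))
        · rw [hb] at h
          refine ih cs (x :: L) _ _ ?_ hcs' (hi.cons hx) hM (by simpa using hn) hno
          revert h
          cases labelSearch leaf n cs (x :: L) (Nat.lor R (Nat.shiftLeft 1 (Nat.sub 26 x)))
            (Nat.lor F (foldBits (Nat.shiftLeft R (Nat.sub 26 x))))
          · exact fun h => absurd h (by simp)
          · exact fun _ => rfl

end LabelSound

/-! ### Soundness of the singular cubic certificates. -/

section Seventeen

variable {K : Type*} [Field K]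

theorem VecGP.comp {r s : ℕ} {v : Fin r → Fin 3 → K} (h : VecGP v) {e : Fin s → Fin r}
    (he : Function.Injective e) : VecGP (v ∘ e) where
  ne_zero i := h.ne_zero _
  line i j k hij hik hjk := h.line _ _ _ (he.ne hij) (he.ne hik) (he.ne hjk)
  conic T hT c hc := by
    obtain ⟨i, hi, hne⟩ := h.conic (T.map ⟨e, he⟩) (by simpa using hT) c hc
    obtain ⟨j, hj, rfl⟩ := Finset.mem_map.1 hi
    exact ⟨j, hj, hne⟩
  cubic T hT c hc hv i hi := by
    refine h.cubic (T.map ⟨e, he⟩) (by simpa using hT) c hc (fun j hj => ?_) (e i)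
      (Finset.mem_map_of_mem _ hi)
    obtain ⟨k, hk, rfl⟩ := Finset.mem_map.1 hj
    exact hv k hk

/-- The vector of coordinates of the point with a given label. -/
def curveVec (K : Type*) [Field K] (a : ℕ) : Fin 3 → K := vecOf (fun n => (n : K)) (curvePt a)

theorem codeLt_curvePt {a : ℕ} (ha : a < 26) : CodeLt 17 (curvePt a) := by
  have : ∀ a < 26, (curvePt a).1 < 17 ∧ (curvePt a).2.1 < 17 ∧ (curvePt a).2.2 < 17 := by
    decide +kernel
  exact this a ha

theorem passes_sound [CharP K 17] {c : List ℕ} {p : ℕ × ℕ × ℕ} (h : passes c p = true) :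
    cubForm (fun i => (c.getD i 0 : K)) (vecOf (fun n => (n : K)) p) = 0 := by
  obtain ⟨x, y, z⟩ := p
  unfold passes at h
  split at h
  · rename_i heq
    simp only [Prod.mk.injEq] at heq
    obtain ⟨rfl, rfl, rfl⟩ := heq
    have h0 := congrArg (Nat.cast (R := K)) (Nat.eq_of_beq_eq_true h)
    change ((_ % 17 : ℕ) : K) = _ at h0
    rw [cast_mod] at h0
    simp only [sum3, mul4, Nat.add_eq, Nat.mul_eq] at h0
    push_cast at h0
    simp [cubForm, vecOf]
    linear_combination h0
  · simp at h

theorem critical_sound [CharP K 17] {c : List ℕ} {p : ℕ × ℕ × ℕ} (h : critical c p = true) :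
    cubGrad (fun i => (c.getD i 0 : K)) (vecOf (fun n => (n : K)) p) = 0 := by
  obtain ⟨x, y, z⟩ := p
  unfold critical at h
  split at h
  · rename_i heq
    simp only [Prod.mk.injEq] at heq
    obtain ⟨rfl, rfl, rfl⟩ := heq
    simp only [Bool.and_eq_true, beq_iff_eq] at h
    obtain ⟨⟨h0, h1⟩, h2⟩ := h
    have e0 := congrArg (Nat.cast (R := K)) h0
    have e1 := congrArg (Nat.cast (R := K)) h1
    have e2 := congrArg (Nat.cast (R := K)) h2
    rw [cast_mod] at e0 e1 e2
    push_cast at e0 e1 e2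
    funext k
    fin_cases k
    · simp [cubGrad, vecOf]
      linear_combination e0
    · simp [cubGrad, vecOf]
      linear_combination e1
    · simp [cubGrad, vecOf]
      linear_combination e2
  · simp at h

theorem critical_length {c : List ℕ} {p : ℕ × ℕ × ℕ} (h : critical c p = true) : c.length = 10 := by
  unfold critical at h
  split at h
  · rfl
  · simp at h

/-- The linear algebra that proposes a cubic needs no proof: `singularCubic` rechecks the
coefficients it returns, so it is enough that some list passed that check. -/
theorem cubicCheck_sound [CharP K 17] {T : ℕ} {basis l : List ℕ} {n : ℕ}
    (h : cubicCheck T basis l n = true) : ∃ i ∈ l, ∃ c : Fin 10 → K, c ≠ 0 ∧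
      (∀ k ∈ l, cubForm c (curveVec K k) = 0) ∧ cubGrad c (curveVec K i) = 0 := by
  simp only [cubicCheck, List.any_eq_true, boolRec_eq, forceMap_eq] at h
  obtain ⟨i, hi, h⟩ := h
  obtain ⟨c, h⟩ : ∃ c, singularCubic l i c = true := by
    cases hb : Nat.beq (Nat.mod (Nat.add n i) 26) 0 with
    | false =>
      rw [hb] at h
      simp at h
    | true =>
      rw [hb, cond_true] at h
      have aux : ∀ (gs L : List ℕ) (k : List ℕ → Bool), cutByAll gs L k = true →
          ∃ m, k m = true := by
        have aux1 : ∀ (g : ℕ) (L acc : List ℕ) (k : List ℕ → Bool), cutBy g L acc k = true →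
            ∃ m, k m = true := by
          intro g L
          induction L with
          | nil => exact fun acc k h => ⟨acc, h⟩
          | cons f L ih =>
            intro acc k h
            simp only [cutBy, force_eq, forceMap_eq, boolRec_eq] at h
            cases hd : Nat.beq (packedDot f g) 0 with
            | false =>
              rw [hd] at h
              exact ⟨_, h⟩
            | true =>
              rw [hd, cond_true] at h
              refine ih (f :: acc) k ?_
              simpa only [cutBy, force_eq, forceMap_eq, boolRec_eq] using h
        intro gs
        induction gs with
        | nil => exact fun L k h => ⟨L, h⟩
        | cons g gs ih =>
          intro L k h
          obtain ⟨m, hm⟩ := aux1 g L [] _ h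
          exact ih m k hm
      obtain ⟨m, hm⟩ := aux _ _ _ h
      cases m with
      | nil => simp at hm
      | cons f m => exact ⟨_, hm⟩
  simp only [singularCubic, Bool.and_eq_true, List.any_eq_true, List.all_eq_true,
    Bool.not_eq_true', beq_eq_false_iff_ne] at h
  obtain ⟨⟨⟨a, ha, hne⟩, hcrit⟩, hpass⟩ := h
  refine ⟨i, hi, fun i => (c.getD i 0 : K), fun h0 => hne ?_, fun k hk => passes_sound (hpass k hk),
    critical_sound hcrit⟩
  obtain ⟨j, hj, rfl⟩ := List.mem_iff_getElem.1 ha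
  have := congrFun h0 ⟨j, by rw [← critical_length hcrit]; exact hj⟩
  simp only [Pi.zero_apply, List.getD_eq_getElem _ _ hj] at this
  exact Nat.mod_eq_zero_of_dvd ((CharP.cast_eq_zero_iff K 17 _).1 this)

end Seventeen

/-! ### No eight points over the field with 17 elements. -/

section Seventeen

variable {K : Type*} [Field K]

theorem exists_label [Finite K] [CharP K 17] (hq : Nat.card K = 17) {v : Fin 3 → K} (hv : v ≠ 0)
    (h : weierstrassForm 0 3 0 v = 0) : ∃ a < 26, ∃ u : K, u ≠ 0 ∧ v = u • curveVec K a := by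
  have hO := isCoding_prime (K := K) (p := 17) (by norm_num) hq
  rw [weierstrassForm] at h
  by_cases h1 : v 1 = 0
  · have h0 : v 0 = 0 := by
      rw [h1] at h
      have : v 0 ^ 3 = 0 := by linear_combination -h
      simpa using this
    refine ⟨0, by norm_num, v 2, fun h2 => hv ?_, ?_⟩
    · funext k; fin_cases k <;> assumption
    · funext k; fin_cases k <;> simp [h0, h1, curveVec, vecOf, curvePt, curvePts]
  · obtain ⟨x, hx, ex⟩ := hO.surj (v 0 / v 1)
    obtain ⟨z, hz, ez⟩ := hO.surj (v 2 / v 1)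
    have hcheck : ∀ x < 17, ∀ z < 17, (x * x * x + 3 * x) % 17 = z * z % 17 →
        ∃ a < 26, curvePt a = (x, 1, z) := by decide +kernel
    obtain ⟨a, ha, hp⟩ := hcheck x hx z hz (by
      refine hO.inj (Nat.mod_lt _ (by norm_num)) (Nat.mod_lt _ (by norm_num)) ?_
      rw [cast_mod, cast_mod]
      push_cast
      rw [ex, ez]
      field_simp
      linear_combination -h)
    refine ⟨a, ha, v 1, h1, ?_⟩
    rw [curveVec, hp]
    funext k
    fin_cases k
    · simp [vecOf, ex]; field_simp
    · simp [vecOf]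
    · simp [vecOf, ez]; field_simp

theorem exists_strictMono_labels [Finite K] [CharP K 17] (hq : Nat.card K = 17)
    {v : Fin 8 → Fin 3 → K} (hv : VecGP v) (h : ∀ i, weierstrassForm 0 3 0 (v i) = 0) :
    ∃ l : Fin 8 → ℕ, StrictMono l ∧ (∀ i, l i < 26) ∧ VecGP fun i => curveVec K (l i) := by
  have := fun i => exists_label hq (hv.ne_zero i) (h i)
  choose l hl u hu hlu using this
  have hinj : Function.Injective l := by
    intro i j hij
    by_contra hne
    refine hv.ne_smul hne (u i * (u j)⁻¹) ?_
    rw [hlu i, hlu j, hij, smul_smul, mul_assoc, inv_mul_cancel₀ (hu j), mul_one]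
  have h1 := hv.smul (u := fun i => (u i)⁻¹) fun i => inv_ne_zero (hu i)
  have h2 : (fun i => (u i)⁻¹ • v i) = fun i => curveVec K (l i) := by
    funext i
    rw [hlu i, smul_smul, inv_mul_cancel₀ (hu i), one_smul]
  rw [h2] at h1
  have hsort := Tuple.monotone_sort l
  exact ⟨l ∘ Tuple.sort l, hsort.strictMono_of_injective (hinj.comp (Tuple.sort l).injective),
    fun i => hl _, h1.comp (Tuple.sort l).injective⟩

theorem labelSum_three_ne [Finite K] [CharP K 17] (hq : Nat.card K = 17) {l : Fin 8 → ℕ}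
    (hl : ∀ i, l i < 26) (h : VecGP fun i => curveVec K (l i)) {i j k : Fin 8} (hij : i ≠ j)
    (hik : i ≠ k) (hjk : j ≠ k) : (l i + l j + l k) % 26 ≠ 0 := by
  intro h0
  have hO := isCoding_prime (K := K) (p := 17) (by norm_num) hq
  have hb := val_brCode hO (codeLt_curvePt (hl i)) (codeLt_curvePt (hl j)) (codeLt_curvePt (hl k))
  have hline := lineCheck_eq
  simp only [lineCheck, List.all_eq_true, List.mem_range] at hline
  have := hline _ (hl i) _ (hl j) _ (hl k)
  rw [h0] at this
  simp only [beq_self_eq_true, Bool.not_true, Bool.false_or, beq_iff_eq] at this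
  refine h.bracket_ne_zero hij hik hjk ?_
  rw [← hO.val_zero, ← this]
  exact hb.2.symm

theorem labelSum_six_ne [Finite K] [CharP K 17] (hq : Nat.card K = 17) {l : Fin 8 → ℕ}
    (hmono : StrictMono l) (hl : ∀ i, l i < 26) (h : VecGP fun i => curveVec K (l i))
    (e : Fin 6 ↪o Fin 8) : (∑ i, l (e i)) % 26 ≠ 0 := by
  intro h0
  have hO := isCoding_prime (K := K) (p := 17) (by norm_num) hq
  have hb := fun i j k =>
    val_brCode hO (codeLt_curvePt (hl i)) (codeLt_curvePt (hl j)) (codeLt_curvePt (hl k))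
  have hlt : ∀ i j : Fin 6, i < j → l (e i) < l (e j) := fun i j hij => hmono (e.strictMono hij)
  have h01 := hlt 0 1 (by decide)
  simp only [Fin.sum_univ_six] at h0
  have hc := conicCheck_eq
  simp only [conicCheck, List.all_eq_true, List.mem_range, force_eq] at hc
  have := hc _ (hl (e 5)) _ (hlt 4 5 (by decide)) _ (hlt 3 4 (by decide)) _ (hlt 2 3 (by decide)) _
    (hlt 1 2 (by decide))
  -- Five labels sum to at most 125, below 156 = 6 · 26, so the subtraction is not truncated.
  have hf : (156 - (l (e 5) + l (e 4) + l (e 3) + l (e 2) + l (e 1))) % 26 = l (e 0) := by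
    have := hl (e 0)
    have := hl (e 1)
    have := hl (e 2)
    have := hl (e 3)
    have := hl (e 4)
    have := hl (e 5)
    omega
  rw [hf, Bool.or_eq_true, Nat.ble_eq] at this
  have hrel := this.resolve_left (by omega)
  simp only [conicRel, fmul_eq, beq_iff_eq] at hrel
  -- The table of conics lists the labels in decreasing order, hence the reversal.
  refine h.bracket_conic (i := fun i => e i.rev)
    (e.injective.comp Fin.rev_injective) ?_
  have := congrArg (fun n : ℕ => (n : K)) hrel
  rw [hO.val_mul, hO.val_mul, hO.val_mul, hO.val_mul, hO.val_mul, hO.val_mul] at this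
  · simp only [(hb _ _ _).2] at this
    exact this
  all_goals first
    | exact (hb _ _ _).1
    | exact hO.mul_lt (hb _ _ _).1 (hb _ _ _).1

theorem not_vecGP_curve [Finite K] [CharP K 17] (hq : Nat.card K = 17) {v : Fin 8 → Fin 3 → K}
    (h : ∀ i, weierstrassForm 0 3 0 (v i) = 0) : ¬ VecGP v := by
  intro hv
  obtain ⟨l, hmono, hl, hgp⟩ := exists_strictMono_labels hq hv h
  have hsearch := labelCheck_eq
  simp only [labelCheck, force_eq, forceMap_eq] at hsearch
  have hmem : ∀ {a}, a ∈ (List.ofFn l).reverse ++ [] ↔ ∃ i, l i = a := by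
    intro a
    rw [List.append_nil, List.mem_reverse, List.mem_ofFn]
  have hnodup : ((List.ofFn l).reverse ++ []).Nodup := by
    rw [List.append_nil, List.nodup_reverse, List.nodup_ofFn]
    exact hmono.injective
  have hsub : (List.ofFn l).Sublist (List.range 26) := by
    refine List.sublist_of_subperm_of_sortedLE ?_ ?_ ?_
    · refine (List.nodup_ofFn.2 hmono.injective).subperm fun a ha => ?_
      obtain ⟨i, rfl⟩ := List.mem_ofFn.1 ha
      exact List.mem_range.2 (hl i)
    · exact hmono.monotone.sortedLE_ofFn
    · exact (List.sortedLT_range 26).sortedLE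
  obtain ⟨R, F, hinv, hleaf⟩ := exists_leaf_of_labelSearch 8 _ _ _ _ hsearch
    (fun x hx => List.mem_range.1 hx) ⟨by simp, by simp⟩ hsub (List.length_ofFn) (by
      intro a b c habc
      have hn := hnodup.sublist habc
      obtain ⟨i, rfl⟩ := hmem.1 (habc.subset (List.mem_cons_self))
      obtain ⟨j, rfl⟩ := hmem.1 (habc.subset (by simp : b ∈ [_, b, c]))
      obtain ⟨k, rfl⟩ := hmem.1 (habc.subset (by simp : c ∈ [_, _, c]))
      simp only [List.nodup_cons, List.mem_cons, List.not_mem_nil, not_or, or_false] at hn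
      exact labelSum_three_ne hq hl hgp (fun h => hn.1.1 (by rw [h])) (fun h => hn.1.2 (by rw [h]))
        fun h => hn.2.1 (by rw [h]))
  have hsum : labelSum ((List.ofFn l).reverse ++ []) = ∑ i, l i := by
    have : ∀ m : List ℕ, labelSum m = m.sum := by
      intro m
      induction m with
      | nil => rfl
      | cons a m ih =>
        rw [List.sum_cons, ← ih]
        rfl
    rw [this, List.append_nil, List.sum_reverse, List.sum_ofFn]
  simp only [labelLeaf, force_eq, boolRec_eq, hsum] at hleaf
  have hle : ∑ i, l i ≤ 208 := by
    have := Finset.sum_le_sum fun i (_ : i ∈ Finset.univ) => (hl i).le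
    simpa using this
  -- Since 208 = 8 · 26, the tested bit is at minus the total. If it is set, two labels have the
  -- same sum as all eight modulo 26, and the other six sum to zero.
  cases hb : bitZero F (Nat.mod (Nat.sub 208 (∑ i, l i)) 26) with
  | false =>
    obtain ⟨a, b, hab, h0⟩ := hinv.pair _ (testBit_of_bitZero hb)
    have hn := hnodup.sublist hab
    obtain ⟨i, rfl⟩ := hmem.1 (hab.subset (List.mem_cons_self))
    obtain ⟨j, rfl⟩ := hmem.1 (hab.subset (by simp : b ∈ [_, b]))
    have hij : i ≠ j := by
      rintro rfl
      simp at hn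
    have hcard : (({i, j} : Finset (Fin 8))ᶜ).card = 6 := by
      rw [Finset.card_compl, Finset.card_pair hij]
      rfl
    refine labelSum_six_ne hq hmono hl hgp ((({i, j} : Finset (Fin 8))ᶜ).orderEmbOfFin hcard) ?_
    have h1 : ∑ k, l ((({i, j} : Finset (Fin 8))ᶜ).orderEmbOfFin hcard k) =
        ∑ k ∈ ({i, j} : Finset (Fin 8))ᶜ, l k := by
      conv_rhs => rw [← Finset.map_orderEmbOfFin_univ _ hcard, Finset.sum_map]
      rfl
    have h2 := Finset.sum_add_sum_compl ({i, j} : Finset (Fin 8)) l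
    rw [Finset.sum_pair hij] at h2
    rw [h1]
    change (l i + l j + (208 - ∑ i, l i) % 26) % 26 = 0 at h0
    omega
  | true =>
    rw [hb, cond_true] at hleaf
    obtain ⟨a, ha, c, hc, hz, hs⟩ := cubicCheck_sound (K := K) hleaf
    obtain ⟨i, rfl⟩ := hmem.1 ha
    exact hgp.cubic Finset.univ (by simp) c hc (fun k _ => hz _ (hmem.2 ⟨k, rfl⟩)) i
      (Finset.mem_univ _) hs

theorem not_vecGP_eight_of_card_eq_seventeen [Finite K] [CharP K 17] (hq : Nat.card K = 17)
    (v : Fin 8 → Fin 3 → K) : ¬ VecGP v := by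
  intro hv
  have hO := isCoding_prime (K := K) (p := 17) (by norm_num) hq
  have h17 : (17 : K) = 0 := by exact_mod_cast CharP.cast_eq_zero K 17
  have h2 : (2 : K) ≠ 0 := two_ne_zero_of_card (by rw [hq]; decide)
  have h3 : (3 : K) ≠ 0 := by
    intro h3
    apply one_ne_zero (α := K)
    linear_combination 6 * h3 - h17
  have hw : ¬ ∃ a b c : K, Carries (weierstrassForm a b c) ((Nat.card K - 1) * 25) := by
    rintro ⟨a, b, c, hc⟩
    obtain ⟨b, c, hc⟩ : ∃ b c : K, Carries (weierstrassForm 0 b c) ((Nat.card K - 1) * 25) := by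
      obtain ⟨a, rfl⟩ : ∃ d, a = 3 * d := ⟨a / 3, by field_simp⟩
      refine ⟨b - 3 * a ^ 2, c - a * b + 2 * a ^ 3, hc.transform (M := !![1, -a, 0; 0, 1, 0; 0, 0, 1])
        (N := !![1, a, 0; 0, 1, 0; 0, 0, 1]) ?_ one_ne_zero fun v => ?_⟩
      · ext i j
        fin_cases i <;> fin_cases j <;> simp [Matrix.mul_apply, Fin.sum_univ_three]
      · simp [weierstrassForm, Matrix.mulVec, dotProduct, Fin.sum_univ_three]
        ring
    obtain ⟨A, B, C, n, hA, hB, hC, eA, rfl, rfl, hn, ht⟩ :=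
      exists_of_countCheck_cubic hO countCheck_cubic_seventeen hc
    have hA0 : A = 0 := hO.inj hA (by norm_num) (by rw [eA, Nat.cast_zero])
    simp only [hA0, beq_self_eq_true, Bool.not_true, Bool.false_or, Bool.or_eq_true, Nat.ble_eq,
      Bool.and_eq_true, beq_iff_eq, List.contains_iff_mem, List.mem_cons, List.not_mem_nil,
      or_false] at ht
    obtain ⟨rfl, hBmem⟩ := ht.resolve_left (by omega)
    -- Modulo 17, 5 = 3 · 3⁴, 12 = 3 · 6⁴ and 14 = 3 · 2⁴. Scaling x by μ² and z by μ³ then reduces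
    -- every case to B = 3.
    obtain ⟨μ, hμ0, hμ⟩ : ∃ μ : K, μ ≠ 0 ∧ (B : K) = 3 * μ ^ 4 := by
      have hne : ∀ n : ℕ, n % 17 ≠ 0 → (n : K) ≠ 0 := fun n hn h0 =>
        hn (Nat.mod_eq_zero_of_dvd ((CharP.cast_eq_zero_iff K 17 n).1 h0))
      rcases hBmem with rfl | rfl | rfl | rfl
      · exact ⟨1, one_ne_zero, by norm_num⟩
      · refine ⟨(3 : ℕ), hne 3 (by norm_num), ?_⟩
        push_cast
        linear_combination -14 * h17
      · refine ⟨(6 : ℕ), hne 6 (by norm_num), ?_⟩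
        push_cast
        linear_combination -228 * h17
      · refine ⟨(2 : ℕ), hne 2 (by norm_num), ?_⟩
        push_cast
        linear_combination -2 * h17
    have hE : Carries (weierstrassForm (0 : K) 3 0) ((Nat.card K - 1) * 25) := by
      refine hc.transform (M := !![μ ^ 2, 0, 0; 0, 1, 0; 0, 0, μ ^ 3])
        (N := !![(μ ^ 2)⁻¹, 0, 0; 0, 1, 0; 0, 0, (μ ^ 3)⁻¹]) ?_ (inv_ne_zero (pow_ne_zero 6 hμ0))
        fun v => ?_
      · ext i j
        fin_cases i <;> fin_cases j <;> simp [Matrix.mul_apply, Fin.sum_univ_three, hμ0]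
      · simp [weierstrassForm, Matrix.mulVec, dotProduct, Fin.sum_univ_three, hμ]
        field_simp
    obtain ⟨w, hgp, hz⟩ := hE.pts
    exact not_vecGP_curve hq hz hgp
  obtain h | ⟨a, b, c, hc⟩ := hv.exists_carries h2 (by rw [hq]; norm_num) (m := 25)
    (by rw [hq]; norm_num)
  · exact hw h
  · obtain ⟨A, B, C, n, hA, hB, hC, eA, eB, eC, hn, ht⟩ :=
      exists_of_countCheck_quartic hO h2 countCheck_quartic_seventeen hc
    simp only [Bool.or_eq_true, quarticTest, beq_iff_eq, Nat.ble_eq] at ht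
    rcases ht with (rfl | ht) | ht
    · have h40 : (2 * 2 : K) ≠ 0 := mul_ne_zero h2 h2
      simp only [Nat.cast_zero] at eB
      obtain rfl : b = 0 :=
        (mul_eq_zero.1 (by linear_combination eB : 2 * 2 * b = 0)).resolve_left h40
      exact hw (hc.weierstrass_of_nonflex h2)
    · omega
    · simp only [flexTest, List.any_eq_true, List.mem_range, Bool.and_eq_true, beq_iff_eq,
        Bool.not_eq_true', beq_eq_false_iff_ne] at ht
      obtain ⟨x, hx, z, hz, ⟨t0, te⟩, s, hs, ⟨ts, t2⟩, t1⟩ := ht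
      have e0 := congrArg (Nat.cast (R := K)) t0
      have e1 := congrArg (Nat.cast (R := K)) t1
      have e2 := congrArg (Nat.cast (R := K)) t2
      rw [cast_mod] at e0 e1 e2
      push_cast at e0 e1 e2
      have hne : ∀ n : ℕ, n % 17 ≠ 0 → (n : K) ≠ 0 := fun n hn h0 =>
        hn (Nat.mod_eq_zero_of_dvd ((CharP.cast_eq_zero_iff K 17 n).1 h0))
      have ee := hne _ te
      push_cast at ee
      rw [eA, eB, eC] at e0
      rw [eA, eB] at e1
      rw [eA] at e2
      refine hw (hc.weierstrass_of_flex h2 (x := x) (z := z) (s := s) (hne s ?_) ?_ ?_ ?_ ?_)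
      · rw [Nat.mod_eq_of_lt hs]
        exact ts
      · intro h0
        exact ee (by linear_combination h0)
      -- The codes stand for −4a, −4b, −4c, and 4 · (−4) = −16 = 1 modulo 17, so the factor 4 in the
      -- test recovers a, b, c.
      · linear_combination e0 + (a * x ^ 2 + b * x + c) * h17
      · linear_combination e1 + (2 * a * x + b) * h17
      · linear_combination e2 + a * h17

end Seventeen

/-! ### Assembling the cases. -/

section Main

variable {K : Type*} [Field K]

theorem not_vecGP_eight [Finite K] (hK : Nat.card K = 9 ∨ Nat.card K = 11 ∨ Nat.card K = 13 ∨
    Nat.card K = 17) (v : Fin 8 → Fin 3 → K) : ¬ VecGP v := by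
  have := Fintype.ofFinite K
  rcases hK with h | h | h | h
  · obtain ⟨val, hO⟩ := exists_isCoding_nine h
    exact not_vecGP_of_countCheck hO h (by decide) (by norm_num) (by norm_num)
      countCheck_quartic_nine countCheck_cubic_nine v
  · have hp : Nat.Prime 11 := by norm_num
    have : Fact (Nat.Prime 11) := ⟨hp⟩
    have : CharP K 11 := charP_of_card_eq_prime (by rw [← Nat.card_eq_fintype_card, h])
    exact not_vecGP_of_countCheck (isCoding_prime hp h) h (by decide) (by norm_num) (by norm_num)
      countCheck_quartic_eleven countCheck_cubic_eleven v
  · have hp : Nat.Prime 13 := by norm_num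
    have : Fact (Nat.Prime 13) := ⟨hp⟩
    have : CharP K 13 := charP_of_card_eq_prime (by rw [← Nat.card_eq_fintype_card, h])
    exact not_vecGP_of_countCheck (isCoding_prime hp h) h (by decide) (by norm_num) (by norm_num)
      countCheck_quartic_thirteen countCheck_cubic_thirteen v
  · have : Fact (Nat.Prime 17) := ⟨by norm_num⟩
    have : CharP K 17 := charP_of_card_eq_prime (by rw [← Nat.card_eq_fintype_card, h])
    exact not_vecGP_eight_of_card_eq_seventeen h v

theorem exists_vecGP_iff {r : ℕ} (hr : 3 ≤ r) :
    (∃ P : Fin r → ProjPlane K, InGeneralPosition P) ↔ ∃ v : Fin r → Fin 3 → K, VecGP v := by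
  constructor
  · rintro ⟨P, hP⟩
    exact ⟨_, hP.vecGP⟩
  · rintro ⟨v, hv⟩
    exact ⟨_, hv.inGeneralPosition hr⟩

theorem exists_seven_of_eight (h : ∃ v : Fin 8 → Fin 3 → K, VecGP v) :
    ∃ v : Fin 7 → Fin 3 → K, VecGP v :=
  let ⟨_, hv⟩ := h
  ⟨_, hv.comp (Fin.castSucc_injective 7)⟩

/-- Among the prime powers above 8, the constructions of eight points reach all but 9, 11, 13 and
17, and those reached are 16 or at least 19. -/
theorem card_cases [Finite K] (h8 : 8 < Nat.card K) :
    (Nat.card K = 9 ∨ Nat.card K = 11 ∨ Nat.card K = 13 ∨ Nat.card K = 17) ∨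
      (Nat.card K = 16 ∨ 19 ≤ Nat.card K) ∧ ∃ v : Fin 8 → Fin 3 → K, VecGP v := by
  obtain ⟨p, hchar⟩ := CharP.exists K
  have := Fintype.ofFinite K
  obtain ⟨N, hp, hN⟩ := FiniteField.card K p
  rw [← Nat.card_eq_fintype_card] at hN
  have hN0 := N.pos
  have hbig : 30 < p ∧ 1 ≤ (N : ℕ) ∨ 5 ≤ p ∧ 2 ≤ (N : ℕ) ∨ p = 3 ∧ 3 ≤ (N : ℕ) ∨
      p = 2 ∧ 4 ≤ (N : ℕ) → ∃ v : Fin 8 → Fin 3 → K, VecGP v :=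
    exists_vecGP_of_card_eq_pow hp hN
  have hpow : ∀ m, m ≤ (N : ℕ) → p ^ m ≤ Nat.card K := fun m hm => by
    rw [hN]
    exact Nat.pow_le_pow_right hp.pos hm
  rcases le_or_gt (N : ℕ) 1 with h1 | h1
  · have hN1 : (N : ℕ) = 1 := by omega
    rw [hN1, pow_one] at hN
    rcases le_or_gt p 30 with h30 | h30
    · have hcases : (p = 11 ∨ p = 13 ∨ p = 17) ∨ p = 19 ∨ p = 23 ∨ p = 29 := by
        rw [hN] at h8
        clear * - hp h8 h30
        interval_cases p <;> first | omega | (exfalso; revert hp; decide)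
      rcases hcases with h | h
      · left
        omega
      · right
        exact ⟨by omega, exists_vecGP_of_small_prime hp hN h⟩
    · right
      exact ⟨by omega, hbig (Or.inl ⟨h30, hN0⟩)⟩
  · have hp2 := hp.two_le
    rcases lt_or_ge p 5 with h5 | h5
    · have h23 : p = 2 ∨ p = 3 := by
        clear * - hp hp2 h5
        interval_cases p <;> first | omega | (exfalso; revert hp; decide)
      rcases h23 with rfl | rfl
      · rcases le_or_gt (N : ℕ) 3 with h3 | h3
        · have := Nat.pow_le_pow_right (n := 2) (by norm_num) h3
          omega
        · right
          refine ⟨?_, hbig (by omega)⟩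
          rcases le_or_gt (N : ℕ) 4 with h4 | h4
          · left
            rw [hN, (by omega : (N : ℕ) = 4)]
            norm_num
          · right
            exact le_trans (by norm_num) (hpow 5 h4)
      · rcases le_or_gt (N : ℕ) 2 with h3 | h3
        · left; left
          rw [hN, (by omega : (N : ℕ) = 2)]
          norm_num
        · right
          exact ⟨Or.inr (le_trans (by norm_num) (hpow 3 h3)), hbig (by omega)⟩
    · right
      refine ⟨Or.inr (le_trans ?_ (hpow 2 h1)), hbig (by omega)⟩
      nlinarith

theorem exists_seven_vecGP [Finite K] (hK : Nat.card K = 9 ∨ Nat.card K = 11 ∨ Nat.card K = 13 ∨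
    Nat.card K = 17) : ∃ v : Fin 7 → Fin 3 → K, VecGP v := by
  have := Fintype.ofFinite K
  have aux : ∀ {p : ℕ}, p.Prime → Nat.card K = p → p = 11 ∨ p = 13 ∨ p = 17 →
      ∃ v : Fin 7 → Fin 3 → K, VecGP v := by
    intro p hp h hp'
    have : Fact p.Prime := ⟨hp⟩
    have : CharP K p := charP_of_card_eq_prime (by rw [← Nat.card_eq_fintype_card, h])
    exact exists_seven_vecGP_of_small_prime hp h hp'
  rcases hK with h | h | h | h
  · exact exists_seven_vecGP_of_card_eq_nine h
  · exact aux (by norm_num) h (by simp)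
  · exact aux (by norm_num) h (by simp)
  · exact aux (by norm_num) h (by simp)

end Main

end PlanePoints

theorem mainTheorem8 {K : Type*} [Field K] [Finite K] (q : ℕ) (hq : Nat.card K = q) :
    ((∃ P : Fin 7 → ProjPlane K, InGeneralPosition P) ↔ 9 ≤ q) ∧
    ((∃ P : Fin 8 → ProjPlane K, InGeneralPosition P) ↔ q = 16 ∨ 19 ≤ q) := by
  subst hq
  rw [PlanePoints.exists_vecGP_iff (by norm_num), PlanePoints.exists_vecGP_iff (by norm_num)]
  have h7 : (∃ v : Fin 7 → Fin 3 → K, PlanePoints.VecGP v) → 9 ≤ Nat.card K := by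
    rintro ⟨v, hv⟩
    by_contra! h
    exact PlanePoints.not_vecGP_seven (by omega) v hv
  refine ⟨⟨h7, fun h => ?_⟩, fun h => ?_, fun h => ?_⟩
  · rcases PlanePoints.card_cases h with h | ⟨-, h⟩
    · exact PlanePoints.exists_seven_vecGP h
    · exact PlanePoints.exists_seven_of_eight h
  · rcases PlanePoints.card_cases (h7 (PlanePoints.exists_seven_of_eight h)) with h' | ⟨h', -⟩
    · obtain ⟨v, hv⟩ := h
      exact absurd hv (PlanePoints.not_vecGP_eight h' v)
    · exact h'
  · rcases PlanePoints.card_cases (by omega : 8 < Nat.card K) with h' | ⟨-, h'⟩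
    · omega
    · exact h'
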